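/- Let $d\ge1$, $\mathbb T^d=\mathbb R^d/\mathbb Z^d$ with Haar probability $dx$, $m\in(0,1)$, $p>(d+2)/2$, $\sigma(\rho)=\rho(1-\rho)$ for $\rho\in[0,1]$. Let $\mathcal M_+$ be the set of positive measures on $\mathbb T^d$ of mass at most $1$ with the weak topology, and let $\mathcal H^d_{-p}$ be the Sobolev space of vector-valued distributions $J$ on $\mathbb T^d$ with $\sum_{n\in\mathbb Z^d}(1+4\pi^2|n|^2)^{-p}|\widehat J(n)|^2<\infty$. Let $\mathcal S$ be the set of pairs $(\boldsymbol\pi,\boldsymbol J)\in D(\mathbb R;\mathcal M_+)\times D(\mathbb R;\mathcal H^d_{-p})$ (right-continuous paths with left limits, Skorohod topologies, Borel $\sigma$-algebra) which satisfy the continuity equation $$\int_s^t\!ds_1\int_{s_1}^t\!ds_2\,\big\{\langle\boldsymbol\pi(s_2)-\boldsymbol\pi(s_1),f\rangle-\langle\boldsymbol J(s_2)-\boldsymbol J(s_1),\nabla f\rangle\big\}=0\qquad\text{for all }s<t,\ f\in C^\infty(\mathbb T^d).$$ For $t\in\mathbb R$ let $\vartheta_t(\boldsymbol\pi,\boldsymbol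 J)(s)=(\boldsymbol\pi(s-t),\boldsymbol J(s-t)-\boldsymbol J(-t))$. Let $\mathcal P_{{\rm stat},m}$ be the set of Borel probability measures on $\mathcal S$ that are invariant under all $\vartheta_t$ and concentrated on paths with $\boldsymbol\pi(t,\mathbb T^d)=m$ for all $t$. Let $E\colon\mathbb T^d\to\mathbb R^d$ be a vector field. For $T>0$ define the action by $$A_{m,T}(\boldsymbol\pi,\boldsymbol J)=\int_0^T\!dt\int_{\mathbb T^d}\!dx\,\frac{|\boldsymbol j+\nabla\boldsymbol\rho-\sigma(\boldsymbol\rho)E|^2}{4\sigma(\boldsymbol\rho)}$$ if $\boldsymbol\pi(t,\mathbb T^d)=m$ for all $t$, $\boldsymbol\pi$ and $\boldsymbol J$ are continuous, $\boldsymbol\pi(t,dx)=\boldsymbol\rho(t,x)\,dx$ with $0\le\boldsymbol\rho\le1$, $\boldsymbol J(t)=\int_0^t\boldsymbol j(s)\,ds$, $\boldsymbol\rho(t,\cdot)$ has a weak gradient for a.e. $t$, and $\int_{-S}^S dt\int dx\,(|\nabla\boldsymbol\rho|^2+|\boldsymbol j|^2)/\sigma(\boldsymbol\rho)<\infty$ for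 every $S>0$; set $A_{m,T}=+\infty$ otherwise. Here and below, in quotients by $\sigma$, $0/0=0$ and $c/0=+\infty$ for $c>0$. Put $\boldsymbol I_m(P)=\frac1T E_P[A_{m,T}]$, which for $\vartheta$-invariant $P$ does not depend on $T>0$, and for $\pi\in\mathcal M_+$ $$I^{(1)}_m(\pi)=\inf\big\{\boldsymbol I_m(P)\;:\;P\in\mathcal P_{{\rm stat},m},\ E_P[\boldsymbol\pi(t)]=\pi\text{ for all }t\big\}\in[0,+\infty],\qquad \inf\emptyset=+\infty.$$ **Theorem.** Suppose $E=-\nabla U$ with $U\in C^2(\mathbb T^d)$. Then $I^{(1)}_m=\mathrm{co}(\mathcal V_m)$ on $\mathcal M_+$, where $$\mathcal V_m(\pi)=\int_{\mathbb T^d}\frac{|\nabla\rho+\sigma(\rho)\nabla U|^2}{4\sigma(\rho)}\,dx$$ if $\pi(\mathbb T^d)=m$ and $\pi(dx)=\rho\,dx$ with $0\le\rho\le1$ and $\rho$ weakly differentiable, $\mathcal V_m(\pi)=+\infty$ otherwise, and where the convex hull $\mathrm{co}(\mathcal V_m)$ is the largest convex function $\mathcal M_+\to[0,+\infty]$ that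 is at most $\mathcal V_m$. -/

import Mathlib

open MeasureTheory Set Filter Topology
open scoped ENNReal NNReal Uniformity ComplexConjugate

noncomputable section

namespace WASEP

/-! ### Calculus on the torus -/

/-- The `d`-dimensional torus of side length one; its `volume` is the normalised Haar measure. -/
abbrev Torus (d : ℕ) : Type := UnitAddTorus (Fin d)

/-- `f` is of class `C^n` on the torus: its periodic lift to `ℝ^d` is of class `C^n`. -/
def TorusContDiff {d : ℕ} (n : ℕ∞) (f : Torus d → ℝ) : Prop :=
  ContDiff ℝ n (fun x : Fin d → ℝ => f (fun i => (x i : UnitAddCircle)))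

/-- The `k`-th partial derivative of a function on the torus. -/
def pderiv {d : ℕ} (k : Fin d) (f : Torus d → ℝ) (x : Torus d) : ℝ :=
  deriv (fun s : ℝ => f (x + Pi.single k (s : UnitAddCircle))) 0

/-- The gradient of a function on the torus. -/
def grad {d : ℕ} (f : Torus d → ℝ) (x : Torus d) : EuclideanSpace ℝ (Fin d) :=
  WithLp.toLp 2 (fun k => pderiv k f x)

/-- The integrable vector field `g` is the weak gradient of the integrable function `u`. -/
def HasWeakGradient {d : ℕ} (u : Torus d → ℝ) (g : Torus d → EuclideanSpace ℝ (Fin d)) : Prop :=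
  Integrable u ∧ Integrable g ∧
    ∀ φ : Torus d → ℝ, TorusContDiff ⊤ φ → ∀ k : Fin d,
      ∫ x, u x * pderiv k φ x = - ∫ x, g x k * φ x

/-- The `n`-th Fourier coefficient `∫ f(x) exp(-2πi n·x) dx` of a real function on the torus. -/
def torusFourierCoeff {d : ℕ} (f : Torus d → ℝ) (n : Fin d → ℤ) : ℂ :=
  ∫ x, (f x : ℂ) * conj (UnitAddTorus.mFourier n x)

/-! ### Measures of mass at most one -/

/-- The positive measures on the torus of total mass at most one, with the weak topology
(inherited from `FiniteMeasure`). -/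
def MPlus (d : ℕ) : Set (FiniteMeasure (Torus d)) := {μ | μ.mass ≤ 1}

theorem mplus_topology_eq (d : ℕ) :
    (instTopologicalSpaceSubtype : TopologicalSpace (MPlus d)) =
      (UniformSpace.comap (fun (μ : MPlus d) (f : BoundedContinuousFunction (Torus d) ℝ) =>
        ∫ x, f x ∂((μ : FiniteMeasure (Torus d)) : Measure (Torus d)))
        inferInstance).toTopologicalSpace := by
  apply TopologicalSpace.ext_nhds
  intro μ
  have key : ∀ l : Filter (MPlus d), l ≤ @nhds _ instTopologicalSpaceSubtype μ ↔
      l ≤ Filter.comap (fun (μ : MPlus d) (f : BoundedContinuousFunction (Torus d) ℝ) =>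
        ∫ x, f x ∂((μ : FiniteMeasure (Torus d)) : Measure (Torus d)))
        (𝓝 (fun f => ∫ x, f x ∂((μ : FiniteMeasure (Torus d)) : Measure (Torus d)))) := by
    intro l
    rw [← Filter.tendsto_iff_comap, nhds_subtype_eq_comap, ← Filter.map_le_iff_le_comap,
      tendsto_pi_nhds]
    exact FiniteMeasure.tendsto_iff_forall_integral_tendsto
      (F := l) (μs := fun ν : MPlus d => (ν : FiniteMeasure (Torus d))) (μ := μ)
  have h2 := nhds_induced (fun (μ : MPlus d) (f : BoundedContinuousFunction (Torus d) ℝ) =>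
        ∫ x, f x ∂((μ : FiniteMeasure (Torus d)) : Measure (Torus d))) μ
  refine Eq.trans ?_ h2.symm
  exact le_antisymm ((key _).1 le_rfl) ((key _).2 le_rfl)

/-- The uniform structure of the weak topology: the coarsest one for which all the maps
`μ ↦ ∫ f dμ`, `f` continuous, are uniformly continuous. -/
instance instUniformSpaceMPlus (d : ℕ) : UniformSpace (MPlus d) :=
  (UniformSpace.comap (fun (μ : MPlus d) (f : BoundedContinuousFunction (Torus d) ℝ) =>
    ∫ x, f x ∂((μ : FiniteMeasure (Torus d)) : Measure (Torus d))) inferInstance).replaceTopology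
    (mplus_topology_eq d)

/-! ### Sobolev spaces -/

/-- The weights `(1 + 4π²|n|²)^q` on the Fourier modes `n ∈ ℤ^d`. -/
def sobolevWeight (d : ℕ) (q : ℝ) : Measure (Fin d → ℤ) :=
  Measure.count.withDensity
    (fun n => ENNReal.ofReal ((1 + 4 * Real.pi ^ 2 * ∑ i, (n i : ℝ) ^ 2) ^ q))

/-- The Sobolev space `H_q^d` of (complex) vector-valued distributions on the torus, an element
being given by its Fourier coefficients: it is the Hilbert space of the families
`J : ℤ^d → ℂ^d` with `‖J‖² = ∑ n, (1 + 4π²|n|²)^q |J n|² < ∞`. -/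
abbrev SobolevField (d : ℕ) (q : ℝ) : Type :=
  Lp (EuclideanSpace ℂ (Fin d)) 2 (sobolevWeight d q)

/-- The duality pairing of a distribution with a smooth real vector field `F`. -/
def pairing {d : ℕ} {q : ℝ} (J : SobolevField d q) (F : Torus d → EuclideanSpace ℝ (Fin d)) : ℂ :=
  ∑' n : Fin d → ℤ, ∑ k : Fin d, J n k * conj (torusFourierCoeff (fun x => F x k) n)

/-! ### The Skorohod space on the real line -/

/-- The right-continuous functions with left limits from `ℝ` to `S`. -/
structure Cadlag (S : Type*) [TopologicalSpace S] where
  toFun : ℝ → S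
  right_cont : ∀ t, ContinuousWithinAt toFun (Ici t) t
  left_lim : ∀ t, ∃ l, Tendsto toFun (𝓝[<] t) (𝓝 l)

instance {S : Type*} [TopologicalSpace S] : CoeFun (Cadlag S) (fun _ => ℝ → S) := ⟨Cadlag.toFun⟩

/-- The basic neighbourhoods of the Skorohod topology: the paths that are uniformly `V`-close
to `f` on `[-T, T]` after a time change which is `ε`-close to the identity there. -/
def skorohodNhd {S : Type*} [UniformSpace S] (f : Cadlag S) (T ε : ℝ) (V : Set (S × S)) :
    Set (Cadlag S) :=
  {g | ∃ l : ℝ ≃o ℝ, ∀ t, |t| ≤ T → |l t - t| < ε ∧ (f t, g (l t)) ∈ V}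

theorem skorohodNhd_mono {S : Type*} [UniformSpace S] (f : Cadlag S) {T T' ε ε' : ℝ}
    {V V' : Set (S × S)} (hT : T ≤ T') (hε : ε' ≤ ε) (hV : V' ⊆ V) :
    skorohodNhd f T' ε' V' ⊆ skorohodNhd f T ε V := by
  rintro g ⟨l, hl⟩
  exact ⟨l, fun t ht => ⟨(hl t (ht.trans hT)).1.trans_le hε, hV (hl t (ht.trans hT)).2⟩⟩

/-- The Skorohod (J1) topology: `g → f` when there are increasing homeomorphisms `l` of `ℝ`
with `l → id` and `g ∘ l → f` uniformly on bounded intervals. -/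
instance instTopologicalSpaceCadlag {S : Type*} [UniformSpace S] :
    TopologicalSpace (Cadlag S) where
  IsOpen O := ∀ f ∈ O, ∃ T > 0, ∃ ε > 0, ∃ V ∈ 𝓤 S, skorohodNhd f T ε V ⊆ O
  isOpen_univ := fun _ _ => ⟨1, one_pos, 1, one_pos, univ, univ_mem, subset_univ _⟩
  isOpen_inter := by
    rintro O O' h h' f ⟨hf, hf'⟩
    obtain ⟨T, hT, ε, hε, V, hV, hO⟩ := h f hf
    obtain ⟨T', hT', ε', hε', V', hV', hO'⟩ := h' f hf'
    exact ⟨max T T', lt_max_of_lt_left hT, min ε ε', lt_min hε hε', V ∩ V', inter_mem hV hV',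
      subset_inter
        ((skorohodNhd_mono f (le_max_left _ _) (min_le_left _ _) inter_subset_left).trans hO)
        ((skorohodNhd_mono f (le_max_right _ _) (min_le_right _ _) inter_subset_right).trans hO')⟩
  isOpen_sUnion := by
    rintro s hs f ⟨O, hO, hf⟩
    obtain ⟨T, hT, ε, hε, V, hV, h⟩ := hs O hO f hf
    exact ⟨T, hT, ε, hε, V, hV, h.trans (subset_sUnion_of_mem hO)⟩

/-- The shifted path `s ↦ f (s - t)`. -/
def Cadlag.shift {S : Type*} [TopologicalSpace S] (t : ℝ) (f : Cadlag S) : Cadlag S where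
  toFun s := f (s - t)
  right_cont s := by
    refine ContinuousWithinAt.comp (t := Ici (s - t)) (f.right_cont (s - t))
      (by fun_prop) ?_
    intro r hr
    simpa using hr
  left_lim s := by
    obtain ⟨l, hl⟩ := f.left_lim (s - t)
    refine ⟨l, hl.comp ?_⟩
    refine tendsto_nhdsWithin_iff.2 ⟨?_, ?_⟩
    · exact ((continuous_sub_right t).tendsto s).mono_left nhdsWithin_le_nhds
    · filter_upwards [self_mem_nhdsWithin] with r hr
      simpa using hr

/-- The path `s ↦ f s - c`. -/
def Cadlag.subConst {S : Type*} [TopologicalSpace S] [AddGroup S] [ContinuousSub S]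
    (c : S) (f : Cadlag S) : Cadlag S where
  toFun s := f s - c
  right_cont s := (f.right_cont s).sub continuousWithinAt_const
  left_lim s := by
    obtain ⟨l, hl⟩ := f.left_lim s
    exact ⟨l - c, hl.sub tendsto_const_nhds⟩

/-! ### Paths of density and integrated current -/

/-- The pairs (density path, integrated current path) that satisfy the continuity equation. -/
structure PathSpace (d : ℕ) (p : ℝ) where
  dens : Cadlag (MPlus d)
  curr : Cadlag (SobolevField d (-p))
  continuity_eq : ∀ s t : ℝ, s < t → ∀ f : Torus d → ℝ, TorusContDiff ⊤ f →
    ∫ s₁ in s..t, ∫ s₂ in s₁..t,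
      (((∫ x, f x ∂((dens s₂ : FiniteMeasure (Torus d)) : Measure (Torus d)) : ℝ) : ℂ)
        - ((∫ x, f x ∂((dens s₁ : FiniteMeasure (Torus d)) : Measure (Torus d)) : ℝ) : ℂ)
        - pairing (curr s₂ - curr s₁) (grad f)) = 0

/-- The topology inherited from the product of the two Skorohod spaces. -/
instance instTopologicalSpacePathSpace (d : ℕ) (p : ℝ) : TopologicalSpace (PathSpace d p) :=
  TopologicalSpace.induced (fun z => (z.dens, z.curr)) inferInstance

instance instMeasurableSpacePathSpace (d : ℕ) (p : ℝ) : MeasurableSpace (PathSpace d p) :=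
  borel _

instance instBorelSpacePathSpace (d : ℕ) (p : ℝ) : BorelSpace (PathSpace d p) := ⟨rfl⟩

/-- The time translation: `s ↦ π(s - t)` and `s ↦ J(s - t) - J(-t)`. -/
def timeShift {d : ℕ} {p : ℝ} (t : ℝ) (z : PathSpace d p) : PathSpace d p where
  dens := z.dens.shift t
  curr := (z.curr.shift t).subConst (z.curr (-t))
  continuity_eq := by
    intro s r hsr f hf
    have h := z.continuity_eq (s - t) (r - t) (by linarith) f hf
    rw [← intervalIntegral.integral_comp_sub_right
      (fun s₁ => ∫ s₂ in s₁..(r - t),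
        (((∫ x, f x ∂((z.dens s₂ : FiniteMeasure (Torus d)) : Measure (Torus d)) : ℝ) : ℂ)
        - ((∫ x, f x ∂((z.dens s₁ : FiniteMeasure (Torus d)) : Measure (Torus d)) : ℝ) : ℂ)
        - pairing (z.curr s₂ - z.curr s₁) (grad f))) t] at h
    rw [← h]
    refine intervalIntegral.integral_congr fun s₁ _ => ?_
    simp only [Cadlag.shift, Cadlag.subConst, sub_sub_sub_cancel_right]
    rw [← intervalIntegral.integral_comp_sub_right (a := s₁) (b := r)
      (fun s₂ =>
        (((∫ x, f x ∂((z.dens s₂ : FiniteMeasure (Torus d)) : Measure (Torus d)) : ℝ) : ℂ)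
        - ((∫ x, f x ∂((z.dens (s₁ - t) : FiniteMeasure (Torus d)) : Measure (Torus d)) : ℝ) : ℂ)
        - pairing (z.curr s₂ - z.curr (s₁ - t)) (grad f))) t]

/-- The paths whose density has total mass `m` at every time. -/
def massPaths (d : ℕ) (p m : ℝ) : Set (PathSpace d p) :=
  {z | ∀ t, ((z.dens t : FiniteMeasure (Torus d)).mass : ℝ) = m}

/-! ### Action and rate functions -/

/-- The mobility of the exclusion process. -/
def mobility (a : ℝ) : ℝ := a * (1 - a)

/-- The quotient `|v|² / b` in `[0, ∞]`, with `0 / 0 = 0` and `c / 0 = ∞` for `c > 0`. -/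
def sqQuot {d : ℕ} (v : EuclideanSpace ℝ (Fin d)) (b : ℝ) : ℝ≥0∞ :=
  ENNReal.ofReal (‖v‖ ^ 2) / ENNReal.ofReal b

/-- The path `z` has mass `m`, is absolutely continuous with density `ρ`, weak space gradient
`g = ∇ρ` and current density `j`, and these have locally finite energy. By the continuity in time
and the uniqueness of densities, `ρ`, `g` and `j` are determined by `z` up to null sets. -/
structure HasDensities {d : ℕ} {p : ℝ} (m : ℝ) (z : PathSpace d p) (ρ : ℝ → Torus d → ℝ)
    (g j : ℝ → Torus d → EuclideanSpace ℝ (Fin d)) : Prop where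
  mass_eq : z ∈ massPaths d p m
  measurable_density : Measurable (Function.uncurry ρ)
  measurable_gradient : Measurable (Function.uncurry g)
  measurable_current : Measurable (Function.uncurry j)
  continuous_dens : Continuous z.dens
  density_mem : ∀ t x, ρ t x ∈ Icc (0 : ℝ) 1
  dens_eq : ∀ t, ((z.dens t : FiniteMeasure (Torus d)) : Measure (Torus d)) =
    volume.withDensity (fun x => ENNReal.ofReal (ρ t x))
  weak_gradient : ∀ᵐ t : ℝ, HasWeakGradient (ρ t) (g t)
  gradient_energy : ∀ T > 0,
    ∫⁻ t in Icc (-T) T, ∫⁻ x, sqQuot (g t x) (mobility (ρ t x)) < ∞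
  continuous_curr : Continuous z.curr
  curr_eq : ∀ t n k, z.curr t n k = ∫ s in (0 : ℝ)..t, torusFourierCoeff (fun x => j s x k) n
  current_energy : ∀ T > 0,
    ∫⁻ t in Icc (-T) T, ∫⁻ x, sqQuot (j t x) (mobility (ρ t x)) < ∞

/-- The action on the time interval `[0, T]` with external field `E`. It is `∞` if the path does
not have densities; otherwise the infimum runs over a single value. -/
def action {d : ℕ} {p : ℝ} (m T : ℝ) (E : Torus d → EuclideanSpace ℝ (Fin d))
    (z : PathSpace d p) : ℝ≥0∞ :=
  ⨅ (ρ : ℝ → Torus d → ℝ) (g : ℝ → Torus d → EuclideanSpace ℝ (Fin d))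
    (j : ℝ → Torus d → EuclideanSpace ℝ (Fin d)) (_ : HasDensities m z ρ g j),
    ∫⁻ t in Icc 0 T, ∫⁻ x,
      sqQuot (j t x + g t x - mobility (ρ t x) • E x) (4 * mobility (ρ t x))

/-- The probability measures on the path space that are invariant under time translations. -/
def stationary (d : ℕ) (p : ℝ) : Set (ProbabilityMeasure (PathSpace d p)) :=
  {P | ∀ t, MeasurePreserving (timeShift t) (P : Measure (PathSpace d p)) P}

/-- The stationary probability measures concentrated on the paths of mass `m`. -/
def stationaryMass (d : ℕ) (p m : ℝ) : Set (ProbabilityMeasure (PathSpace d p)) :=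
  {P | P ∈ stationary d p ∧ ∀ᵐ z ∂(P : Measure (PathSpace d p)), z ∈ massPaths d p m}

/-- The level-three rate function: the expected action per unit of time. On stationary measures it
does not depend on `T > 0`. -/
def levelThreeRate {d : ℕ} {p : ℝ} (m T : ℝ) (E : Torus d → EuclideanSpace ℝ (Fin d))
    (P : ProbabilityMeasure (PathSpace d p)) : ℝ≥0∞ :=
  (ENNReal.ofReal T)⁻¹ * ∫⁻ z, action m T E z ∂(P : Measure (PathSpace d p))

/-- The expected density `E_P[π(t)]` is the measure `μ`, for every time `t`. -/
def HasMeanDensity {d : ℕ} {p : ℝ} (P : ProbabilityMeasure (PathSpace d p))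
    (μ : FiniteMeasure (Torus d)) : Prop :=
  ∀ t : ℝ, ∀ f : C(Torus d, ℝ),
    ∫ z, (∫ x, f x ∂((z.dens t : FiniteMeasure (Torus d)) : Measure (Torus d)))
      ∂(P : Measure (PathSpace d p)) = ∫ x, f x ∂(μ : Measure (Torus d))

/-- The projection on the density of the level-one rate function. -/
def levelOneDensityRate {d : ℕ} (p m T : ℝ) (E : Torus d → EuclideanSpace ℝ (Fin d))
    (μ : FiniteMeasure (Torus d)) : ℝ≥0∞ :=
  ⨅ P ∈ {P : ProbabilityMeasure (PathSpace d p) | P ∈ stationaryMass d p m ∧ HasMeanDensity P μ},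
    levelThreeRate m T E P

/-- The measure `μ` has mass `m` and a density `ρ` with values in `[0, 1]` and weak gradient `g`. -/
def HasProfile {d : ℕ} (m : ℝ) (μ : FiniteMeasure (Torus d)) (ρ : Torus d → ℝ)
    (g : Torus d → EuclideanSpace ℝ (Fin d)) : Prop :=
  (μ.mass : ℝ) = m ∧ Measurable ρ ∧ (∀ x, ρ x ∈ Icc (0 : ℝ) 1) ∧
    (μ : Measure (Torus d)) = volume.withDensity (fun x => ENNReal.ofReal (ρ x)) ∧
    HasWeakGradient ρ g

/-- The functional `∫ |∇ρ + σ(ρ) ∇U|² / (4 σ(ρ)) dx`, equal to `∞` if `μ` has no density with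
values in `[0, 1]` and a weak gradient, or does not have mass `m`. -/
def fisherFunctional {d : ℕ} (m : ℝ) (U : Torus d → ℝ) (μ : FiniteMeasure (Torus d)) : ℝ≥0∞ :=
  ⨅ (ρ : Torus d → ℝ) (g : Torus d → EuclideanSpace ℝ (Fin d)) (_ : HasProfile m μ ρ g),
    ∫⁻ x, sqQuot (g x + mobility (ρ x) • grad U x) (4 * mobility (ρ x))

/-- The convex hull of `V : s → [0, ∞]`: the largest convex function on `s` below `V`. -/
def convexHullFun {F : Type*} [AddCommMonoid F] [Module ℝ≥0 F] (s : Set F) (V : F → ℝ≥0∞)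
    (μ : F) : ℝ≥0∞ :=
  ⨆ f ∈ {f : F → ℝ≥0∞ | ConvexOn ℝ≥0 s f ∧ ∀ ν ∈ s, f ν ≤ V ν}, f μ

end WASEP

end

/-! Write V for `fisherFunctional` and I for `levelOneDensityRate`.

I ≤ co(V). The function I is convex, because a mixture of stationary laws is stationary with the
mixed mean density and `levelThreeRate` is affine in the law (`convexOn_levelOneDensityRate`). It
lies below V, because the Dirac mass at a path that rests at a profile with zero current is
stationary and its action is T V (`levelOneDensityRate_le_fisherFunctional`). Hence I is one of the
convex functions whose supremum is co(V).

co(V) ≤ I. Let f be convex with f ≤ V, and let P be stationary with mean density μ. For E = -∇U the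
integrand of the action is |∇ρ + σ∇U|²/4σ + |j|²/4σ + j·(∇ρ/σ + ∇U)/2. The vector ∇ρ/σ + ∇U is the
gradient of log(ρ/(1-ρ)) + U, the derivative of the free energy density, so by the continuity
equation the last term integrates to half the increment of the free energy between the times 0 and
T. Dropping |j|² gives ∫ V(ρ_t) dt + (F(ρ_T) - F(ρ_0))/2 ≤ action
(`HasDensities.fisher_add_freeEnergy_le`). The free energy is bounded, so its increment has mean
zero under P, and the mean action per unit time is at least the mean of V(π(0)). The formal
computation is justified on smoothed fields: density, gradient and current are convolved with a
nonnegative kernel and the density is mixed with the constant 1/2. This respects the continuity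
equation, keeps the density away from 0 and 1, and by Jensen's inequality does not increase the
quotients; lower semicontinuity then removes the smoothing.

It remains to bound f(μ) by the mean of V(π(0)), whose barycentre is μ. Since f is neither
measurable nor lower semicontinuous, Jensen's inequality is available for finite combinations only.
Integration by parts gives V = ∫ |∇ρ|²/4σ - ∫ ρ ΔU/2 + ∫ σ(ρ)|∇U|²/4, a convex, a linear and a
concave term. The first two obey Jensen's inequality under any law. The third is almost constant on
a set of measures whose mollifications are uniformly close. Finitely many such cells cover all
measures of mass at most one (`WeaklyMeasurable.exists_partition`). Conditioning P on the cells
writes μ as a finite convex combination of barycentres, and convexity of f, the bound f ≤ V and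
Jensen's inequality inside each cell give the claim up to an error that vanishes with the cell size
and the mollification (`WeaklyMeasurable.convexOn_add_const_le`).

To avoid a measurable choice of densities, the functionals of a measure (`fisherInformation`,
`lowerRate`, `measureFreeEnergy`) are defined through its convolutions. The action itself is never
shown to be measurable; monotonicity of the integral suffices. -/

noncomputable section

namespace WASEP

/-! ### The Skorohod topology -/

section Skorohod

variable {S : Type*} [UniformSpace S]

/-- Openness is defined by what a set contains around each of its points, so an open set inside
`skorohodNhd` has to be exhibited. It consists of the paths that have a whole basic neighbourhood
inside; it is open because time changes compose and an entourage contains the square of another one.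
-/
theorem skorohodNhd_mem_nhds (f : Cadlag S) {T ε : ℝ} (hε : 0 < ε) {V : Set (S × S)}
    (hV : V ∈ 𝓤 S) : skorohodNhd f T ε V ∈ 𝓝 f := by
  rw [mem_nhds_iff]
  refine ⟨{g | ∃ T' ε', 0 < ε' ∧ ∃ V' ∈ 𝓤 S, skorohodNhd g T' ε' V' ⊆ skorohodNhd f T ε V},
    ?_, ?_, ?_⟩
  · rintro g ⟨T', ε', hε', V', hV', h⟩
    refine h ⟨OrderIso.refl ℝ, fun t _ => ?_⟩
    simpa using ⟨hε', refl_mem_uniformity hV'⟩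
  · rintro g ⟨T', ε', hε', V', hV', h⟩
    obtain ⟨W, hW, hWV⟩ := comp_mem_uniformity_sets hV'
    refine ⟨max T' 1, by positivity, ε' / 2, by positivity, W, hW, ?_⟩
    rintro g₁ ⟨l, hl⟩
    -- The first time change moves the window outwards by at most ε'/2, so the second is controlled
    -- on a larger window; the two displacements add up to less than ε'. The maximum with 1 keeps
    -- the window length positive.
    refine ⟨max T' 1 + ε', ε' / 2, by positivity, W, hW, ?_⟩
    rintro g₂ ⟨l', hl'⟩
    refine h ⟨l.trans l', fun t ht => ?_⟩
    have h1 := hl t (ht.trans (le_max_left _ _))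
    have h2 : |l t| ≤ max T' 1 + ε' := by
      have := abs_add_le (l t - t) t
      rw [sub_add_cancel] at this
      have := ht.trans (le_max_left T' 1)
      linarith [h1.1]
    have h3 := hl' _ h2
    refine ⟨?_, hWV ⟨g₁ (l t), h1.2, h3.2⟩⟩
    have := abs_add_le (l' (l t) - l t) (l t - t)
    rw [sub_add_sub_cancel] at this
    simp only [OrderIso.trans_apply]
    linarith [h1.1, h3.1]
  · exact ⟨T, ε, hε, V, hV, subset_rfl⟩

theorem mem_nhds_cadlag_iff (f : Cadlag S) (A : Set (Cadlag S)) :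
    A ∈ 𝓝 f ↔ ∃ T > 0, ∃ ε > 0, ∃ V ∈ 𝓤 S, skorohodNhd f T ε V ⊆ A := by
  constructor
  · intro h
    obtain ⟨O, hOA, hO, hf⟩ := mem_nhds_iff.1 h
    obtain ⟨T, hT, ε, hε, V, hV, hsub⟩ := hO f hf
    exact ⟨T, hT, ε, hε, V, hV, hsub.trans hOA⟩
  · rintro ⟨T, _, ε, hε, V, hV, hsub⟩
    exact mem_of_superset (skorohodNhd_mem_nhds f hε hV) hsub

theorem continuous_cadlag_shift (t : ℝ) : Continuous (Cadlag.shift t : Cadlag S → Cadlag S) := by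
  rw [continuous_iff_continuousAt]
  intro f A hA
  obtain ⟨T, hT, ε, hε, V, hV, hsub⟩ := (mem_nhds_cadlag_iff _ _).1 hA
  refine (mem_nhds_cadlag_iff _ _).2 ⟨T + |t|, by positivity, ε, hε, V, hV, ?_⟩
  rintro g ⟨l, hl⟩
  refine hsub ⟨((OrderIso.subRight t).trans l).trans (OrderIso.addRight t), fun s hs => ?_⟩
  have h1 := hl (s - t) (by have := abs_sub s t; linarith)
  simp only [OrderIso.trans_apply, OrderIso.subRight_apply, OrderIso.addRight_apply, Cadlag.shift]
  refine ⟨by convert h1.1 using 2; ring, ?_⟩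
  simpa using h1.2

theorem continuous_cadlag_subConst {H : Type*} [NormedAddCommGroup H] :
    Continuous (fun q : Cadlag H × H => Cadlag.subConst q.2 q.1) := by
  rw [continuous_iff_continuousAt]
  rintro ⟨f, c⟩ A hA
  obtain ⟨T, hT, ε, hε, V, hV, hsub⟩ := (mem_nhds_cadlag_iff _ _).1 hA
  obtain ⟨r, hr, hrV⟩ := Metric.mem_uniformity_dist.1 hV
  rw [Filter.mem_map, nhds_prod_eq]
  refine mem_of_superset (prod_mem_prod
    (skorohodNhd_mem_nhds f (T := T) hε (Metric.dist_mem_uniformity (half_pos hr)))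
    (Metric.ball_mem_nhds c (half_pos hr))) ?_
  rintro ⟨g, c'⟩ ⟨⟨l, hl⟩, hc⟩
  refine hsub ⟨l, fun t ht => ⟨(hl t ht).1, hrV ?_⟩⟩
  have h1 := (hl t ht).2
  simp only [mem_ofPred_eq, Metric.mem_ball, Cadlag.subConst] at h1 hc ⊢
  calc dist (f t - c) (g (l t) - c') ≤ dist (f t) (g (l t)) + dist c c' := dist_sub_sub_le _ _ _ _
    _ < r := by rw [dist_comm c]; linarith

/-- The image of a path under a uniformly continuous map. -/
def Cadlag.map {E : Type*} [UniformSpace E] (φ : S → E) (hφ : UniformContinuous φ)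
    (f : Cadlag S) : Cadlag E where
  toFun s := φ (f s)
  right_cont s := hφ.continuous.continuousAt.comp_continuousWithinAt (f.right_cont s)
  left_lim s := by
    obtain ⟨l, hl⟩ := f.left_lim s
    exact ⟨φ l, (hφ.continuous.tendsto l).comp hl⟩

theorem continuous_cadlag_map {E : Type*} [UniformSpace E] (φ : S → E)
    (hφ : UniformContinuous φ) : Continuous (Cadlag.map φ hφ) := by
  rw [continuous_iff_continuousAt]
  intro f A hA
  obtain ⟨T, hT, ε, hε, V, hV, hsub⟩ := (mem_nhds_cadlag_iff _ _).1 hA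
  refine (mem_nhds_cadlag_iff _ _).2 ⟨T, hT, ε, hε, _, hφ hV, ?_⟩
  rintro g ⟨l, hl⟩
  exact hsub ⟨l, hl⟩

end Skorohod

/-! ### Right-continuous functions -/

/-- The point of the grid of mesh `1 / (n + 1)` to the right of `t`. -/
def gridRight (n : ℕ) (t : ℝ) : ℝ := (⌊t * (n + 1)⌋ + 1) / (n + 1)

theorem lt_gridRight (n : ℕ) (t : ℝ) : t < gridRight n t := by
  rw [gridRight, lt_div_iff₀ (by positivity)]
  exact Int.lt_floor_add_one _

theorem tendsto_gridRight (t : ℝ) : Tendsto (fun n => gridRight n t) atTop (𝓝[≥] t) := by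
  refine tendsto_nhdsWithin_iff.2 ⟨?_, Eventually.of_forall fun n => (lt_gridRight n t).le⟩
  have h : Tendsto (fun n : ℕ => t + 1 / ((n : ℝ) + 1)) atTop (𝓝 (t + 0)) :=
    tendsto_const_nhds.add tendsto_one_div_add_atTop_nhds_zero_nat
  rw [add_zero] at h
  refine tendsto_of_tendsto_of_tendsto_of_le_of_le tendsto_const_nhds h
    (fun n => (lt_gridRight n t).le) fun n => ?_
  have hn : (0 : ℝ) < n + 1 := by positivity
  simp only [gridRight]
  rw [div_le_iff₀ hn, add_mul, one_div, inv_mul_cancel₀ hn.ne']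
  linarith [Int.floor_le (t * (n + 1))]

/-- A function that is measurable in `z` and right-continuous in `t` is jointly measurable. -/
theorem measurable_uncurry_of_rightCont {Z E : Type*} [MeasurableSpace Z] [TopologicalSpace E]
    [TopologicalSpace.PseudoMetrizableSpace E] [MeasurableSpace E] [BorelSpace E] (F : ℝ → Z → E)
    (hm : ∀ t, Measurable (F t)) (hc : ∀ z t, ContinuousWithinAt (fun t => F t z) (Ici t) t) :
    Measurable (Function.uncurry F) := by
  refine measurable_of_tendsto_metrizable (f := fun n q => F (gridRight n q.1) q.2) ?_ ?_
  · intro n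
    -- At a fixed mesh only countably many times occur, so measurability in z at each of them is
    -- enough.
    have h1 : Measurable (fun q : ℤ × Z => F ((q.1 + 1) / (n + 1)) q.2) :=
      measurable_from_prod_countable_right fun k => hm ((k + 1) / (n + 1))
    exact h1.comp (f := fun q : ℝ × Z => ((⌊q.1 * (n + 1)⌋ : ℤ), q.2))
      ((Int.measurable_floor.comp (measurable_fst.mul_const _)).prodMk measurable_snd)
  · rw [tendsto_pi_nhds]
    rintro ⟨t, z⟩
    exact (hc z t).tendsto.comp (tendsto_gridRight t)

section Real

variable {E : Type*} [NormedAddCommGroup E]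

theorem Cadlag.measurable [MeasurableSpace E] [BorelSpace E] (f : Cadlag E) :
    Measurable (f : ℝ → E) := by
  have h := measurable_uncurry_of_rightCont (Z := Unit) (fun t _ => f t)
    (fun t => measurable_const) (fun _ t => f.right_cont t)
  exact h.comp (f := fun t => (t, ())) (measurable_id.prodMk measurable_const)

/-- The left limit and right-continuity bound the path near each point; compactness of the interval
does the rest. -/
theorem Cadlag.exists_bound (f : Cadlag E) (a b : ℝ) : ∃ C, ∀ t ∈ Icc a b, ‖f t‖ ≤ C := by
  refine isCompact_Icc.induction_on (p := fun s => ∃ C, ∀ t ∈ s, ‖f t‖ ≤ C) ?_ ?_ ?_ ?_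
  · exact ⟨0, by simp⟩
  · rintro s t hst ⟨C, hC⟩
    exact ⟨C, fun x hx => hC x (hst hx)⟩
  · rintro s t ⟨C, hC⟩ ⟨D, hD⟩
    refine ⟨max C D, ?_⟩
    rintro x (hx | hx)
    · exact (hC x hx).trans (le_max_left _ _)
    · exact (hD x hx).trans (le_max_right _ _)
  · intro t _
    obtain ⟨l, hl⟩ := f.left_lim t
    have h1 : ∀ᶠ s in 𝓝[<] t, ‖f s‖ < ‖l‖ + 1 := hl.norm.eventually_lt_const (by linarith)
    have h2 : ∀ᶠ s in 𝓝[≥] t, ‖f s‖ < ‖f t‖ + 1 :=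
      (f.right_cont t).tendsto.norm.eventually_lt_const (by linarith)
    refine ⟨{s | ‖f s‖ ≤ max (‖l‖ + 1) (‖f t‖ + 1)}, ?_, _, fun s hs => hs⟩
    apply mem_nhdsWithin_of_mem_nhds
    rw [← nhdsLT_sup_nhdsGE]
    refine mem_sup.2 ⟨?_, ?_⟩
    · filter_upwards [h1] with s hs using hs.le.trans (le_max_left _ _)
    · filter_upwards [h2] with s hs using hs.le.trans (le_max_right _ _)

/-- Left jumps of size at least 1/(n+1) occur on a set whose points are isolated from the right,
since the path oscillates by less than that on some [t, u). Such a set is countable. -/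
theorem Cadlag.countable_not_continuousAt (f : Cadlag E) :
    {t | ¬ ContinuousAt f t}.Countable := by
  have h : {t | ¬ ContinuousAt f t} ⊆ ⋃ n : ℕ, {t | ∃ᶠ s in 𝓝[<] t, 1 / ((n : ℝ) + 1) ≤ dist (f s) (f t)} := by
    intro t ht
    by_contra hcon
    simp only [mem_iUnion, mem_ofPred_eq, not_exists, not_frequently, not_le] at hcon
    apply ht
    rw [ContinuousAt, ← nhdsLT_sup_nhdsGE]
    refine tendsto_sup.2 ⟨Metric.tendsto_nhds.2 fun ε hε => ?_, f.right_cont t⟩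
    obtain ⟨n, hn⟩ := exists_nat_one_div_lt hε
    exact (hcon n).mono fun s hs => hs.trans hn
  refine (countable_iUnion fun n => ?_).mono h
  set D := {t | ∃ᶠ s in 𝓝[<] t, 1 / ((n : ℝ) + 1) ≤ dist (f s) (f t)} with hD
  refine (countable_setOfPred_isolated_right_within (s := D)).mono fun t ht => ?_
  have h2 : ∀ᶠ s in 𝓝[≥] t, dist (f s) (f t) < 1 / ((n : ℝ) + 1) / 2 :=
    Metric.tendsto_nhds.1 (f.right_cont t) _ (by positivity)
  obtain ⟨u, hu, hus⟩ := mem_nhdsGE_iff_exists_Ico_subset.1 h2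
  refine ⟨ht, ?_⟩
  rw [← empty_mem_iff_bot, mem_nhdsWithin]
  refine ⟨Iio u, isOpen_Iio, hu, ?_⟩
  rintro s ⟨hsu, hsD, hts⟩
  refine hsD ?_
  filter_upwards [Ioo_mem_nhdsLT hts] with r hr
  have h3 := hus ⟨hr.1.le, hr.2.trans hsu⟩
  have h4 := hus ⟨(show t < s from hts).le, hsu⟩
  simp only [mem_ofPred_eq] at h3 h4
  have := dist_triangle_right (f r) (f s) (f t)
  rw [not_le]
  linarith

/-- Evaluation at a time is not continuous for the Skorohod topology, but time integrals are: a path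
is continuous off a countable set, so a time change near the identity moves it little in L¹. All
measurability on the path space rests on this. -/
theorem continuous_integral_cadlag [NormedSpace ℝ E] [SecondCountableTopology E]
    (a b : ℝ) : Continuous (fun f : Cadlag E => ∫ s in a..b, f s) := by
  borelize E
  have hint : ∀ (f : Cadlag E) (l : ℝ ≃o ℝ),
      IntervalIntegrable (fun s => f (l s)) volume a b := by
    intro f l
    have hmeas : AEStronglyMeasurable (fun s => f (l s)) (volume.restrict (uIoc a b)) :=
      (f.measurable.comp l.continuous.measurable).aestronglyMeasurable
    obtain ⟨C, hC⟩ := f.exists_bound (l (min a b)) (l (max a b))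
    refine intervalIntegrable_iff.2 (IntegrableOn.of_bound (C := C) (by simp) hmeas ?_)
    refine (ae_restrict_iff' measurableSet_uIoc).2 (Eventually.of_forall fun s hs => hC _ ?_)
    rw [uIoc] at hs
    exact ⟨l.monotone hs.1.le, l.monotone hs.2⟩
  rw [continuous_iff_continuousAt]
  intro f
  -- One unit of margin: the inverse of a time change with displacement at most 1 maps [a, b] into
  -- [-T, T].
  set T := max |a| |b| + 1 with hT
  have hTa : |a| + 1 ≤ T := by rw [hT]; linarith [le_max_left |a| |b|]
  have hTb : |b| + 1 ≤ T := by rw [hT]; linarith [le_max_right |a| |b|]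
  have hT0 : 0 < T := by positivity
  obtain ⟨C, hC⟩ := f.exists_bound (-T) T
  have habs : ∀ s ∈ uIoc a b, |s| + 1 ≤ T := by
    intro s hs
    have h1 := abs_le_max_abs_abs hs.1.le hs.2
    have h2 : |min a b| ≤ max |a| |b| := abs_min_le_max_abs_abs
    have h3 : |max a b| ≤ max |a| |b| := abs_max_le_max_abs_abs
    rw [hT]; linarith [h1.trans (max_le h2 h3)]
  have hclose : ∀ (l : ℝ ≃o ℝ) (ε : ℝ), ε ≤ 1 → (∀ t, |t| ≤ T → |l t - t| < ε) →
      ∀ s ∈ uIoc a b, |l.symm s| ≤ T ∧ |s - l.symm s| < ε := by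
    intro l ε hε hl s hs
    have hs' := habs s hs
    have h1 := abs_lt.1 (hl T (abs_of_pos hT0).le)
    have h2 := abs_lt.1 (hl (-T) (by rw [abs_neg, abs_of_pos hT0]))
    have h3 : |l.symm s| ≤ T := by
      rw [abs_le]
      constructor
      · rw [← l.le_iff_le, l.apply_symm_apply]; linarith [neg_abs_le s]
      · rw [← l.le_iff_le, l.apply_symm_apply]; linarith [le_abs_self s]
    refine ⟨h3, ?_⟩
    have := hl _ h3
    rwa [l.apply_symm_apply] at this
  -- f ∘ l⁻¹ is close to f in L¹, uniformly over time changes l near the identity. Otherwise choose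
  -- offending l with displacement below 1/(n+1) and let n → ∞ by dominated convergence.
  have key : ∀ η > 0, ∃ ε > 0, ε ≤ 1 ∧ ∀ l : ℝ ≃o ℝ, (∀ t, |t| ≤ T → |l t - t| < ε) →
      ∫ s in uIoc a b, ‖f (l.symm s) - f s‖ < η := by
    intro η hη
    by_contra! hcon
    choose l hl hlη using fun n : ℕ => hcon (1 / ((n : ℝ) + 1)) (by positivity)
      (by rw [div_le_one (by positivity)]; linarith [n.cast_nonneg (α := ℝ)])
    have hlim : Tendsto (fun n => ∫ s in uIoc a b, ‖f ((l n).symm s) - f s‖) atTop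
        (𝓝 (∫ s in uIoc a b, (0 : ℝ))) := by
      refine tendsto_integral_of_dominated_convergence (fun _ => 2 * C) ?_
        (integrableOn_const (by simp)) ?_ ?_
      · intro n
        exact (((f.measurable.comp (l n).symm.continuous.measurable).aestronglyMeasurable).sub
          f.measurable.aestronglyMeasurable).norm
      · intro n
        refine (ae_restrict_iff' measurableSet_uIoc).2 (Eventually.of_forall fun s hs => ?_)
        have h1 := hclose (l n) _ (by rw [div_le_one (by positivity)]; linarith [n.cast_nonneg (α := ℝ)])
          (hl n) s hs
        have h2 := habs s hs
        rw [norm_norm]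
        refine (norm_sub_le _ _).trans ?_
        linarith [hC _ (abs_le.1 h1.1), hC s (abs_le.1 (by linarith))]
      · have h0 : ∀ᵐ s : ℝ, ContinuousAt f s := by
          have := f.countable_not_continuousAt.measure_zero volume
          simpa [ae_iff] using this
        refine (ae_restrict_iff' measurableSet_uIoc).2 ?_
        filter_upwards [h0] with s hs hsab
        have h1 : Tendsto (fun n => (l n).symm s) atTop (𝓝 s) := by
          rw [tendsto_iff_dist_tendsto_zero]
          refine squeeze_zero (fun _ => dist_nonneg) (fun n => ?_)
            tendsto_one_div_add_atTop_nhds_zero_nat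
          rw [dist_comm, Real.dist_eq]
          exact (hclose (l n) _ (by rw [div_le_one (by positivity)]; linarith [n.cast_nonneg (α := ℝ)])
            (hl n) s hsab).2.le
        have h2 := (hs.tendsto.comp h1).sub_const (f s)
        simpa using h2.norm
    rw [integral_zero] at hlim
    obtain ⟨n, hn⟩ := (hlim.eventually_lt_const hη).exists
    exact absurd (hlη n) (not_le.2 hn)
  rw [ContinuousAt, Metric.tendsto_nhds]
  intro η hη
  obtain ⟨ε, hε, hε1, hl⟩ := key (η / 2) (half_pos hη)
  -- A uniform error η' on an interval of length |b - a| costs at most η/2; the other half is left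
  -- for the time change.
  set η' := η / (2 * (|b - a| + 1)) with hη'
  have hη'0 : 0 < η' := by positivity
  refine mem_of_superset
    (skorohodNhd_mem_nhds f (T := T) hε (Metric.dist_mem_uniformity hη'0)) ?_
  rintro g ⟨l, hg⟩
  have hl2 := hl l fun t ht => (hg t ht).1
  have hcl := hclose l ε hε1 fun t ht => (hg t ht).1
  have hfi := hint f (OrderIso.refl ℝ)
  have hfl := hint f l.symm
  have hgi := hint g (OrderIso.refl ℝ)
  simp only [OrderIso.refl_apply] at hfi hgi
  have hint0 : IntegrableOn (fun _ => η') (uIoc a b) := integrableOn_const (by simp)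
  have hint2 : IntegrableOn (fun s => ‖f (l.symm s) - f s‖) (uIoc a b) :=
    (intervalIntegrable_iff.1 (hfl.sub hfi)).norm
  have hbound : ‖∫ s in a..b, (g s - f s)‖ ≤ ∫ s in uIoc a b, (η' + ‖f (l.symm s) - f s‖) := by
    refine (intervalIntegral.norm_integral_le_integral_norm_uIoc).trans ?_
    refine setIntegral_mono_on (intervalIntegrable_iff.1 (hgi.sub hfi)).norm
      (hint0.add hint2) measurableSet_uIoc fun s hs => ?_
    have h1 := (hg _ (hcl s hs).1).2
    rw [l.apply_symm_apply, mem_ofPred_eq, dist_comm, dist_eq_norm] at h1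
    have h2 := norm_sub_le_norm_sub_add_norm_sub (g s) (f (l.symm s)) (f s)
    linarith
  rw [integral_add hint0 hint2, setIntegral_const, measureReal_def, Real.volume_uIoc,
    ENNReal.toReal_ofReal (abs_nonneg _),
    smul_eq_mul] at hbound
  rw [mem_ofPred_eq, dist_eq_norm, ← intervalIntegral.integral_sub hgi hfi]
  have h3 : |b - a| * η' ≤ η / 2 := by
    rw [hη', mul_div_assoc', div_le_div_iff₀ (by positivity) two_pos]
    nlinarith [abs_nonneg (b - a)]
  linarith

/-- The evaluation at a fixed time is Borel measurable for the Skorohod topology. -/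
theorem measurable_cadlag_eval [NormedSpace ℝ E] [CompleteSpace E] [SecondCountableTopology E]
    [MeasurableSpace E] [BorelSpace E] {Z : Type*} [TopologicalSpace Z] [MeasurableSpace Z]
    [OpensMeasurableSpace Z] {F : Z → Cadlag E} (hF : Continuous F) (t : ℝ) :
    Measurable (fun z => F z t) := by
  -- The averages over [t, t + 1/(n+1)] are continuous in the path and converge to the value at t by
  -- right-continuity.
  refine measurable_of_tendsto_metrizable
    (f := fun (n : ℕ) z => ((n : ℝ) + 1) • ∫ s in t..(t + 1 / ((n : ℝ) + 1)), F z s) ?_ ?_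
  · intro n
    exact (((continuous_integral_cadlag t (t + 1 / ((n : ℝ) + 1))).comp hF).const_smul _).measurable
  · rw [tendsto_pi_nhds]
    intro z
    rw [Metric.tendsto_atTop]
    intro ε hε
    obtain ⟨u, hu, hus⟩ := mem_nhdsGE_iff_exists_Ico_subset.1
      (Metric.tendsto_nhds.1 ((F z).right_cont t) (ε / 2) (half_pos hε))
    obtain ⟨N, hN⟩ := exists_nat_one_div_lt (K := ℝ) (sub_pos.2 (show t < u from hu))
    refine ⟨N, fun n hn => ?_⟩
    have hn0 : (0 : ℝ) < (n : ℝ) + 1 := by positivity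
    have hn1 : 1 / ((n : ℝ) + 1) < u - t := lt_of_le_of_lt
      (one_div_le_one_div_of_le (by positivity) (by exact_mod_cast Nat.succ_le_succ hn)) hN
    have hint : IntervalIntegrable (F z) volume t (t + 1 / ((n : ℝ) + 1)) := by
      obtain ⟨C, hC⟩ := (F z).exists_bound t (t + 1 / ((n : ℝ) + 1))
      rw [intervalIntegrable_iff_integrableOn_Ioc_of_le (by linarith [one_div_pos.2 hn0])]
      refine IntegrableOn.of_bound (C := C) (by simp) (F z).measurable.aestronglyMeasurable ?_
      exact (ae_restrict_iff' measurableSet_Ioc).2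
        (Eventually.of_forall fun s hs => hC s ⟨hs.1.le, hs.2⟩)
    have h1 : ((n : ℝ) + 1) • (∫ s in t..(t + 1 / ((n : ℝ) + 1)), F z s) - F z t
        = ((n : ℝ) + 1) • ∫ s in t..(t + 1 / ((n : ℝ) + 1)), (F z s - F z t) := by
      rw [intervalIntegral.integral_sub hint (by simp), intervalIntegral.integral_const, smul_sub,
        smul_smul]
      congr 1
      rw [add_sub_cancel_left, mul_one_div_cancel hn0.ne', one_smul]
    have h2 : ‖∫ s in t..(t + 1 / ((n : ℝ) + 1)), (F z s - F z t)‖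
        ≤ ε / 2 * |t + 1 / ((n : ℝ) + 1) - t| := by
      refine intervalIntegral.norm_integral_le_of_norm_le_const fun s hs => ?_
      rw [uIoc_of_le (by linarith [one_div_pos.2 hn0])] at hs
      have := hus (show s ∈ Ico t u from ⟨hs.1.le, by linarith [hs.2]⟩)
      rw [mem_ofPred_eq, dist_eq_norm] at this
      exact this.le
    rw [dist_eq_norm, h1, norm_smul, Real.norm_of_nonneg hn0.le]
    rw [add_sub_cancel_left, abs_of_pos (one_div_pos.2 hn0)] at h2
    calc ((n : ℝ) + 1) * _ ≤ ((n : ℝ) + 1) * (ε / 2 * (1 / ((n : ℝ) + 1))) := by gcongr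
      _ = ε / 2 := by field_simp
      _ < ε := half_lt_self hε

end Real

/-! ### Measurability on the path space -/

section PathMeasurability

variable {d : ℕ} {p : ℝ}

/-- The integral of a continuous function against a measure of mass at most one. -/
def MPlus.integral (f : C(Torus d, ℝ)) (μ : MPlus d) : ℝ :=
  ∫ x, f x ∂((μ : FiniteMeasure (Torus d)) : Measure (Torus d))

/-- This is how the uniform structure on `MPlus` was chosen. Composing with these maps reduces
measurability for measure-valued paths to that for real-valued ones. -/
theorem MPlus.uniformContinuous_integral (f : C(Torus d, ℝ)) :
    UniformContinuous (MPlus.integral f) := by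
  have h1 : UniformContinuous (fun (μ : MPlus d) (f : BoundedContinuousFunction (Torus d) ℝ) =>
      ∫ x, f x ∂((μ : FiniteMeasure (Torus d)) : Measure (Torus d))) := by
    rw [instUniformSpaceMPlus, UniformSpace.replaceTopology_eq]
    exact uniformContinuous_comap
  exact (Pi.uniformContinuous_proj _ (BoundedContinuousFunction.mkOfCompact f)).comp h1

theorem continuous_dens : Continuous (PathSpace.dens : PathSpace d p → _) :=
  (continuous_induced_dom (f := fun z : PathSpace d p => (z.dens, z.curr))).fst

theorem continuous_curr : Continuous (PathSpace.curr : PathSpace d p → _) :=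
  (continuous_induced_dom (f := fun z : PathSpace d p => (z.dens, z.curr))).snd

theorem measurable_integral_dens (f : C(Torus d, ℝ)) (t : ℝ) :
    Measurable (fun z : PathSpace d p => MPlus.integral f (z.dens t)) :=
  measurable_cadlag_eval
    ((continuous_cadlag_map _ (MPlus.uniformContinuous_integral f)).comp continuous_dens) t

theorem measurable_integral_dens_uncurry (f : C(Torus d, ℝ)) :
    Measurable (fun q : ℝ × PathSpace d p => MPlus.integral f (q.2.dens q.1)) :=
  measurable_uncurry_of_rightCont (fun t z => MPlus.integral f (PathSpace.dens z t))
    (measurable_integral_dens f) fun z t =>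
      (MPlus.uniformContinuous_integral f).continuous.continuousAt.comp_continuousWithinAt
        (z.dens.right_cont t)

instance : Fact ((2 : ℝ≥0∞) ≠ ∞) := ⟨by simp⟩

instance (q : ℝ) : SecondCountableTopology (SobolevField d q) := inferInstance

/-- The shift subtracts J(-t), which is measurable but not continuous in the path. Hence it is
factored through z ↦ (z, J(-t)), followed by a continuous map; the Sobolev space is second
countable, so open sets of the product are measurable. -/
theorem measurable_timeShift (t : ℝ) :
    Measurable (timeShift t : PathSpace d p → PathSpace d p) := by
  borelize (SobolevField d (-p))
  have h1 : Measurable (fun z : PathSpace d p => z.curr (-t)) :=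
    measurable_cadlag_eval continuous_curr (-t)
  have h2 : Measurable (fun z : PathSpace d p => (z, z.curr (-t))) := measurable_id.prodMk h1
  have h3 : Continuous (fun q : PathSpace d p × SobolevField d (-p) =>
      (q.1.dens.shift t, Cadlag.subConst q.2 (q.1.curr.shift t))) :=
    ((continuous_cadlag_shift t).comp (continuous_dens.comp continuous_fst)).prodMk
      (continuous_cadlag_subConst.comp
        (((continuous_cadlag_shift t).comp (continuous_curr.comp continuous_fst)).prodMk
          continuous_snd))
  refine measurable_of_isOpen fun O hO => ?_
  obtain ⟨O', hO', rfl⟩ := isOpen_induced_iff.1 hO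
  exact h2 (hO'.preimage h3).measurableSet

end PathMeasurability

/-! ### Calculus on the torus -/

section TorusCalculus

variable {d : ℕ}

theorem volume_unitAddCircle : (volume : Measure UnitAddCircle) = AddCircle.haarAddCircle := by
  rw [AddCircle.volume_eq_smul_haarAddCircle]; simp

instance : IsProbabilityMeasure (volume : Measure UnitAddCircle) := by
  rw [volume_unitAddCircle]; infer_instance

instance : IsProbabilityMeasure (volume : Measure (Torus d)) := by
  rw [volume_pi]; infer_instance

instance : (volume : Measure (Torus d)).IsNegInvariant :=
  Measure.IsAddHaarMeasure.isNegInvariant_of_regular _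

/-- The projection of `ℝ^d` onto the torus. -/
def torusMk (x : Fin d → ℝ) : Torus d := fun i => (x i : UnitAddCircle)

theorem isOpenQuotientMap_torusMk : IsOpenQuotientMap (torusMk : (Fin d → ℝ) → Torus d) :=
  IsOpenQuotientMap.piMap fun _ => QuotientAddGroup.isOpenQuotientMap_mk

theorem torusMk_add_single (x : Fin d → ℝ) (k : Fin d) (s : ℝ) :
    torusMk x + Pi.single k (s : UnitAddCircle) = torusMk (x + s • Pi.single k 1) := by
  ext i
  rcases eq_or_ne i k with rfl | h
  · simp [torusMk]
  · simp [torusMk, h]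

/-- `F'` is the `k`-th partial derivative of `F`. -/
def HasPDeriv {E : Type*} [NormedAddCommGroup E] [NormedSpace ℝ E] (k : Fin d)
    (F F' : Torus d → E) : Prop :=
  ∀ x, HasDerivAt (fun s : ℝ => F (x + Pi.single k (s : UnitAddCircle))) (F' x) 0

section HasPDeriv

variable {E : Type*} [NormedAddCommGroup E] [NormedSpace ℝ E] {k : Fin d}

theorem HasPDeriv.pderiv_eq {F F' : Torus d → ℝ} (h : HasPDeriv k F F') : pderiv k F = F' :=
  funext fun x => (h x).deriv

theorem HasPDeriv.hasDerivAt {F F' : Torus d → E} (h : HasPDeriv k F F') (x : Torus d) (s : ℝ) :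
    HasDerivAt (fun s : ℝ => F (x + Pi.single k (s : UnitAddCircle)))
      (F' (x + Pi.single k (s : UnitAddCircle))) s := by
  have h1 := h (x + Pi.single k (s : UnitAddCircle))
  rw [show (0 : ℝ) = s - s by simp] at h1
  convert h1.comp_sub_const s s using 1
  ext r
  rw [add_assoc, ← Pi.single_add, ← AddCircle.coe_add, add_sub_cancel]

theorem HasPDeriv.congr {F G F' G' : Torus d → E} (h : HasPDeriv k F F') (hF : ∀ x, G x = F x)
    (hG : ∀ x, G' x = F' x) : HasPDeriv k G G' := by
  rwa [show G = F from funext hF, show G' = F' from funext hG]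

theorem HasPDeriv.mul {F F' G G' : Torus d → ℝ} (hF : HasPDeriv k F F') (hG : HasPDeriv k G G') :
    HasPDeriv k (fun x => F x * G x) (fun x => F' x * G x + F x * G' x) := by
  intro x
  simpa using (hF x).fun_mul (hG x)

theorem HasPDeriv.const_mul {F F' : Torus d → ℝ} (hF : HasPDeriv k F F') (c : ℝ) :
    HasPDeriv k (fun x => c * F x) (fun x => c * F' x) :=
  fun x => (hF x).const_mul c

theorem HasPDeriv.add_const {F F' : Torus d → ℝ} (hF : HasPDeriv k F F') (c : ℝ) :
    HasPDeriv k (fun x => F x + c) F' :=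
  fun x => (hF x).add_const c

theorem HasPDeriv.comp {F F' : Torus d → ℝ} (hF : HasPDeriv k F F') {h h' : ℝ → ℝ}
    (hh : ∀ x, HasDerivAt h (h' (F x)) (F x)) :
    HasPDeriv k (fun x => h (F x)) (fun x => h' (F x) * F' x) := by
  intro x
  have h1 : HasDerivAt h (h' (F x))
      (F (x + Pi.single k ((0 : ℝ) : UnitAddCircle))) := by simpa using hh x
  exact h1.comp 0 (hF x)

theorem continuous_integrable {E : Type*} [NormedAddCommGroup E] {F : Torus d → E} (hF : Continuous F) : Integrable F :=
  hF.integrable_of_hasCompactSupport (HasCompactSupport.of_compactSpace _)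

/-- The integral of a partial derivative over the torus vanishes. -/
theorem HasPDeriv.integral_eq_zero [CompleteSpace E] {F F' : Torus d → E} (h : HasPDeriv k F F')
    (hF : Continuous F) (hF' : Continuous F') : ∫ x, F' x = 0 := by
  obtain ⟨C, hC⟩ : ∃ C, ∀ x, ‖F' x‖ ≤ C := by
    obtain ⟨C, hC⟩ := isCompact_univ.exists_bound_of_continuousOn hF'.continuousOn
    exact ⟨C, fun x => hC x (mem_univ x)⟩
  have hc : ∀ G : Torus d → E, Continuous G → ∀ s : ℝ,
      Continuous fun x : Torus d => G (x + Pi.single k (s : UnitAddCircle)) :=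
    fun G hG s => hG.comp (continuous_add_const _)
  have h1 := hasDerivAt_integral_of_dominated_loc_of_deriv_le (μ := (volume : Measure (Torus d)))
    (F := fun (s : ℝ) x => F (x + Pi.single k (s : UnitAddCircle)))
    (F' := fun (s : ℝ) x => F' (x + Pi.single k (s : UnitAddCircle))) (bound := fun _ => C)
    (x₀ := (0 : ℝ)) (s := univ) univ_mem
    (Eventually.of_forall fun s => (hc F hF s).aestronglyMeasurable)
    (continuous_integrable (hc F hF 0)) (hc F' hF' 0).aestronglyMeasurable
    (Eventually.of_forall fun x s _ => hC _) (integrable_const _)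
    (Eventually.of_forall fun x s _ => h.hasDerivAt x s)
  have h2 := h1.2
  -- By translation invariance the integral does not depend on s, so its derivative is zero.
  simp only [integral_add_right_eq_self (μ := (volume : Measure (Torus d)))] at h2
  exact h2.unique (hasDerivAt_const _ _)

theorem HasPDeriv.integral_mul_eq {F F' G G' : Torus d → ℝ} (hF : HasPDeriv k F F')
    (hG : HasPDeriv k G G') (cF : Continuous F) (cF' : Continuous F') (cG : Continuous G)
    (cG' : Continuous G') : ∫ x, F x * G' x = - ∫ x, F' x * G x := by
  have h := (hF.mul hG).integral_eq_zero (cF.mul cG) ((cF'.mul cG).add (cF.mul cG'))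
  rw [integral_add (f := fun x => F' x * G x) (g := fun x => F x * G' x)
    (continuous_integrable (cF'.mul cG)) (continuous_integrable (cF.mul cG'))] at h
  linarith

end HasPDeriv

theorem TorusContDiff.continuous {n : ℕ∞} {f : Torus d → ℝ} (h : TorusContDiff n f) :
    Continuous f :=
  isOpenQuotientMap_torusMk.isQuotientMap.continuous_iff.2 (ContDiff.continuous h)

theorem TorusContDiff.hasPDeriv_torusMk {n : ℕ∞} {f : Torus d → ℝ} (h : TorusContDiff n f)
    (hn : 1 ≤ n) (k : Fin d) (y : Fin d → ℝ) :
    HasDerivAt (fun s : ℝ => f (torusMk y + Pi.single k (s : UnitAddCircle)))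
      (fderiv ℝ (fun x : Fin d → ℝ => f (torusMk x)) y (Pi.single k 1)) 0 := by
  have hd : Differentiable ℝ (fun x : Fin d → ℝ => f (torusMk x)) :=
    ContDiff.differentiable h (by
      have : n ≠ 0 := by rintro rfl; simp at hn
      exact_mod_cast this)
  simp only [torusMk_add_single]
  have h2 : HasDerivAt (fun s : ℝ => y + s • (Pi.single k 1 : Fin d → ℝ)) (Pi.single k 1) 0 := by
    simpa using ((hasDerivAt_id (0 : ℝ)).smul_const (Pi.single k 1 : Fin d → ℝ)).const_add y
  have h3 : HasFDerivAt (fun x : Fin d → ℝ => f (torusMk x))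
      (fderiv ℝ (fun x : Fin d → ℝ => f (torusMk x)) y)
      (y + (0 : ℝ) • (Pi.single k 1 : Fin d → ℝ)) := by
    simpa using (hd y).hasFDerivAt
  exact h3.comp_hasDerivAt 0 h2

theorem TorusContDiff.pderiv_torusMk {n : ℕ∞} {f : Torus d → ℝ} (h : TorusContDiff n f)
    (hn : 1 ≤ n) (k : Fin d) : pderiv k f ∘ torusMk =
      fun y => fderiv ℝ (fun x : Fin d → ℝ => f (torusMk x)) y (Pi.single k 1) :=
  funext fun y => (h.hasPDeriv_torusMk hn k y).deriv

theorem TorusContDiff.hasPDeriv {n : ℕ∞} {f : Torus d → ℝ} (h : TorusContDiff n f) (hn : 1 ≤ n)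
    (k : Fin d) : HasPDeriv k f (pderiv k f) ∧ Continuous (pderiv k f) := by
  constructor
  · intro x
    obtain ⟨y, rfl⟩ := isOpenQuotientMap_torusMk.surjective x
    rw [show pderiv k f (torusMk y) = _ from congrFun (h.pderiv_torusMk hn k) y]
    exact h.hasPDeriv_torusMk hn k y
  · refine isOpenQuotientMap_torusMk.isQuotientMap.continuous_iff.2 ?_
    rw [h.pderiv_torusMk hn k]
    exact (ContDiff.continuous_fderiv h (by
      have : n ≠ 0 := by rintro rfl; simp at hn
      exact_mod_cast this)).clm_apply continuous_const

theorem TorusContDiff.torusContDiff_pderiv {f : Torus d → ℝ} (h : TorusContDiff 2 f) (k : Fin d) :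
    TorusContDiff 1 (pderiv k f) := by
  have h1 : ContDiff ℝ 1 (pderiv k f ∘ torusMk) := by
    rw [h.pderiv_torusMk (by norm_num) k]
    exact (ContDiff.fderiv_right (n := 2) h (by norm_num)).clm_apply contDiff_const
  exact h1

theorem continuous_grad {n : ℕ∞} {f : Torus d → ℝ} (h : TorusContDiff n f) (hn : 1 ≤ n) :
    Continuous (grad f) :=
  (PiLp.continuous_toLp 2 _).comp (continuous_pi fun k => (h.hasPDeriv hn k).2)

theorem exists_bound_of_continuous {E : Type*} [NormedAddCommGroup E] {F : Torus d → E}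
    (hF : Continuous F) : ∃ C, 0 ≤ C ∧ ∀ x, ‖F x‖ ≤ C := by
  obtain ⟨C, hC⟩ := isCompact_univ.exists_bound_of_continuousOn hF.continuousOn
  exact ⟨max C 0, le_max_right _ _, fun x => (hC x (mem_univ x)).trans (le_max_left _ _)⟩

/-! ### Trigonometric polynomials -/

/-- `f` is a real trigonometric polynomial. -/
def IsTrigPoly (f : Torus d → ℝ) : Prop :=
  ∃ F ∈ UnitAddTorus.mFourierSubalgebra (Fin d), ∀ x, F x = (f x : ℂ)

theorem mFourierSubalgebra_induction {p : C(Torus d, ℂ) → Prop}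
    (hn : ∀ n, p (UnitAddTorus.mFourier n)) (hadd : ∀ F G, p F → p G → p (F + G))
    (hsmul : ∀ (a : ℂ) F, p F → p (a • F)) {F : C(Torus d, ℂ)}
    (hF : F ∈ UnitAddTorus.mFourierSubalgebra (Fin d)) : p F := by
  have h : F ∈ Submodule.span ℂ (range (UnitAddTorus.mFourier (d := Fin d))) := by
    rw [← UnitAddTorus.mFourierSubalgebra_coe]; exact hF
  induction h using Submodule.span_induction with
  | mem x hx => obtain ⟨n, rfl⟩ := hx; exact hn n
  | zero => rw [← zero_smul ℂ (UnitAddTorus.mFourier (0 : Fin d → ℤ))]; exact hsmul 0 _ (hn 0)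
  | add x y _ _ hx hy =>
    have hmem : ∀ y, y ∈ Submodule.span ℂ (range (UnitAddTorus.mFourier (d := Fin d))) →
        y ∈ UnitAddTorus.mFourierSubalgebra (Fin d) := by
      intro y hy
      rw [← UnitAddTorus.mFourierSubalgebra_coe] at hy; exact hy
    exact hadd _ _ (hx (hmem _ ‹_›)) (hy (hmem _ ‹_›))
  | smul a x _ hx =>
    have hmem : ∀ y, y ∈ Submodule.span ℂ (range (UnitAddTorus.mFourier (d := Fin d))) →
        y ∈ UnitAddTorus.mFourierSubalgebra (Fin d) := by
      intro y hy
      rw [← UnitAddTorus.mFourierSubalgebra_coe] at hy; exact hy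
    exact hsmul _ _ (hx (hmem _ ‹_›))

theorem mFourier_mem (n : Fin d → ℤ) :
    UnitAddTorus.mFourier n ∈ UnitAddTorus.mFourierSubalgebra (Fin d) := by
  have : UnitAddTorus.mFourier n ∈ Submodule.span ℂ (range (UnitAddTorus.mFourier (d := Fin d))) :=
    Submodule.subset_span ⟨n, rfl⟩
  rw [← UnitAddTorus.mFourierSubalgebra_coe] at this
  exact this

theorem mFourier_apply_add (n : Fin d → ℤ) (x y : Torus d) :
    UnitAddTorus.mFourier n (x + y) = UnitAddTorus.mFourier n x * UnitAddTorus.mFourier n y := by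
  simp [UnitAddTorus.mFourier, fourier_apply, smul_add, AddCircle.toCircle_add, Finset.prod_mul_distrib]

theorem mFourier_apply_neg (n : Fin d → ℤ) (x : Torus d) :
    UnitAddTorus.mFourier n (-x) = conj (UnitAddTorus.mFourier n x) := by
  rw [← UnitAddTorus.mFourier_neg]
  change ∏ i, fourier (n i) (-x i) = ∏ i, fourier (-n i) (x i)
  simp only [fourier_apply, neg_smul, smul_neg]

theorem mFourier_single_apply (n : Fin d → ℤ) (k : Fin d) (s : UnitAddCircle) :
    UnitAddTorus.mFourier n (Pi.single k s) = fourier (n k) s := by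
  simp only [UnitAddTorus.mFourier, ContinuousMap.coe_mk]
  rw [Finset.prod_eq_single k]
  · simp
  · intro i _ hi
    simp [hi]
  · simp

theorem hasPDeriv_mFourier (n : Fin d → ℤ) (k : Fin d) :
    HasPDeriv k (UnitAddTorus.mFourier n)
      (((2 * Real.pi * Complex.I * n k : ℂ)) • (UnitAddTorus.mFourier n : C(Torus d, ℂ))) := by
  intro x
  have h := (hasDerivAt_fourier 1 (n k) 0).const_mul (UnitAddTorus.mFourier n x)
  refine HasDerivAt.congr_deriv (h.congr_of_eventuallyEq (Eventually.of_forall fun s => ?_)) ?_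
  · exact (mFourier_apply_add n x _).trans (by rw [mFourier_single_apply])
  · simp
    ring

theorem exists_hasPDeriv_of_mem {F : C(Torus d, ℂ)}
    (hF : F ∈ UnitAddTorus.mFourierSubalgebra (Fin d)) (k : Fin d) :
    ∃ F' ∈ UnitAddTorus.mFourierSubalgebra (Fin d), HasPDeriv k F F' := by
  refine mFourierSubalgebra_induction (p := fun F =>
    ∃ F' ∈ UnitAddTorus.mFourierSubalgebra (Fin d), HasPDeriv k F F') ?_ ?_ ?_ hF
  · intro n
    exact ⟨_, SMulMemClass.smul_mem _ (mFourier_mem n), hasPDeriv_mFourier n k⟩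
  · rintro F G ⟨F', hF', h1⟩ ⟨G', hG', h2⟩
    exact ⟨F' + G', add_mem hF' hG', fun x => (h1 x).add (h2 x)⟩
  · rintro a F ⟨F', hF', h1⟩
    exact ⟨a • F', SMulMemClass.smul_mem _ hF', fun x => (h1 x).const_smul a⟩

theorem IsTrigPoly.continuous {f : Torus d → ℝ} (hf : IsTrigPoly f) : Continuous f := by
  obtain ⟨F, _, h⟩ := hf
  have : f = fun x => (F x).re := by ext x; simp [h]
  rw [this]
  exact Complex.continuous_re.comp F.continuous

theorem IsTrigPoly.exists_hasPDeriv {f : Torus d → ℝ} (hf : IsTrigPoly f) (k : Fin d) :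
    ∃ f', IsTrigPoly f' ∧ HasPDeriv k f f' := by
  obtain ⟨F, hF, h⟩ := hf
  obtain ⟨F', hF', h'⟩ := exists_hasPDeriv_of_mem hF k
  have hre : ∀ x, HasDerivAt (fun s : ℝ => f (x + Pi.single k (s : UnitAddCircle))) (F' x).re 0 := by
    intro x
    have := Complex.reCLM.hasFDerivAt.comp_hasDerivAt (0 : ℝ) (h' x)
    refine this.congr_of_eventuallyEq (Eventually.of_forall fun s => ?_)
    simp [h]
  refine ⟨fun x => (F' x).re, ⟨F', hF', fun x => ?_⟩, hre⟩
  have h1 := h' x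
  simp only [h] at h1
  exact h1.unique (hre x).ofReal_comp

theorem IsTrigPoly.torusContDiff {f : Torus d → ℝ} (hf : IsTrigPoly f) : TorusContDiff ⊤ f := by
  obtain ⟨F, hF, h⟩ := hf
  have h1 : ContDiff ℝ ((⊤ : ℕ∞) : WithTop ℕ∞) (fun x : Fin d → ℝ => F (torusMk x)) := by
    refine mFourierSubalgebra_induction (p := fun F =>
      ContDiff ℝ ((⊤ : ℕ∞) : WithTop ℕ∞) (fun x : Fin d → ℝ => F (torusMk x))) ?_ ?_ ?_ hF
    · intro n
      simp only [UnitAddTorus.mFourier, ContinuousMap.coe_mk, torusMk, fourier_coe_apply]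
      refine contDiff_prod fun i _ => ContDiff.cexp ?_
      refine ContDiff.div_const ?_ _
      refine contDiff_const.mul ?_
      exact Complex.ofRealCLM.contDiff.comp (contDiff_apply ℝ ℝ i)
    · intro F G hF hG
      exact hF.add hG
    · intro a F hF
      exact hF.const_smul a
  have h2 := Complex.reCLM.contDiff.comp h1
  unfold TorusContDiff
  convert h2 using 2 with x
  simp only [Function.comp_apply, Complex.reCLM_apply, h, Complex.ofReal_re]
  rfl

theorem IsTrigPoly.comp_sub_left {f : Torus d → ℝ} (hf : IsTrigPoly f) (x : Torus d) :
    IsTrigPoly (fun y => f (x - y)) := by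
  obtain ⟨F, hF, h⟩ := hf
  have h1 : ∃ G ∈ UnitAddTorus.mFourierSubalgebra (Fin d), ∀ y, G y = F (x - y) := by
    refine mFourierSubalgebra_induction (p := fun F =>
      ∃ G ∈ UnitAddTorus.mFourierSubalgebra (Fin d), ∀ y, G y = F (x - y)) ?_ ?_ ?_ hF
    · intro n
      refine ⟨UnitAddTorus.mFourier n x • star (UnitAddTorus.mFourier n),
        SMulMemClass.smul_mem _ (star_mem (mFourier_mem n)), fun y => ?_⟩
      rw [sub_eq_add_neg, mFourier_apply_add, mFourier_apply_neg]
      simp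
    · rintro F G ⟨F', hF', h1⟩ ⟨G', hG', h2⟩
      exact ⟨F' + G', add_mem hF' hG', fun y => by simp [h1, h2]⟩
    · rintro a F ⟨F', hF', h1⟩
      exact ⟨a • F', SMulMemClass.smul_mem _ hF', fun y => by simp [h1]⟩
  obtain ⟨G, hG, h2⟩ := h1
  exact ⟨G, hG, fun y => by rw [h2, h]⟩

theorem integral_mFourier (n : Fin d → ℤ) :
    ∫ x : Torus d, UnitAddTorus.mFourier n x = if n = 0 then 1 else 0 := by
  split_ifs with h
  · subst h
    rw [UnitAddTorus.mFourier_zero]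
    simp
  · obtain ⟨k, hk⟩ := Function.ne_iff.1 h
    have h1 := (hasPDeriv_mFourier n k).integral_eq_zero (UnitAddTorus.mFourier n).continuous
      ((UnitAddTorus.mFourier n).continuous.const_smul _)
    simp only [Pi.smul_apply, integral_smul] at h1
    rw [smul_eq_zero] at h1
    refine h1.resolve_left ?_
    have : (n k : ℂ) ≠ 0 := by exact_mod_cast hk
    simp [this, Real.pi_ne_zero]

theorem integral_mFourier_mul_conj (n m : Fin d → ℤ) :
    ∫ x : Torus d, UnitAddTorus.mFourier n x * conj (UnitAddTorus.mFourier m x)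
      = if n = m then 1 else 0 := by
  simp only [← UnitAddTorus.mFourier_neg, ← UnitAddTorus.mFourier_add, integral_mFourier,
    ← sub_eq_add_neg, sub_eq_zero]

/-- Parseval's identity with a trigonometric polynomial. -/
theorem exists_parseval {F : C(Torus d, ℂ)} (hF : F ∈ UnitAddTorus.mFourierSubalgebra (Fin d)) :
    ∃ s : Finset (Fin d → ℤ),
      (∀ m ∉ s, ∫ x, F x * conj (UnitAddTorus.mFourier m x) = 0) ∧
      ∀ t, s ⊆ t → ∀ u : Torus d → ℂ, Integrable u →
        ∑ m ∈ t, (∫ x, u x * conj (UnitAddTorus.mFourier m x)) *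
          conj (∫ x, F x * conj (UnitAddTorus.mFourier m x)) = ∫ x, u x * conj (F x) := by
  have hint : ∀ (u : Torus d → ℂ) (G : C(Torus d, ℂ)), Integrable u →
      Integrable (fun x => u x * conj (G x)) := by
    intro u G hu
    obtain ⟨C, -, hC⟩ := exists_bound_of_continuous G.continuous
    exact hu.mul_bdd (c := C)
      (Complex.continuous_conj.comp G.continuous).aestronglyMeasurable
      (Eventually.of_forall fun x => by simpa using hC x)
  refine mFourierSubalgebra_induction (p := fun F => ∃ s : Finset (Fin d → ℤ),
      (∀ m ∉ s, ∫ x, F x * conj (UnitAddTorus.mFourier m x) = 0) ∧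
      ∀ t, s ⊆ t → ∀ u : Torus d → ℂ, Integrable u →
        ∑ m ∈ t, (∫ x, u x * conj (UnitAddTorus.mFourier m x)) *
          conj (∫ x, F x * conj (UnitAddTorus.mFourier m x)) = ∫ x, u x * conj (F x))
    ?_ ?_ ?_ hF
  · intro n
    refine ⟨{n}, fun m hm => ?_, fun t ht u hu => ?_⟩
    · rw [integral_mFourier_mul_conj, if_neg]
      rintro rfl
      simp at hm
    · simp only [integral_mFourier_mul_conj]
      rw [Finset.sum_eq_single_of_mem n (ht (by simp))]
      · simp
      · intro m _ hm
        simp [hm.symm]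
  · rintro F G ⟨s, hs, h1⟩ ⟨s', hs', h2⟩
    classical
    have hadd : ∀ m, ∫ x, (F + G) x * conj (UnitAddTorus.mFourier m x) =
        (∫ x, F x * conj (UnitAddTorus.mFourier m x)) +
          ∫ x, G x * conj (UnitAddTorus.mFourier m x) := by
      intro m
      simp only [ContinuousMap.add_apply, add_mul]
      exact integral_add (hint _ _ (continuous_integrable F.continuous))
        (hint _ _ (continuous_integrable G.continuous))
    -- Because the identity is asserted for every t containing s, those for F and G can be read on a
    -- common set of modes.
    refine ⟨s ∪ s', fun m hm => ?_, fun t ht u hu => ?_⟩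
    · rw [Finset.mem_union, not_or] at hm
      rw [hadd, hs m hm.1, hs' m hm.2, add_zero]
    · simp only [hadd, map_add, mul_add, Finset.sum_add_distrib]
      simp only [ContinuousMap.add_apply, map_add, mul_add]
      rw [h1 t (Finset.union_subset_left ht) u hu, h2 t (Finset.union_subset_right ht) u hu,
        ← integral_add (hint u F hu) (hint u G hu)]
  · rintro a F ⟨s, hs, h1⟩
    have hmul : ∀ m, ∫ x, (a • F) x * conj (UnitAddTorus.mFourier m x) =
        a * ∫ x, F x * conj (UnitAddTorus.mFourier m x) := by
      intro m
      simp only [ContinuousMap.smul_apply, smul_eq_mul, mul_assoc]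
      exact integral_const_mul _ _
    refine ⟨s, fun m hm => by rw [hmul, hs m hm, mul_zero], fun t ht u hu => ?_⟩
    simp only [hmul, map_mul, mul_left_comm _ (conj a), ← Finset.mul_sum, h1 t ht u hu]
    simp only [ContinuousMap.smul_apply, smul_eq_mul, map_mul, mul_left_comm _ (conj a)]
    exact (integral_const_mul _ _).symm

theorem IsTrigPoly.exists_parseval {f : Torus d → ℝ} (hf : IsTrigPoly f) :
    ∃ s : Finset (Fin d → ℤ), (∀ m ∉ s, torusFourierCoeff f m = 0) ∧
      ∀ t, s ⊆ t → ∀ u : Torus d → ℝ, Integrable u →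
        ∑ m ∈ t, torusFourierCoeff u m * conj (torusFourierCoeff f m)
          = ((∫ x, u x * f x : ℝ) : ℂ) := by
  obtain ⟨F, hF, h⟩ := hf
  obtain ⟨s, hs, h1⟩ := WASEP.exists_parseval hF
  simp only [h] at hs h1
  refine ⟨s, hs, fun t ht u hu => ?_⟩
  rw [← integral_complex_ofReal]
  simp only [Complex.ofReal_mul]
  exact (h1 t ht (fun x => (u x : ℂ)) hu.ofReal).trans (by simp only [Complex.conj_ofReal])

end TorusCalculus

/-! ### Mollification on the torus -/

section Mollify

variable {d : ℕ} {E : Type*} [NormedAddCommGroup E] [NormedSpace ℝ E]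

/-- A nonnegative trigonometric polynomial with a unique maximum at the origin. -/
def bump (x : Torus d) : ℝ := ∏ i, (1 + (fourier 1 (x i) : ℂ).re) / 2

theorem isTrigPoly_bump : IsTrigPoly (bump : Torus d → ℝ) := by
  refine ⟨∏ i, (algebraMap ℂ _ (1 / 2) + (1 / 4 : ℂ) • (UnitAddTorus.mFourier (Pi.single i 1) +
    star (UnitAddTorus.mFourier (Pi.single i 1)))), ?_, fun x => ?_⟩
  · refine prod_mem fun i _ => add_mem (algebraMap_mem _ _) (SMulMemClass.smul_mem _ ?_)
    exact add_mem (mFourier_mem _) (star_mem (mFourier_mem _))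
  · rw [ContinuousMap.prod_apply, bump, Complex.ofReal_prod]
    refine Finset.prod_congr rfl fun i _ => ?_
    rw [ContinuousMap.add_apply, ContinuousMap.smul_apply, ContinuousMap.add_apply,
      ContinuousMap.star_apply, UnitAddTorus.mFourier_single, RCLike.star_def, Complex.add_conj]
    simp
    ring

theorem bump_factor_mem (s : UnitAddCircle) :
    (1 + (fourier 1 s : ℂ).re) / 2 ∈ Icc (0 : ℝ) 1 := by
  have h := abs_le.1 ((Complex.abs_re_le_norm (fourier 1 s : ℂ)).trans_eq
    (by rw [fourier_apply, Circle.norm_coe] : ‖(fourier 1 s : ℂ)‖ = 1))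
  constructor <;> linarith [h.1, h.2]

theorem bump_nonneg (x : Torus d) : 0 ≤ bump x :=
  Finset.prod_nonneg fun i _ => (bump_factor_mem (x i)).1

theorem bump_zero : bump (0 : Torus d) = 1 := by
  simp [bump]

theorem bump_neg (x : Torus d) : bump (-x) = bump x := by
  simp [bump, fourier_apply, AddCircle.toCircle_neg]

theorem bump_lt {x : Torus d} (hx : x ≠ 0) : bump x < 1 := by
  obtain ⟨i, hi⟩ := Function.ne_iff.1 hx
  have h1 : (1 + (fourier 1 (x i) : ℂ).re) / 2 < 1 := by
    refine lt_of_le_of_ne (bump_factor_mem (x i)).2 fun h => hi ?_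
    have hre : (fourier 1 (x i) : ℂ).re = 1 := by linarith
    have h2 : (fourier 1 (x i) : ℂ) = 1 := by
      have hn : ‖(fourier 1 (x i) : ℂ)‖ = 1 := by
        rw [fourier_apply, Circle.norm_coe]
      refine Complex.ext hre ?_
      have := Complex.sq_norm (fourier 1 (x i) : ℂ)
      rw [hn, Complex.normSq_apply, hre] at this
      rw [Complex.one_im]
      nlinarith
    rw [fourier_apply, one_smul] at h2
    refine AddCircle.injective_toCircle one_ne_zero ?_
    rw [Pi.zero_apply, AddCircle.toCircle_zero]
    exact Circle.ext (h2.trans Circle.coe_one.symm)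
  rw [bump, ← Finset.mul_prod_erase _ _ (Finset.mem_univ i)]
  refine (mul_le_of_le_one_right (bump_factor_mem (x i)).1 ?_).trans_lt h1
  exact Finset.prod_le_one (fun j _ => (bump_factor_mem (x j)).1)
    fun j _ => (bump_factor_mem (x j)).2

theorem IsTrigPoly.pow {f : Torus d → ℝ} (hf : IsTrigPoly f) (N : ℕ) :
    IsTrigPoly (fun x => f x ^ N) := by
  obtain ⟨F, hF, h⟩ := hf
  exact ⟨F ^ N, pow_mem hF N, fun x => by simp [h]⟩

theorem IsTrigPoly.const_mul {f : Torus d → ℝ} (hf : IsTrigPoly f) (c : ℝ) :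
    IsTrigPoly (fun x => c * f x) := by
  obtain ⟨F, hF, h⟩ := hf
  exact ⟨(c : ℂ) • F, SMulMemClass.smul_mem _ hF, fun x => by simp [h]⟩

/-- A nonnegative approximate identity made of trigonometric polynomials. -/
def kernel (N : ℕ) (x : Torus d) : ℝ := (∫ y : Torus d, bump y ^ N)⁻¹ * bump x ^ N

theorem isTrigPoly_kernel (N : ℕ) : IsTrigPoly (kernel N : Torus d → ℝ) :=
  (isTrigPoly_bump.pow N).const_mul _

theorem continuous_kernel (N : ℕ) : Continuous (kernel N : Torus d → ℝ) :=
  (isTrigPoly_kernel N).continuous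

theorem kernel_nonneg (N : ℕ) (x : Torus d) : 0 ≤ kernel N x :=
  mul_nonneg (inv_nonneg.2 (integral_nonneg fun y => pow_nonneg (bump_nonneg y) N))
    (pow_nonneg (bump_nonneg x) N)

theorem kernel_neg (N : ℕ) (x : Torus d) : kernel N (-x) = kernel N x := by
  simp [kernel, bump_neg]

theorem kernel_sub_comm (N : ℕ) (x y : Torus d) : kernel N (x - y) = kernel N (y - x) := by
  rw [← kernel_neg, neg_sub]

theorem integral_kernel (N : ℕ) : ∫ x : Torus d, kernel N x = 1 := by
  have hpos : 0 < ∫ y : Torus d, bump y ^ N := by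
    refine (isTrigPoly_bump.pow N).continuous.integral_pos_of_hasCompactSupport_nonneg_nonzero
      (HasCompactSupport.of_compactSpace _) (fun y => pow_nonneg (bump_nonneg y) N) (x := 0) ?_
    simp [bump_zero]
  simp only [kernel]
  rw [integral_const_mul, inv_mul_cancel₀ hpos.ne']

theorem integral_kernel_sub (N : ℕ) (x : Torus d) : ∫ y : Torus d, kernel N (x - y) = 1 := by
  rw [integral_sub_left_eq_self (kernel N) volume x, integral_kernel]

theorem lintegral_kernel_sub (N : ℕ) (x : Torus d) :
    ∫⁻ y : Torus d, ENNReal.ofReal (kernel N (x - y)) = 1 := by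
  rw [← ofReal_integral_eq_lintegral_ofReal, integral_kernel_sub, ENNReal.ofReal_one]
  · exact continuous_integrable ((continuous_kernel N).comp (continuous_const.sub continuous_id))
  · exact Eventually.of_forall fun y => kernel_nonneg N _

/-- The normalised powers of `bump` concentrate at its unique maximum, the origin. -/
theorem tendsto_integral_kernel [CompleteSpace E] {φ : Torus d → E} (hφ : Continuous φ) :
    Tendsto (fun N => ∫ x, kernel N x • φ x) atTop (𝓝 (φ 0)) := by
  have h := tendsto_setIntegral_pow_smul_of_unique_maximum_of_isCompact_of_continuousOn
    (μ := (volume : Measure (Torus d))) (g := φ) (x₀ := 0) (s := univ) (c := bump) isCompact_univ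
    isTrigPoly_bump.continuous.continuousOn (fun y _ hy => by rw [bump_zero]; exact bump_lt hy)
    (fun x _ => bump_nonneg x) (by rw [bump_zero]; exact one_pos) (by simp) hφ.continuousOn
  simp only [Measure.restrict_univ] at h
  refine h.congr fun N => ?_
  simp only [kernel, mul_smul, integral_smul]

/-- The convolution with the kernel. -/
def mollify (N : ℕ) (u : Torus d → E) (x : Torus d) : E := ∫ y, kernel N (x - y) • u y

theorem integrable_comp_sub_smul {K : Torus d → ℝ} (hK : Continuous K) {u : Torus d → E}
    (hu : Integrable u) (x : Torus d) : Integrable (fun y => K (x - y) • u y) := by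
  obtain ⟨C, -, hC⟩ := exists_bound_of_continuous hK
  exact hu.bdd_smul C (hK.comp (continuous_const.sub continuous_id)).aestronglyMeasurable
    (Eventually.of_forall fun y => hC _)

theorem continuous_integral_comp_sub {K : Torus d → ℝ} (hK : Continuous K) {u : Torus d → E}
    (hu : Integrable u) : Continuous (fun x => ∫ y, K (x - y) • u y) := by
  obtain ⟨C, -, hC⟩ := exists_bound_of_continuous hK
  refine continuous_of_dominated (bound := fun y => C * ‖u y‖)
    (fun x => (integrable_comp_sub_smul hK hu x).aestronglyMeasurable)
    (fun x => Eventually.of_forall fun y => ?_) (hu.norm.const_mul C)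
    (Eventually.of_forall fun y => ?_)
  · rw [norm_smul]
    exact mul_le_mul_of_nonneg_right (hC _) (norm_nonneg _)
  · exact (hK.comp (continuous_id.sub continuous_const)).smul continuous_const

theorem hasPDeriv_integral_comp_sub {K K' : Torus d → ℝ} {k : Fin d} (hK : HasPDeriv k K K')
    (cK : Continuous K) (cK' : Continuous K') {u : Torus d → E} (hu : Integrable u) :
    HasPDeriv k (fun x => ∫ y, K (x - y) • u y) (fun x => ∫ y, K' (x - y) • u y) := by
  obtain ⟨C, -, hC⟩ := exists_bound_of_continuous cK'
  intro x
  have h := hasDerivAt_integral_of_dominated_loc_of_deriv_le (μ := (volume : Measure (Torus d)))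
    (F := fun (s : ℝ) y => K (x + Pi.single k (s : UnitAddCircle) - y) • u y)
    (F' := fun (s : ℝ) y => K' (x + Pi.single k (s : UnitAddCircle) - y) • u y)
    (bound := fun y => C * ‖u y‖) (x₀ := (0 : ℝ)) (s := univ) univ_mem
    (Eventually.of_forall fun s => (integrable_comp_sub_smul cK hu _).aestronglyMeasurable)
    (integrable_comp_sub_smul cK hu _) (integrable_comp_sub_smul cK' hu _).aestronglyMeasurable
    (Eventually.of_forall fun y s _ => by
      rw [norm_smul]; exact mul_le_mul_of_nonneg_right (hC _) (norm_nonneg _))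
    (hu.norm.const_mul C)
    (Eventually.of_forall fun y s _ => by
      have := (hK.hasDerivAt (x - y) s).smul_const (u y)
      simpa only [sub_add_eq_add_sub] using this)
  have h2 := h.2
  simpa using h2

theorem continuous_mollify (N : ℕ) {u : Torus d → E} (hu : Integrable u) :
    Continuous (mollify N u) :=
  continuous_integral_comp_sub (continuous_kernel N) hu

theorem mollify_eq (N : ℕ) (u : Torus d → E) (x : Torus d) :
    mollify N u x = ∫ y, kernel N y • u (x - y) := by
  rw [mollify, ← integral_sub_left_eq_self _ volume x]
  simp

theorem norm_mollify_le (N : ℕ) {u : Torus d → E} {C : ℝ} (hC : ∀ x, ‖u x‖ ≤ C) (x : Torus d) :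
    ‖mollify N u x‖ ≤ C := by
  have h : ‖mollify N u x‖ ≤ ∫ y, kernel N (x - y) * C := by
    refine norm_integral_le_of_norm_le ((continuous_integrable
      ((continuous_kernel N).comp (continuous_const.sub continuous_id))).mul_const C) ?_
    refine Eventually.of_forall fun y => ?_
    rw [norm_smul, Real.norm_of_nonneg (kernel_nonneg _ _)]
    exact mul_le_mul_of_nonneg_left (hC y) (kernel_nonneg _ _)
  rwa [integral_mul_const, integral_kernel_sub, one_mul] at h

theorem mollify_mem_Icc (N : ℕ) {u : Torus d → ℝ}
    (h : ∀ x, u x ∈ Icc (0 : ℝ) 1) (x : Torus d) : mollify N u x ∈ Icc (0 : ℝ) 1 := by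
  refine ⟨integral_nonneg fun y => mul_nonneg (kernel_nonneg _ _) (h y).1, ?_⟩
  refine (Real.le_norm_self _).trans (norm_mollify_le N (fun y => ?_) x)
  rw [Real.norm_of_nonneg (h y).1]
  exact (h y).2

theorem tendsto_mollify [CompleteSpace E] {φ : Torus d → E} (hφ : Continuous φ) (x : Torus d) :
    Tendsto (fun N => mollify N φ x) atTop (𝓝 (φ x)) := by
  simp only [mollify_eq]
  simpa using tendsto_integral_kernel (φ := fun y => φ (x - y))
    (hφ.comp (continuous_const.sub continuous_id))

theorem lintegral_mollify (N : ℕ) {F : Torus d → ℝ≥0∞} (hF : AEMeasurable F) :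
    ∫⁻ x, ∫⁻ y, ENNReal.ofReal (kernel N (x - y)) * F y = ∫⁻ y, F y := by
  rw [lintegral_lintegral_swap]
  · refine lintegral_congr fun y => ?_
    rw [lintegral_mul_const _ (by
      exact (ENNReal.continuous_ofReal.comp ((continuous_kernel N).comp
        (continuous_id.sub continuous_const))).measurable)]
    simp_rw [kernel_sub_comm N _ y]
    rw [lintegral_kernel_sub, one_mul]
  · refine AEMeasurable.mul ?_ hF.comp_snd
    exact (ENNReal.continuous_ofReal.comp ((continuous_kernel N).comp
        (continuous_fst.sub continuous_snd))).aemeasurable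

theorem lintegral_enorm_mollify_le (N : ℕ) {u : Torus d → E} (hu : Integrable u) :
    ∫⁻ x, ‖mollify N u x‖ₑ ≤ ∫⁻ x, ‖u x‖ₑ := by
  rw [← lintegral_mollify N hu.aestronglyMeasurable.enorm]
  refine lintegral_mono fun x => (enorm_integral_le_lintegral_enorm _).trans_eq ?_
  refine lintegral_congr fun y => ?_
  rw [enorm_smul, Real.enorm_of_nonneg (kernel_nonneg _ _)]

theorem mollify_sub (N : ℕ) {u v : Torus d → E} (hu : Integrable u) (hv : Integrable v)
    (x : Torus d) : mollify N (u - v) x = mollify N u x - mollify N v x := by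
  simp only [mollify, Pi.sub_apply, smul_sub]
  exact integral_sub (integrable_comp_sub_smul (continuous_kernel N) hu x)
    (integrable_comp_sub_smul (continuous_kernel N) hv x)

/-- Mollifications converge in `L¹`. -/
theorem tendsto_eLpNorm_mollify [CompleteSpace E] {u : Torus d → E} (hu : Integrable u) :
    Tendsto (fun N => eLpNorm (mollify N u - u) 1 volume) atTop (𝓝 0) := by
  rw [ENNReal.tendsto_nhds_zero]
  intro ε hε
  have hε3 : ε / 3 ≠ 0 := (ENNReal.div_pos hε.ne' (by simp)).ne'
  obtain ⟨φ, -, hφu, hφ, -⟩ := (memLp_one_iff_integrable.2 hu).exists_hasCompactSupport_eLpNorm_sub_le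
    (by simp) hε3
  have hφi := continuous_integrable hφ
  obtain ⟨C, -, hC⟩ := exists_bound_of_continuous hφ
  have h1 : Tendsto (fun N => ∫⁻ x, ‖mollify N φ x - φ x‖ₑ) atTop (𝓝 (∫⁻ _ : Torus d, 0)) := by
    refine tendsto_lintegral_of_dominated_convergence (fun _ => ENNReal.ofReal (C + C))
      (fun N => ((continuous_mollify N hφi).sub hφ).enorm.measurable) (fun N => ?_) (by simp) ?_
    · refine Eventually.of_forall fun x => ?_
      simp only [← ofReal_norm]
      exact ENNReal.ofReal_le_ofReal ((norm_sub_le _ _).trans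
        (add_le_add (norm_mollify_le N hC x) (hC x)))
    · refine Eventually.of_forall fun x => ?_
      have := ((tendsto_mollify hφ x).sub_const (φ x)).enorm
      simpa using this
  rw [lintegral_zero] at h1
  filter_upwards [ENNReal.tendsto_nhds_zero.1 h1 (ε / 3) (pos_iff_ne_zero.2 hε3)] with N hN
  have hm : AEStronglyMeasurable (mollify N (u - φ)) volume :=
    (continuous_mollify N (hu.sub hφi)).aestronglyMeasurable
  -- φ is a continuous approximation of u in L¹. The first and third pieces are small because
  -- mollification is an L¹ contraction, the second by pointwise convergence for φ.
  have hsplit : mollify N u - u = mollify N (u - φ) + ((mollify N φ - φ) + (φ - u)) := by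
    ext x
    simp [mollify_sub N hu hφi]
  rw [hsplit]
  refine (eLpNorm_add_le hm ((((continuous_mollify N hφi).sub hφ).aestronglyMeasurable).add
    (hφ.aestronglyMeasurable.sub hu.aestronglyMeasurable)) le_rfl).trans ?_
  refine (add_le_add le_rfl (eLpNorm_add_le ((continuous_mollify N hφi).sub hφ).aestronglyMeasurable
    (hφ.aestronglyMeasurable.sub hu.aestronglyMeasurable) le_rfl)).trans ?_
  have e1 : eLpNorm (mollify N (u - φ)) 1 volume ≤ ε / 3 := by
    refine le_trans ?_ hφu
    rw [eLpNorm_one_eq_lintegral_enorm, eLpNorm_one_eq_lintegral_enorm]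
    exact lintegral_enorm_mollify_le N (hu.sub hφi)
  have e2 : eLpNorm (mollify N φ - φ) 1 volume ≤ ε / 3 := by
    rw [eLpNorm_one_eq_lintegral_enorm]; exact hN
  have e3 : eLpNorm (φ - u) 1 volume ≤ ε / 3 := by rwa [eLpNorm_sub_comm]
  calc _ ≤ ε / 3 + (ε / 3 + ε / 3) := add_le_add e1 (add_le_add e2 e3)
    _ = ε := by rw [← add_assoc]; exact ENNReal.add_thirds ε

theorem integral_mollify_mul (N : ℕ) {u φ : Torus d → ℝ} (hu : Integrable u) (hφ : Continuous φ) :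
    ∫ x, mollify N u x * φ x = ∫ x, u x * mollify N φ x := by
  simp only [mollify, smul_eq_mul, ← integral_mul_const, ← integral_const_mul]
  rw [integral_integral_swap]
  · refine integral_congr_ae (Eventually.of_forall fun y => ?_)
    refine integral_congr_ae (Eventually.of_forall fun x => ?_)
    simp only [kernel_sub_comm N x y]
    ring
  · obtain ⟨C, -, hC⟩ := exists_bound_of_continuous
      (F := fun q : Torus d => kernel N q) (continuous_kernel N)
    obtain ⟨D, -, hD⟩ := exists_bound_of_continuous hφ
    have h1 : Integrable (fun q : Torus d × Torus d => kernel N (q.1 - q.2) * φ q.1 * u q.2)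
        (volume.prod volume) := by
      refine (hu.comp_snd volume).bdd_mul (c := C * D) ?_ ?_
      · exact (((continuous_kernel N).comp (continuous_fst.sub continuous_snd)).mul
          (hφ.comp continuous_fst)).aestronglyMeasurable
      · refine Eventually.of_forall fun q => ?_
        rw [norm_mul]
        exact mul_le_mul (hC _) (hD _) (norm_nonneg _) ((norm_nonneg _).trans (hC 0))
    refine h1.congr (Eventually.of_forall fun q => ?_)
    simp only [Function.uncurry]
    ring

theorem HasPDeriv.comp_sub_left {K K' : Torus d → ℝ} {k : Fin d} (hK : HasPDeriv k K K')
    (x : Torus d) : HasPDeriv k (fun y => K (x - y)) (fun y => - K' (x - y)) := by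
  intro y
  have h2 := hK.hasDerivAt (x - y) 0
  have h3 : HasDerivAt (fun s : ℝ => -s) (-1) 0 := hasDerivAt_neg 0
  have h4 := HasDerivAt.scomp (0 : ℝ)
    (g₁ := fun s : ℝ => K (x - y + Pi.single k (s : UnitAddCircle))) (by simpa using h2) h3
  simp only [neg_smul, one_smul] at h4
  refine (h4.congr_of_eventuallyEq (Eventually.of_forall fun s => ?_))
  simp only [Function.comp_apply]
  rw [AddCircle.coe_neg, Pi.single_neg]
  congr 1
  abel

/-- The weak gradient is tested against y ↦ kernel N (x - y); the sign of its derivative in y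
cancels the sign of the weak formulation. -/
theorem HasWeakGradient.hasPDeriv_mollify {u : Torus d → ℝ} {g : Torus d → EuclideanSpace ℝ (Fin d)}
    (h : HasWeakGradient u g) (N : ℕ) (k : Fin d) :
    HasPDeriv k (mollify N u) (fun x => mollify N g x k) := by
  obtain ⟨κ, hκ, hd⟩ := (isTrigPoly_kernel (d := d) N).exists_hasPDeriv k
  refine (hasPDeriv_integral_comp_sub hd (continuous_kernel N) hκ.continuous h.1).congr
    (fun x => rfl) fun x => ?_
  have h1 : HasPDeriv k (fun y => kernel N (x - y)) (fun y => - κ (x - y)) := hd.comp_sub_left x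
  have h2 := h.2.2 _ ((isTrigPoly_kernel N).comp_sub_left x).torusContDiff k
  rw [h1.pderiv_eq] at h2
  have h3 : mollify N g x k = ∫ y, kernel N (x - y) * g y k := by
    have := (EuclideanSpace.proj (𝕜 := ℝ) k).integral_comp_comm
      (integrable_comp_sub_smul (continuous_kernel N) h.2.1 x)
    exact this.symm
  rw [h3]
  simp only [mul_neg, integral_neg, neg_inj] at h2
  simp only [smul_eq_mul]
  rw [show (fun y => κ (x - y) * u y) = fun y => u y * κ (x - y) from funext fun y => mul_comm _ _, h2]
  exact integral_congr_ae (Eventually.of_forall fun y => mul_comm _ _)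

end Mollify

/-! ### The quadratic quotient -/

section SqQuot

variable {d : ℕ}

local notation "V" => EuclideanSpace ℝ (Fin d)

theorem sqQuot_of_pos (v : V) {b : ℝ} (hb : 0 < b) :
    sqQuot v b = ENNReal.ofReal (‖v‖ ^ 2 / b) := by
  rw [sqQuot, ENNReal.ofReal_div_of_pos hb]

theorem sqQuot_zero_left (b : ℝ) : sqQuot (0 : V) b = 0 := by
  simp [sqQuot]

theorem sqQuot_of_nonpos {v : V} (hv : v ≠ 0) {b : ℝ} (hb : b ≤ 0) : sqQuot v b = ⊤ := by
  rw [sqQuot, ENNReal.ofReal_of_nonpos hb, ENNReal.div_zero]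
  simpa using norm_pos_iff.2 hv

theorem sqQuot_eq_of_ne_top {v : V} {b : ℝ} (hb : 0 ≤ b) (h : sqQuot v b ≠ ⊤) :
    sqQuot v b = ENNReal.ofReal (‖v‖ ^ 2 / b) ∧ (b = 0 → v = 0) := by
  rcases hb.eq_or_lt with rfl | hb
  · have hv : v = 0 := by
      by_contra hv
      exact h (sqQuot_of_nonpos hv le_rfl)
    subst hv
    simp [sqQuot_zero_left]
  · exact ⟨sqQuot_of_pos v hb, fun h => absurd h hb.ne'⟩

@[fun_prop]
theorem _root_.AEMeasurable.sqQuot {α : Type*} [MeasurableSpace α] {μ : Measure α} {v : α → V}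
    {b : α → ℝ} (hv : AEMeasurable v μ) (hb : AEMeasurable b μ) :
    AEMeasurable (fun x => sqQuot (v x) (b x)) μ := by
  unfold WASEP.sqQuot
  fun_prop

@[fun_prop]
theorem _root_.Measurable.sqQuot {α : Type*} [MeasurableSpace α] {v : α → V}
    {b : α → ℝ} (hv : Measurable v) (hb : Measurable b) :
    Measurable (fun x => sqQuot (v x) (b x)) := by
  unfold WASEP.sqQuot
  fun_prop

theorem two_inner_sub_le (q v : V) {b : ℝ} (hb : 0 < b) :
    2 * inner ℝ q v - ‖q‖ ^ 2 * b ≤ ‖v‖ ^ 2 / b := by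
  rw [le_div_iff₀ hb]
  have h1 := real_inner_le_norm q v
  nlinarith [sq_nonneg (‖q‖ * b - ‖v‖)]

theorem ofReal_inner_sub_le_sqQuot (q v : V) {b : ℝ} (hb : 0 ≤ b) :
    ENNReal.ofReal (2 * inner ℝ q v - ‖q‖ ^ 2 * b) ≤ sqQuot v b := by
  rcases hb.eq_or_lt with rfl | hb
  · by_cases hv : v = 0
    · simp [hv]
    · simp [sqQuot_of_nonpos hv le_rfl]
  · rw [sqQuot_of_pos v hb]
    exact ENNReal.ofReal_le_ofReal (two_inner_sub_le q v hb)

/-- Legendre duality. The bounds on the right are affine in (v, b), which is the source of lower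
semicontinuity and of every Jensen inequality below, and b = 0 is included. -/
theorem sqQuot_eq_iSup (v : V) {b : ℝ} (hb : 0 ≤ b) :
    sqQuot v b = ⨆ q : V, ENNReal.ofReal (2 * inner ℝ q v - ‖q‖ ^ 2 * b) := by
  refine le_antisymm ?_ (iSup_le fun q => ofReal_inner_sub_le_sqQuot q v hb)
  rcases hb.eq_or_lt with rfl | hb
  · by_cases hv : v = 0
    · simp [hv, sqQuot_zero_left]
    · have hv' : 0 < ‖v‖ ^ 2 := by positivity
      rw [sqQuot_of_nonpos hv le_rfl, top_le_iff, iSup_eq_top]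
      intro c hc
      -- For b = 0 the expression is linear in q, and this multiple of v gives 2(c + 1) > c.
      refine ⟨((c.toReal + 1) / ‖v‖ ^ 2) • v, ?_⟩
      rw [inner_smul_left, real_inner_self_eq_norm_sq, ENNReal.lt_ofReal_iff_toReal_lt hc.ne]
      simp only [mul_zero, sub_zero, RCLike.conj_to_real]
      rw [div_mul_cancel₀ _ hv'.ne']
      have := c.toReal_nonneg
      linarith
  · rw [sqQuot_of_pos v hb]
    -- The maximiser is v / b.
    refine le_iSup_of_le (b⁻¹ • v) (ENNReal.ofReal_le_ofReal ?_)
    rw [inner_smul_left, real_inner_self_eq_norm_sq, norm_smul, mul_pow, Real.norm_of_nonneg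
      (by positivity), RCLike.conj_to_real]
    apply le_of_eq
    field_simp
    ring

theorem sqQuot_le_liminf {ι : Type*} {l : Filter ι} [l.NeBot] {v : ι → V} {b : ι → ℝ} {v₀ : V}
    {b₀ : ℝ} (hv : Tendsto v l (𝓝 v₀)) (hb : Tendsto b l (𝓝 b₀)) (hb0 : ∀ i, 0 ≤ b i) :
    sqQuot v₀ b₀ ≤ liminf (fun i => sqQuot (v i) (b i)) l := by
  rw [sqQuot_eq_iSup v₀ (ge_of_tendsto' hb hb0)]
  refine iSup_le fun q => ?_
  have h : Tendsto (fun i => ENNReal.ofReal (2 * inner ℝ q (v i) - ‖q‖ ^ 2 * b i)) l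
      (𝓝 (ENNReal.ofReal (2 * inner ℝ q v₀ - ‖q‖ ^ 2 * b₀))) :=
    (ENNReal.continuous_ofReal.tendsto _).comp
      (((tendsto_const_nhds.inner hv).const_mul 2).sub (hb.const_mul _))
  rw [← h.liminf_eq]
  exact liminf_le_liminf (Eventually.of_forall fun i => ofReal_inner_sub_le_sqQuot q _ (hb0 i))

theorem mobility_nonneg {r : ℝ} (hr : r ∈ Icc (0 : ℝ) 1) : 0 ≤ mobility r :=
  mul_nonneg hr.1 (by linarith [hr.2])

theorem mobility_le (r : ℝ) : mobility r ≤ 1 / 4 := by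
  unfold mobility; nlinarith [sq_nonneg (r - 1 / 2)]

/-- The tangent line at a of the concave function σ. The Jensen inequalities integrate it with a
equal to the mean, where a² + (1 - 2a)a = σ(a). -/
theorem mobility_le_affine (a r : ℝ) : mobility r ≤ a ^ 2 + (1 - 2 * a) * r := by
  unfold mobility; nlinarith [sq_nonneg (r - a)]

@[fun_prop]
theorem continuous_mobility : Continuous mobility := by
  unfold mobility; fun_prop

@[fun_prop]
theorem measurable_mobility : Measurable mobility := continuous_mobility.measurable

/-- By concavity σ((1-δ)r + δ/2) ≥ (1-δ)σ(r), while the numerator gains the factor (1-δ)². This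
permits moving a density away from 0 and 1 without raising its energy. -/
theorem sqQuot_mix_le (v : V) {r : ℝ} (hr : r ∈ Icc (0 : ℝ) 1) {δ : ℝ} (hδ : δ ∈ Icc (0 : ℝ) 1) :
    sqQuot ((1 - δ) • v) (4 * mobility ((1 - δ) * r + δ / 2)) ≤ sqQuot v (4 * mobility r) := by
  have h0 : 0 ≤ mobility r := mobility_nonneg hr
  have h1 : (1 - δ) * mobility r ≤ mobility ((1 - δ) * r + δ / 2) := by
    unfold mobility
    nlinarith [mul_nonneg (mul_nonneg hδ.1 (sub_nonneg.2 hδ.2)) (sq_nonneg (r - 1 / 2)), hδ.1]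
  have h2 : 0 ≤ 1 - δ := by linarith [hδ.2]
  rw [sqQuot_eq_iSup _ (by nlinarith)]
  refine iSup_le fun q => le_trans ?_ (ofReal_inner_sub_le_sqQuot q v (by linarith))
  rw [inner_smul_right]
  rcases le_total 0 (2 * inner ℝ q v - ‖q‖ ^ 2 * (4 * mobility r)) with h | h
  · refine ENNReal.ofReal_le_ofReal ?_
    nlinarith [mul_le_mul_of_nonneg_left h1 (sq_nonneg ‖q‖), mul_nonneg hδ.1 h]
  · rw [ENNReal.ofReal_of_nonpos]
    · exact zero_le
    · nlinarith [mul_le_mul_of_nonneg_left h1 (sq_nonneg ‖q‖), mul_nonpos_of_nonneg_of_nonpos h2 h]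

theorem ofReal_integral_le_lintegral {α : Type*} [MeasurableSpace α] {μ : Measure α} {f : α → ℝ}
    (hf : Integrable f μ) : ENNReal.ofReal (∫ x, f x ∂μ) ≤ ∫⁻ x, ENNReal.ofReal (f x) ∂μ := by
  rw [integral_eq_lintegral_pos_part_sub_lintegral_neg_part hf]
  refine (ENNReal.ofReal_le_ofReal (sub_le_self _ ENNReal.toReal_nonneg)).trans ?_
  exact ENNReal.ofReal_toReal_le

/-- Jensen's inequality for the quadratic quotient under mollification. -/
theorem sqQuot_mollify_le (N : ℕ) {r : Torus d → ℝ} {v : Torus d → V} (hr : Integrable r)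
    (hv : Integrable v) (h01 : ∀ x, r x ∈ Icc (0 : ℝ) 1) (x : Torus d) :
    sqQuot (mollify N v x) (4 * mobility (mollify N r x)) ≤
      ∫⁻ y, ENNReal.ofReal (kernel N (x - y)) * sqQuot (v y) (4 * mobility (r y)) := by
  set a := mollify N r x with ha
  have ha01 : a ∈ Icc (0 : ℝ) 1 := mollify_mem_Icc N h01 x
  rw [sqQuot_eq_iSup _ (mul_nonneg zero_le_four (mobility_nonneg ha01))]
  refine iSup_le fun q => ?_
  have hi1 : Integrable (fun y => kernel N (x - y) • v y) :=
    integrable_comp_sub_smul (continuous_kernel N) hv x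
  have hi2 : Integrable (fun y => kernel N (x - y) * r y) :=
    integrable_comp_sub_smul (continuous_kernel N) hr x
  have hi3 : Integrable (fun y => kernel N (x - y)) :=
    continuous_integrable ((continuous_kernel N).comp (continuous_const.sub continuous_id))
  have hi1q : Integrable (fun y => inner ℝ q (kernel N (x - y) • v y)) := hi1.const_inner q
  have hi4 : Integrable (fun y => 4 * ‖q‖ ^ 2 * a ^ 2 * kernel N (x - y)
      + 4 * ‖q‖ ^ 2 * (1 - 2 * a) * (kernel N (x - y) * r y)) :=
    (hi3.const_mul _).add (hi2.const_mul _)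
  have e1 : ∫ y, inner ℝ q (kernel N (x - y) • v y) = inner ℝ q (mollify N v x) :=
    integral_inner hi1 q
  -- The affine bound for q is written as an average over the kernel, with the mobility replaced by
  -- its tangent line at the mean a.
  have e : 2 * inner ℝ q (mollify N v x) - ‖q‖ ^ 2 * (4 * mobility a) =
      ∫ y, (2 * inner ℝ q (kernel N (x - y) • v y) - (4 * ‖q‖ ^ 2 * a ^ 2 * kernel N (x - y)
        + 4 * ‖q‖ ^ 2 * (1 - 2 * a) * (kernel N (x - y) * r y))) := by
    rw [integral_sub (hi1q.const_mul 2) hi4,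
      integral_add (hi3.const_mul _) (hi2.const_mul _), integral_const_mul, integral_const_mul,
      integral_const_mul, e1, integral_kernel_sub]
    have : ∫ y, kernel N (x - y) * r y = a := rfl
    rw [this]
    unfold mobility
    ring
  rw [e]
  refine (ofReal_integral_le_lintegral ((hi1q.const_mul 2).sub hi4)).trans (lintegral_mono fun y => ?_)
  have hk := kernel_nonneg N (x - y)
  calc ENNReal.ofReal (2 * inner ℝ q (kernel N (x - y) • v y) - (4 * ‖q‖ ^ 2 * a ^ 2
          * kernel N (x - y) + 4 * ‖q‖ ^ 2 * (1 - 2 * a) * (kernel N (x - y) * r y)))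
      ≤ ENNReal.ofReal (kernel N (x - y) * (2 * inner ℝ q (v y)
          - ‖q‖ ^ 2 * (4 * mobility (r y)))) := by
        refine ENNReal.ofReal_le_ofReal ?_
        rw [inner_smul_right]
        have h1 := mul_le_mul_of_nonneg_left (mobility_le_affine a (r y))
          (mul_nonneg hk (sq_nonneg ‖q‖))
        nlinarith
    _ = ENNReal.ofReal (kernel N (x - y)) * ENNReal.ofReal (2 * inner ℝ q (v y)
          - ‖q‖ ^ 2 * (4 * mobility (r y))) := ENNReal.ofReal_mul hk
    _ ≤ _ := by
        gcongr
        exact ofReal_inner_sub_le_sqQuot q _ (mul_nonneg zero_le_four (mobility_nonneg (h01 y)))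

/-- Lower semicontinuity of the integrated quotient under convergence in measure. -/
theorem lintegral_sqQuot_le_of_tendstoInMeasure {α : Type*} [MeasurableSpace α] {μ : Measure α}
    {r : ℕ → α → ℝ} {v : ℕ → α → V} {r₀ : α → ℝ} {v₀ : α → V} {c : ℕ → ℝ≥0∞} {c₀ : ℝ≥0∞}
    (hr : TendstoInMeasure μ r atTop r₀) (hv : TendstoInMeasure μ v atTop v₀)
    (mr : ∀ n, AEMeasurable (r n) μ) (mv : ∀ n, AEMeasurable (v n) μ)
    (h01 : ∀ n, ∀ᵐ x ∂μ, r n x ∈ Icc (0 : ℝ) 1) {F : α → V} (mF : AEMeasurable F μ)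
    (hc : Tendsto c atTop (𝓝 c₀))
    (hle : ∀ n, ∫⁻ x, sqQuot (v n x + mobility (r n x) • F x) (4 * mobility (r n x)) ∂μ ≤ c n) :
    ∫⁻ x, sqQuot (v₀ x + mobility (r₀ x) • F x) (4 * mobility (r₀ x)) ∂μ ≤ c₀ := by
  -- Two extractions, the second along the first, so that densities and fields converge almost
  -- everywhere along one subsequence.
  obtain ⟨n₁, hn₁, ht₁⟩ := hr.exists_seq_tendsto_ae
  have hv' : TendstoInMeasure μ (fun i => v (n₁ i)) atTop v₀ :=
    fun ε hε => (hv ε hε).comp hn₁.tendsto_atTop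
  obtain ⟨n₂, hn₂, ht₂⟩ := hv'.exists_seq_tendsto_ae
  have ht : Tendsto (fun i => n₁ (n₂ i)) atTop atTop :=
    hn₁.tendsto_atTop.comp hn₂.tendsto_atTop
  generalize hR : (fun i => r (n₁ (n₂ i))) = R
  generalize hW : (fun i => v (n₁ (n₂ i))) = W
  have hR01 : ∀ᵐ x ∂μ, ∀ i, R i x ∈ Icc (0 : ℝ) 1 := by
    rw [← hR]; exact ae_all_iff.2 fun i => h01 _
  have mR : ∀ i, AEMeasurable (R i) μ := fun i => by rw [← hR]; exact mr _
  have mW : ∀ i, AEMeasurable (W i) μ := fun i => by rw [← hW]; exact mv _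
  have tR : ∀ᵐ x ∂μ, Tendsto (fun i => R i x) atTop (𝓝 (r₀ x)) := by
    filter_upwards [ht₁] with x h1
    rw [← hR]
    exact h1.comp hn₂.tendsto_atTop
  have tW : ∀ᵐ x ∂μ, Tendsto (fun i => W i x) atTop (𝓝 (v₀ x)) := by
    filter_upwards [ht₂] with x h1
    rw [← hW]
    exact h1
  have hRW : ∀ i, ∫⁻ x, sqQuot (W i x + mobility (R i x) • F x) (4 * mobility (R i x)) ∂μ
      ≤ c (n₁ (n₂ i)) := fun i => by rw [← hR, ← hW]; exact hle _
  refine le_trans (lintegral_mono_ae ?_) ((lintegral_liminf_le' (u := atTop) (f := fun i x =>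
    sqQuot (W i x + mobility (R i x) • F x) (4 * mobility (R i x))) fun i => ?_).trans ?_)
  · filter_upwards [tR, tW, hR01] with x h1 h2 h3
    have h4 : Tendsto (fun i => mobility (R i x)) atTop (𝓝 (mobility (r₀ x))) :=
      (continuous_mobility.tendsto _).comp h1
    have h5 : Tendsto (fun i => W i x + mobility (R i x) • F x) atTop
        (𝓝 (v₀ x + mobility (r₀ x) • F x)) := h2.add (h4.smul_const _)
    exact sqQuot_le_liminf h5 (h4.const_mul 4)
      fun i => mul_nonneg zero_le_four (mobility_nonneg (h3 i))
  · have hm : AEMeasurable (fun x => mobility (R i x)) μ :=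
      measurable_mobility.comp_aemeasurable (mR i)
    exact ((mW i).add (hm.smul mF)).sqQuot (hm.const_mul 4)
  · rw [← (hc.comp ht).liminf_eq]
    exact liminf_le_liminf (Eventually.of_forall hRW)

end SqQuot

/-! ### The continuity equation -/

section ContinuityEquation

/-- The continuity equation is given only in doubly integrated form. Differentiating in s yields
∫_s^t w = (t - s) w(s), and differentiating this in t yields w(t) = w(s). -/
theorem eq_of_integral_integral_sub_eq_zero {w : ℝ → ℂ} (hw : Continuous w)
    (h : ∀ s t, s < t → ∫ s₁ in s..t, ∫ s₂ in s₁..t, (w s₂ - w s₁) = 0) (s t : ℝ) (hst : s < t) :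
    w t = w s := by
  have hint : ∀ a b, IntervalIntegrable w volume a b := fun a b => hw.intervalIntegrable a b
  have hF : ∀ s₁ t, ∫ s₂ in s₁..t, (w s₂ - w s₁) = (∫ s₂ in s₁..t, w s₂) - (t - s₁) • w s₁ := by
    intro s₁ t
    rw [intervalIntegral.integral_sub (hint _ _) (by simp), intervalIntegral.integral_const]
  have h1 : ∀ s t, s < t → ∫ s₂ in s..t, w s₂ = (t - s) • w s := by
    intro s t hst
    have hc : Continuous (fun s₁ => (∫ s₂ in s₁..t, w s₂) - (t - s₁) • w s₁) := by
      have : (fun s₁ => ∫ s₂ in s₁..t, w s₂) = fun s₁ => - ∫ s₂ in t..s₁, w s₂ := by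
        ext s₁; rw [intervalIntegral.integral_symm]
      have h2 : Continuous fun s₁ => ∫ s₂ in s₁..t, w s₂ := by
        rw [this]; exact (intervalIntegral.continuous_primitive hint t).neg
      fun_prop
    have hd := intervalIntegral.integral_hasDerivAt_left (hc.intervalIntegrable s t)
      hc.stronglyMeasurable.stronglyMeasurableAtFilter hc.continuousAt
    have h0 : HasDerivAt (fun u => ∫ s₁ in u..t, ((∫ s₂ in s₁..t, w s₂) - (t - s₁) • w s₁)) 0 s := by
      refine (hasDerivAt_const s (0 : ℂ)).congr_of_eventuallyEq ?_
      filter_upwards [Iio_mem_nhds hst] with u hu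
      rw [← h u t hu]
      simp only [hF]
    have := hd.unique h0
    rw [neg_eq_zero, sub_eq_zero] at this
    exact this
  have hd1 := intervalIntegral.integral_hasDerivAt_right (hint s t)
      hw.stronglyMeasurable.stronglyMeasurableAtFilter hw.continuousAt
  have hd2 : HasDerivAt (fun u => (u - s) • w s) ((1 : ℝ) • w s) t :=
    ((hasDerivAt_id t).sub_const s).smul_const (w s)
  rw [one_smul] at hd2
  refine hd1.unique (hd2.congr_of_eventuallyEq ?_)
  filter_upwards [Ioi_mem_nhds hst] with u hu
  exact h1 s u hu

variable {d : ℕ}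

/-- Every mode has positive weight, so each element of the Sobolev space has well-defined Fourier
coefficients. -/
theorem ae_sobolevWeight_iff {q : ℝ} {P : (Fin d → ℤ) → Prop} :
    (∀ᵐ n ∂sobolevWeight d q, P n) ↔ ∀ n, P n := by
  rw [sobolevWeight, ae_withDensity_iff (measurable_of_countable _), Measure.ae_count_iff]
  refine forall_congr' fun n => ⟨fun h => h ?_, fun h _ => h⟩
  rw [Ne, ENNReal.ofReal_eq_zero, not_le]
  positivity

theorem sobolevField_sub_apply {q : ℝ} (J K : SobolevField d q) (n : Fin d → ℤ) :
    (J - K) n = J n - K n :=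
  ae_sobolevWeight_iff.1 (Lp.coeFn_sub J K) n

theorem sobolevField_zero_apply {q : ℝ} (n : Fin d → ℤ) : (0 : SobolevField d q) n = 0 :=
  ae_sobolevWeight_iff.1 (Lp.coeFn_zero _ _ _) n

theorem ofReal_sq_norm_le_sqQuot (v : EuclideanSpace ℝ (Fin d)) {b : ℝ} (hb0 : 0 ≤ b) (hb1 : b ≤ 1) :
    ENNReal.ofReal (‖v‖ ^ 2) ≤ sqQuot v b := by
  rcases hb0.eq_or_lt with rfl | hb
  · by_cases hv : v = 0
    · simp [hv]
    · simp [sqQuot_of_nonpos hv le_rfl]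
  · rw [sqQuot_of_pos v hb]
    exact ENNReal.ofReal_le_ofReal ((le_div_iff₀ hb).2 (mul_le_of_le_one_right (by positivity) hb1))

/-- A vector field of finite energy on a bounded time interval is square integrable. -/
theorem memLp_of_energy {ρ : ℝ → Torus d → ℝ} {j : ℝ → Torus d → EuclideanSpace ℝ (Fin d)}
    (hj : Measurable (Function.uncurry j)) (hρ : ∀ t x, ρ t x ∈ Icc (0 : ℝ) 1) {I : Set ℝ}
    (hE : ∫⁻ t in I, ∫⁻ x, sqQuot (j t x) (mobility (ρ t x)) < ∞) :
    MemLp (Function.uncurry j) 2 ((volume.restrict I).prod volume) := by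
  refine ⟨hj.aestronglyMeasurable, ?_⟩
  rw [eLpNorm_lt_top_iff_lintegral_rpow_enorm_lt_top (by simp) (by simp)]
  refine lt_of_le_of_lt ?_ hE
  rw [lintegral_prod _ (by fun_prop)]
  refine lintegral_mono fun t => lintegral_mono fun x => ?_
  refine le_trans (le_of_eq ?_) (ofReal_sq_norm_le_sqQuot (j t x) (mobility_nonneg (hρ t x))
    ((mobility_le _).trans (by norm_num)))
  simp only [Function.uncurry, ENNReal.toReal_ofNat, ENNReal.rpow_ofNat]
  rw [ENNReal.ofReal_pow (norm_nonneg _), ofReal_norm]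

section Densities

variable {p m : ℝ} {z : PathSpace d p} {ρ : ℝ → Torus d → ℝ}
  {g j : ℝ → Torus d → EuclideanSpace ℝ (Fin d)}

instance (a b : ℝ) : IsFiniteMeasure ((volume : Measure ℝ).restrict (uIcc a b)) :=
  ⟨by simp [uIcc]⟩

theorem exists_Icc_symm_superset (a b : ℝ) : ∃ S > 0, uIcc a b ⊆ Icc (-S) S := by
  refine ⟨max |a| |b| + 1, by positivity, fun s hs => abs_le.1 ?_⟩
  have h1 := abs_le_max_abs_abs hs.1 hs.2
  have h2 : |min a b| ≤ max |a| |b| := abs_min_le_max_abs_abs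
  have h3 : |max a b| ≤ max |a| |b| := abs_max_le_max_abs_abs
  linarith [h1.trans (max_le h2 h3)]

theorem HasDensities.memLp_current (h : HasDensities m z ρ g j) (a b : ℝ) :
    MemLp (Function.uncurry j) 2 ((volume.restrict (uIcc a b)).prod volume) := by
  obtain ⟨S, hS, hsub⟩ := exists_Icc_symm_superset a b
  exact (memLp_of_energy h.measurable_current h.density_mem (h.current_energy S hS)).mono_measure
    (Measure.prod_mono (Measure.restrict_mono hsub le_rfl) le_rfl)

theorem HasDensities.memLp_gradient (h : HasDensities m z ρ g j) (a b : ℝ) :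
    MemLp (Function.uncurry g) 2 ((volume.restrict (uIcc a b)).prod volume) := by
  obtain ⟨S, hS, hsub⟩ := exists_Icc_symm_superset a b
  exact (memLp_of_energy h.measurable_gradient h.density_mem (h.gradient_energy S hS)).mono_measure
    (Measure.prod_mono (Measure.restrict_mono hsub le_rfl) le_rfl)

theorem HasDensities.integrable_current (h : HasDensities m z ρ g j) (a b : ℝ) :
    Integrable (Function.uncurry j) ((volume.restrict (uIcc a b)).prod volume) :=
  (h.memLp_current a b).integrable one_le_two

theorem HasDensities.integrable_density (h : HasDensities m z ρ g j) (t : ℝ) :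
    Integrable (ρ t) :=
  Integrable.of_bound (h.measurable_density.of_uncurry_left).aestronglyMeasurable 1
    (Eventually.of_forall fun x => by
      rw [Real.norm_of_nonneg (h.density_mem t x).1]; exact (h.density_mem t x).2)

theorem HasDensities.integral_dens (h : HasDensities m z ρ g j) (t : ℝ) (f : Torus d → ℝ) :
    ∫ x, f x ∂((z.dens t : FiniteMeasure (Torus d)) : Measure (Torus d)) = ∫ x, ρ t x * f x := by
  rw [h.dens_eq, integral_withDensity_eq_integral_toReal_smul
    (h.measurable_density.of_uncurry_left).ennreal_ofReal (by simp)]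
  refine integral_congr_ae (Eventually.of_forall fun x => ?_)
  simp [ENNReal.toReal_ofReal (h.density_mem t x).1]

/-- The time derivative of the integral of `f` against the density. -/
def transport (j : ℝ → Torus d → EuclideanSpace ℝ (Fin d)) (f : Torus d → ℝ) (τ : ℝ) : ℝ :=
  ∑ k, ∫ x, j τ x k * pderiv k f x

theorem norm_coord_le (v : EuclideanSpace ℝ (Fin d)) (k : Fin d) : ‖v k‖ ≤ ‖v‖ :=
  PiLp.norm_apply_le v k

theorem Integrable.coord {α : Type*} [MeasurableSpace α] {μ : Measure α}
    {v : α → EuclideanSpace ℝ (Fin d)} (hv : Integrable v μ) (k : Fin d) :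
    Integrable (fun x => v x k) μ :=
  (EuclideanSpace.proj (𝕜 := ℝ) k).integrable_comp hv

theorem HasDensities.integrable_current_mul (h : HasDensities m z ρ g j) (a b : ℝ) (k : Fin d)
    {f : Torus d → ℝ} (hf : Continuous f) :
    Integrable (fun q : ℝ × Torus d => j q.1 q.2 k * f q.2)
      ((volume.restrict (uIcc a b)).prod volume) := by
  obtain ⟨C, -, hC⟩ := exists_bound_of_continuous hf
  exact (Integrable.coord (h.integrable_current a b) k).mul_bdd
    (hf.comp continuous_snd).aestronglyMeasurable (Eventually.of_forall fun q => hC q.2)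

theorem HasDensities.intervalIntegrable_transport (h : HasDensities m z ρ g j) {f : Torus d → ℝ}
    (hf : ∀ k, Continuous (pderiv k f)) (a b : ℝ) :
    IntervalIntegrable (transport j f) volume a b := by
  have h1 : IntegrableOn (transport j f) (uIcc a b) := by
    unfold transport
    exact integrable_finsetSum _ fun k _ =>
      (h.integrable_current_mul a b k (hf k)).integral_prod_left
  rw [intervalIntegrable_iff]
  exact h1.mono_set uIoc_subset_uIcc

/-- For a trigonometric polynomial the series of the pairing is a finite sum; it is exchanged with
the time integral, and Parseval's identity is applied at almost every time. For this reason the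
mollifying kernel consists of trigonometric polynomials. -/
theorem HasDensities.pairing_curr (h : HasDensities m z ρ g j) {f : Torus d → ℝ}
    (hf : IsTrigPoly f) (s t : ℝ) :
    pairing (z.curr t - z.curr s) (grad f) = ((∫ τ in s..t, transport j f τ : ℝ) : ℂ) := by
  choose f' hf' hd using fun k => hf.exists_hasPDeriv k
  have hp : ∀ k, pderiv k f = f' k := fun k => (hd k).pderiv_eq
  choose σ hσ0 hσ using fun k => (hf' k).exists_parseval
  classical
  set K := Finset.univ.biUnion σ with hK
  have hsub : ∀ k, σ k ⊆ K := fun k => Finset.subset_biUnion_of_mem σ (Finset.mem_univ k)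
  have hcoefint : ∀ (n : Fin d → ℤ) k a b,
      IntervalIntegrable (fun τ => torusFourierCoeff (fun x => j τ x k) n) volume a b := by
    intro n k a b
    rw [intervalIntegrable_iff]
    have h1 : Integrable (fun q : ℝ × Torus d => ((j q.1 q.2 k : ℝ) : ℂ) *
        conj (UnitAddTorus.mFourier n q.2)) ((volume.restrict (uIcc a b)).prod volume) := by
      refine ((Integrable.coord (h.integrable_current a b) k).ofReal).mul_bdd (c := 1)
        (Complex.continuous_conj.comp
          ((UnitAddTorus.mFourier n).continuous.comp continuous_snd)).aestronglyMeasurable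
        (Eventually.of_forall fun q => ?_)
      rw [RCLike.norm_conj]
      exact ((UnitAddTorus.mFourier n).norm_coe_le_norm q.2).trans UnitAddTorus.mFourier_norm.le
    have h2 : IntegrableOn (fun τ => torusFourierCoeff (fun x => j τ x k) n) (uIcc a b) :=
      h1.integral_prod_left
    exact h2.mono_set uIoc_subset_uIcc
  have hsum : pairing (z.curr t - z.curr s) (grad f) = ∑ n ∈ K, ∑ k,
      (∫ τ in s..t, torusFourierCoeff (fun x => j τ x k) n) * conj (torusFourierCoeff (f' k) n) := by
    unfold pairing
    rw [tsum_eq_sum (s := K)]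
    · refine Finset.sum_congr rfl fun n _ => Finset.sum_congr rfl fun k _ => ?_
      rw [sobolevField_sub_apply, PiLp.sub_apply, h.curr_eq, h.curr_eq,
        intervalIntegral.integral_interval_sub_left (hcoefint _ _ _ _) (hcoefint _ _ _ _), ← hp]
      rfl
    · intro n hn
      refine Finset.sum_eq_zero fun k _ => ?_
      have : torusFourierCoeff (fun x => grad f x k) n = 0 := by
        have h1 : (fun x => grad f x k) = f' k := by rw [← hp]; rfl
        rw [h1]
        exact hσ0 k n fun hmem => hn (hsub k hmem)
      rw [this, map_zero, mul_zero]
  rw [hsum, Finset.sum_comm]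
  simp only [← intervalIntegral.integral_mul_const]
  have hswap : ∀ k, ∑ n ∈ K, ∫ τ in s..t, torusFourierCoeff (fun x => j τ x k) n *
      conj (torusFourierCoeff (f' k) n) =
      ∫ τ in s..t, ((∫ x, j τ x k * f' k x : ℝ) : ℂ) := by
    intro k
    rw [← intervalIntegral.integral_finsetSum fun n _ => (hcoefint n k s t).mul_const _]
    refine intervalIntegral.integral_congr_ae_restrict ?_
    have hae : ∀ᵐ τ ∂(volume.restrict (uIcc s t)), Integrable (fun x => j τ x k) :=
      (Integrable.coord (h.integrable_current s t) k).prod_right_ae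
    filter_upwards [ae_restrict_of_ae_restrict_of_subset uIoc_subset_uIcc hae] with τ hτ
    exact hσ k K (hsub k) _ hτ
  simp only [hswap]
  simp only [intervalIntegral.integral_ofReal, ← Complex.ofReal_sum]
  congr 1
  unfold transport
  rw [intervalIntegral.integral_finsetSum]
  · simp only [hp]
  · intro k _
    rw [intervalIntegrable_iff, hp]
    have h2 : IntegrableOn (fun τ => ∫ x, j τ x k * f' k x) (uIcc s t) :=
      (h.integrable_current_mul s t k (hf' k).continuous).integral_prod_left
    exact h2.mono_set uIoc_subset_uIcc

/-- The continuity equation in integrated form. -/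
theorem HasDensities.integral_density_sub (h : HasDensities m z ρ g j) {f : Torus d → ℝ}
    (hf : IsTrigPoly f) {s t : ℝ} (hst : s ≤ t) :
    (∫ x, ρ t x * f x) - ∫ x, ρ s x * f x = ∫ τ in s..t, transport j f τ := by
  have hint : ∀ a b, IntervalIntegrable (transport j f) volume a b :=
    h.intervalIntegrable_transport fun k => (hf.torusContDiff.hasPDeriv le_top k).2
  -- The pairing with the density minus the accumulated transport; the continuity equation says that
  -- it is constant in time.
  set w : ℝ → ℝ := fun t => (∫ x, ρ t x * f x) - ∫ τ in (0 : ℝ)..t, transport j f τ with hw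
  have hwc : Continuous w := by
    refine Continuous.sub ?_ (intervalIntegral.continuous_primitive hint 0)
    have h1 : Continuous fun t => MPlus.integral ⟨f, hf.continuous⟩ (z.dens t) :=
      (MPlus.uniformContinuous_integral _).continuous.comp h.continuous_dens
    refine h1.congr fun t => ?_
    exact h.integral_dens t f
  have key := eq_of_integral_integral_sub_eq_zero (w := fun t => (w t : ℂ))
    (Complex.continuous_ofReal.comp hwc) (fun s t hst => by
      rw [← z.continuity_eq s t hst f hf.torusContDiff]
      refine intervalIntegral.integral_congr fun s₁ _ => ?_
      refine intervalIntegral.integral_congr fun s₂ _ => ?_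
      simp only [h.pairing_curr hf, h.integral_dens, hw]
      rw [← intervalIntegral.integral_interval_sub_left (hint 0 s₂) (hint 0 s₁)]
      push_cast
      ring)
  rcases hst.eq_or_lt with rfl | hst
  · simp
  · have h1 := key s t hst
    have h2 : w t = w s := by exact_mod_cast h1
    rw [← intervalIntegral.integral_interval_sub_left (hint 0 t) (hint 0 s)]
    simp only [hw] at h2
    linarith

end Densities

end ContinuityEquation

/-! ### Entropy production along smoothed paths -/

section Smoothing

variable {d : ℕ} {E : Type*} [NormedAddCommGroup E] [NormedSpace ℝ E]

/-- The mixing weight. -/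
def mixRate (N : ℕ) : ℝ := 1 / ((N : ℝ) + 2)

theorem mixRate_pos (N : ℕ) : 0 < mixRate N := by unfold mixRate; positivity

theorem mixRate_lt_one (N : ℕ) : mixRate N < 1 := by
  unfold mixRate
  rw [div_lt_one (by positivity)]
  linarith [N.cast_nonneg (α := ℝ)]

theorem mixRate_mem (N : ℕ) : mixRate N ∈ Icc (0 : ℝ) 1 :=
  ⟨(mixRate_pos N).le, (mixRate_lt_one N).le⟩

theorem tendsto_mixRate : Tendsto mixRate atTop (𝓝 0) := by
  have h := (tendsto_one_div_add_atTop_nhds_zero_nat (𝕜 := ℝ)).comp (tendsto_add_atTop_nat 1)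
  refine h.congr fun N => ?_
  simp only [mixRate, Function.comp_apply]
  push_cast
  ring_nf

/-- Mollification followed by mixing with a constant. -/
def smoothing (N : ℕ) (c : E) (w : Torus d → E) (x : Torus d) : E :=
  (1 - mixRate N) • mollify N w x + mixRate N • c

theorem continuous_smoothing (N : ℕ) (c : E) {w : Torus d → E} (hw : Integrable w) :
    Continuous (smoothing N c w) :=
  ((continuous_mollify N hw).const_smul _).add continuous_const

theorem smoothing_mem (N : ℕ) {u : Torus d → ℝ} (h : ∀ x, u x ∈ Icc (0 : ℝ) 1) (x : Torus d) :
    smoothing N (1 / 2 : ℝ) u x ∈ Icc (mixRate N / 2) (1 - mixRate N / 2) := by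
  have h1 := mollify_mem_Icc N h x
  have h2 := mixRate_mem N
  simp only [smoothing, smul_eq_mul]
  constructor
  · nlinarith [mul_nonneg (sub_nonneg.2 h2.2) h1.1]
  · nlinarith [mul_le_mul_of_nonneg_left h1.2 (sub_nonneg.2 h2.2)]

theorem smoothing_mem_Ioo (N : ℕ) {u : Torus d → ℝ} (h : ∀ x, u x ∈ Icc (0 : ℝ) 1) (x : Torus d) :
    smoothing N (1 / 2 : ℝ) u x ∈ Ioo (0 : ℝ) 1 := by
  have h1 := smoothing_mem N h x
  have h2 := mixRate_pos N
  exact ⟨by linarith [h1.1], by linarith [h1.2]⟩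

theorem mobility_pos {r : ℝ} (hr : r ∈ Ioo (0 : ℝ) 1) : 0 < mobility r :=
  mul_pos hr.1 (by linarith [hr.2])

theorem mollify_coord (N : ℕ) {v : Torus d → EuclideanSpace ℝ (Fin d)} (hv : Integrable v)
    (x : Torus d) (k : Fin d) : mollify N v x k = mollify N (fun y => v y k) x :=
  ((EuclideanSpace.proj (𝕜 := ℝ) k).integral_comp_comm
    (integrable_comp_sub_smul (continuous_kernel N) hv x)).symm

/-- The velocity of the smoothed density when the current is `v`. -/
def smoothedVelocity (N : ℕ) (v : Torus d → EuclideanSpace ℝ (Fin d)) (x : Torus d) : ℝ :=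
  (1 - mixRate N) * ∑ k, ∫ y, v y k * pderiv k (fun y => kernel N (x - y)) y

theorem hasPDeriv_kernel (N : ℕ) (k : Fin d) :
    HasPDeriv k (kernel N : Torus d → ℝ) (pderiv k (kernel N)) ∧
      Continuous (pderiv k (kernel N) : Torus d → ℝ) :=
  (isTrigPoly_kernel N).torusContDiff.hasPDeriv le_top k

theorem smoothedVelocity_eq (N : ℕ) (v : Torus d → EuclideanSpace ℝ (Fin d)) (x : Torus d) :
    smoothedVelocity N v x =
      - ∑ k, (1 - mixRate N) * ∫ y, pderiv k (kernel N) (x - y) • v y k := by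
  rw [smoothedVelocity, Finset.mul_sum, ← Finset.sum_neg_distrib]
  refine Finset.sum_congr rfl fun k _ => ?_
  rw [((hasPDeriv_kernel N k).1.comp_sub_left x).pderiv_eq, ← mul_neg, ← integral_neg]
  congr 1
  refine integral_congr_ae (Eventually.of_forall fun y => ?_)
  simp only [smul_eq_mul]
  ring

theorem inner_eq_sum (v w : EuclideanSpace ℝ (Fin d)) : inner ℝ v w = ∑ k, v k * w k := by
  rw [PiLp.inner_apply]
  refine Finset.sum_congr rfl fun k _ => ?_
  simp [mul_comm]

theorem hasDerivAt_logit {r : ℝ} (hr : r ∈ Ioo (0 : ℝ) 1) :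
    HasDerivAt (fun r => Real.log r - Real.log (1 - r)) (mobility r)⁻¹ r := by
  have h0 : r ≠ 0 := hr.1.ne'
  have h1 : 1 - r ≠ 0 := by linarith [hr.2]
  have h2 := (Real.hasDerivAt_log h0).sub
    ((Real.hasDerivAt_log h1).comp r ((hasDerivAt_id r).const_sub 1))
  refine h2.congr_deriv ?_
  unfold mobility
  field_simp
  ring

/-- Integration by parts of the chemical potential against the velocity. -/
theorem integral_potential_mul_velocity (N : ℕ) {u : Torus d → ℝ}
    {g v : Torus d → EuclideanSpace ℝ (Fin d)} (hu : HasWeakGradient u g)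
    (h01 : ∀ x, u x ∈ Icc (0 : ℝ) 1) (hv : Integrable v) {U : Torus d → ℝ}
    (hU : TorusContDiff 2 U) :
    ∫ x, (Real.log (smoothing N (1 / 2 : ℝ) u x) - Real.log (1 - smoothing N (1 / 2 : ℝ) u x) + U x)
        * smoothedVelocity N v x =
      ∫ x, ((mobility (smoothing N (1 / 2 : ℝ) u x))⁻¹ *
        inner ℝ (smoothing N 0 g x) (smoothing N 0 v x) + inner ℝ (grad U x) (smoothing N 0 v x)) := by
  set R := smoothing N (1 / 2 : ℝ) u with hR
  have hRI : ∀ x, R x ∈ Ioo (0 : ℝ) 1 := smoothing_mem_Ioo N h01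
  have cR : Continuous R := continuous_smoothing N _ hu.1
  have cG : Continuous (smoothing N 0 g) := continuous_smoothing N _ hu.2.1
  have cJ : Continuous (smoothing N 0 v) := continuous_smoothing N _ hv
  have cm : Continuous (fun x => (mobility (R x))⁻¹) :=
    (continuous_mobility.comp cR).inv₀ fun x => (mobility_pos (hRI x)).ne'
  have hcoord : ∀ {w : Torus d → EuclideanSpace ℝ (Fin d)}, Continuous w → ∀ k,
      Continuous (fun x => w x k) := fun hw k => (EuclideanSpace.proj (𝕜 := ℝ) k).continuous.comp hw
  have hUk := fun k => hU.hasPDeriv (by norm_num) k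
  have hRk : ∀ k, HasPDeriv k R (fun x => smoothing N 0 g x k) := by
    intro k
    refine (((hu.hasPDeriv_mollify N k).const_mul (1 - mixRate N)).add_const
      (mixRate N * (1 / 2))).congr (fun x => by simp [hR, smoothing]) fun x => by simp [smoothing]
  -- The logit has derivative 1/σ, so the gradient of log R - log(1 - R) + U is ∇R/σ(R) + ∇U.
  have hFk : ∀ k, HasPDeriv k (fun x => Real.log (R x) - Real.log (1 - R x) + U x)
      (fun x => (mobility (R x))⁻¹ * smoothing N 0 g x k + pderiv k U x) := by
    intro k x
    exact ((hRk k).comp (h' := fun r => (mobility r)⁻¹)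
      (fun x => hasDerivAt_logit (hRI x)) x).add ((hUk k).1 x)
  have cF : Continuous (fun x => Real.log (R x) - Real.log (1 - R x) + U x) :=
    ((cR.log fun x => (hRI x).1.ne').sub ((continuous_const.sub cR).log fun x =>
      (sub_pos.2 (hRI x).2).ne')).add hU.continuous
  have hJk : ∀ k, HasPDeriv k (fun x => smoothing N 0 v x k)
      (fun x => (1 - mixRate N) * ∫ y, pderiv k (kernel N) (x - y) • v y k) := by
    intro k
    refine ((hasPDeriv_integral_comp_sub (hasPDeriv_kernel N k).1 (continuous_kernel N)
      (hasPDeriv_kernel N k).2 (Integrable.coord hv k)).const_mul (1 - mixRate N)).congr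
      (fun x => ?_) fun x => rfl
    simp only [smoothing, smul_zero, add_zero, PiLp.smul_apply, smul_eq_mul, mollify_coord N hv x k]
    rfl
  have cD : ∀ k, Continuous
      (fun x => (1 - mixRate N) * ∫ y, pderiv k (kernel N) (x - y) • v y k) := fun k =>
    continuous_const.mul (continuous_integral_comp_sub (hasPDeriv_kernel N k).2
      (Integrable.coord hv k))
  have ibp := fun k => (hFk k).integral_mul_eq (hJk k) cF
    ((cm.mul (hcoord cG k)).add (hUk k).2) (hcoord cJ k) (cD k)
  have e1 : ∀ x, (Real.log (R x) - Real.log (1 - R x) + U x) * smoothedVelocity N v x =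
      ∑ k, -((Real.log (R x) - Real.log (1 - R x) + U x) *
        ((1 - mixRate N) * ∫ y, pderiv k (kernel N) (x - y) • v y k)) := by
    intro x
    rw [smoothedVelocity_eq, mul_neg, Finset.mul_sum, Finset.sum_neg_distrib]
  have e2 : ∀ x, (mobility (R x))⁻¹ * inner ℝ (smoothing N 0 g x) (smoothing N 0 v x)
      + inner ℝ (grad U x) (smoothing N 0 v x) =
      ∑ k, ((mobility (R x))⁻¹ * smoothing N 0 g x k + pderiv k U x) * smoothing N 0 v x k := by
    intro x
    rw [inner_eq_sum, inner_eq_sum, Finset.mul_sum, ← Finset.sum_add_distrib]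
    refine Finset.sum_congr rfl fun k _ => ?_
    simp only [grad]
    ring
  have i1 : ∀ k, Integrable (fun x => -((Real.log (R x) - Real.log (1 - R x) + U x) *
      ((1 - mixRate N) * ∫ y, pderiv k (kernel N) (x - y) • v y k))) :=
    fun k => (continuous_integrable (cF.mul (cD k))).neg
  have i2 : ∀ k, Integrable (fun x => ((mobility (R x))⁻¹ * smoothing N 0 g x k + pderiv k U x)
      * smoothing N 0 v x k) :=
    fun k => continuous_integrable (((cm.mul (hcoord cG k)).add (hUk k).2).mul (hcoord cJ k))
  simp only [e1, e2]
  rw [integral_finsetSum _ fun k _ => i1 k, integral_finsetSum _ fun k _ => i2 k]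
  refine Finset.sum_congr rfl fun k _ => ?_
  rw [integral_neg, ibp k, neg_neg]

end Smoothing

/-- The chain rule along an absolutely continuous curve. -/
theorem sub_eq_integral_deriv_comp {r D φ φ' : ℝ → ℝ} {T : ℝ} {s : Set ℝ} (hT : 0 ≤ T)
    (hD : IntervalIntegrable D volume 0 T)
    (hr : ∀ t ∈ Icc 0 T, r t - r 0 = ∫ τ in (0 : ℝ)..t, D τ) (hrs : ∀ t ∈ Icc 0 T, r t ∈ s)
    (hφ : ∀ x ∈ s, HasDerivAt φ (φ' x) x) {K : ℝ≥0} (hK : LipschitzOnWith K φ s) :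
    φ (r T) - φ (r 0) = ∫ τ in (0 : ℝ)..T, φ' (r τ) * D τ := by
  have hu : uIcc 0 T = Icc 0 T := uIcc_of_le hT
  -- r is known only on [0, T]; r' is a primitive of D that agrees with it there.
  set r' : ℝ → ℝ := fun t => r 0 + ∫ τ in (0 : ℝ)..t, D τ with hr'
  have hrr : ∀ t ∈ Icc 0 T, r' t = r t := fun t ht => by
    simp only [hr', ← hr t ht]; ring
  have hac : AbsolutelyContinuousOnInterval r' 0 T :=
    (LipschitzOnWith.absolutelyContinuousOnInterval
      (K := 0) (f := fun _ => r 0) (LipschitzWith.const (r 0)).lipschitzOnWith).fun_add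
      (hD.absolutelyContinuousOnInterval_intervalIntegral (c := 0) (by simp))
  have hac2 : AbsolutelyContinuousOnInterval (fun t => φ (r' t)) 0 T := by
    rw [absolutelyContinuousOnInterval_iff] at hac ⊢
    intro ε hε
    -- Dividing by K + 1 rather than K allows K = 0 and makes the final inequality strict.
    obtain ⟨δ, hδ, h⟩ := hac (ε / (K + 1)) (by positivity)
    refine ⟨δ, hδ, fun Q hQ hQδ => ?_⟩
    have h1 := h Q hQ hQδ
    calc ∑ i ∈ Finset.range Q.1, dist (φ (r' (Q.2 i).1)) (φ (r' (Q.2 i).2))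
        ≤ ∑ i ∈ Finset.range Q.1, K * dist (r' (Q.2 i).1) (r' (Q.2 i).2) := by
          refine Finset.sum_le_sum fun i hi => hK.dist_le_mul _ ?_ _ ?_
          · have := (hQ.1 i hi).1
            rw [hu] at this
            rw [hrr _ this]; exact hrs _ this
          · have := (hQ.1 i hi).2
            rw [hu] at this
            rw [hrr _ this]; exact hrs _ this
      _ = K * ∑ i ∈ Finset.range Q.1, dist (r' (Q.2 i).1) (r' (Q.2 i).2) := by
          rw [Finset.mul_sum]
      _ ≤ K * (ε / (K + 1)) := by gcongr
      _ < (K + 1) * (ε / (K + 1)) := by gcongr; linarith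
      _ = ε := by field_simp
  have h := hac2.integral_deriv_eq_sub
  simp only [hrr T ⟨hT, le_rfl⟩, hrr 0 ⟨le_rfl, hT⟩] at h
  rw [← h]
  refine intervalIntegral.integral_congr_ae ?_
  filter_upwards [hD.ae_hasDerivAt_integral] with t ht htT
  have htI : t ∈ Icc 0 T := by rw [← hu]; exact uIoc_subset_uIcc htT
  have h1 : HasDerivAt r' (D t) t := (ht (uIoc_subset_uIcc htT) 0 (by simp)).const_add (r 0)
  have h2 : HasDerivAt φ (φ' (r t)) (r' t) := by rw [hrr t htI]; exact hφ _ (hrs t htI)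
  exact (h2.comp t h1).deriv

/-! ### Convergence of the smoothed fields -/

theorem tendstoInMeasure_of_eLpNorm_one {α F : Type*} [NormedAddCommGroup F] [MeasurableSpace α] {μ : Measure α}
    {f : ℕ → α → F} {f₀ : α → F} (hf : ∀ n, AEStronglyMeasurable (f n) μ)
    (hf₀ : AEStronglyMeasurable f₀ μ)
    (h : Tendsto (fun n => eLpNorm (f n - f₀) 1 μ) atTop (𝓝 0)) : TendstoInMeasure μ f atTop f₀ :=
  tendstoInMeasure_of_tendsto_eLpNorm one_ne_zero hf hf₀ h

section SmoothingLimit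

variable {d : ℕ} {E : Type*} [NormedAddCommGroup E] [NormedSpace ℝ E]

theorem stronglyMeasurable_integral_comp_sub {K : Torus d → ℝ} (hK : Continuous K)
    {w : ℝ → Torus d → E} (hw : StronglyMeasurable (Function.uncurry w)) :
    StronglyMeasurable (fun q : ℝ × Torus d => ∫ y, K (q.2 - y) • w q.1 y) := by
  have h : StronglyMeasurable (fun q : (ℝ × Torus d) × Torus d => K (q.1.2 - q.2) • w q.1.1 q.2) := by
    refine StronglyMeasurable.smul ?_ ?_
    · exact (hK.comp ((continuous_snd.comp continuous_fst).sub continuous_snd)).stronglyMeasurable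
    · exact hw.comp_measurable
        (g := fun q : (ℝ × Torus d) × Torus d => (q.1.1, q.2)) (by fun_prop)
  exact h.integral_prod_right'

theorem stronglyMeasurable_smoothing (N : ℕ) (c : E) {w : ℝ → Torus d → E}
    (hw : StronglyMeasurable (Function.uncurry w)) :
    StronglyMeasurable (fun q : ℝ × Torus d => smoothing N c (w q.1) q.2) :=
  ((stronglyMeasurable_integral_comp_sub (continuous_kernel N) hw).const_smul (1 - mixRate N)).add
    stronglyMeasurable_const

theorem tendsto_eLpNorm_smoothing [CompleteSpace E] (c : E) {w : Torus d → E} (hw : Integrable w) :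
    Tendsto (fun N => eLpNorm (smoothing N c w - w) 1 volume) atTop (𝓝 0) := by
  have h1 := tendsto_eLpNorm_mollify hw
  have hfin : ‖c‖ₑ + ∫⁻ x, ‖w x‖ₑ ≠ ∞ := ENNReal.add_ne_top.2 ⟨enorm_ne_top, hw.2.ne⟩
  have h2 : Tendsto (fun N => ‖mixRate N‖ₑ * (‖c‖ₑ + ∫⁻ x, ‖w x‖ₑ)) atTop (𝓝 0) := by
    have := ENNReal.Tendsto.mul_const (b := ‖c‖ₑ + ∫⁻ x, ‖w x‖ₑ) tendsto_mixRate.enorm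
      (Or.inr hfin)
    simpa using this
  have h3 := h1.add h2
  rw [add_zero] at h3
  refine tendsto_of_tendsto_of_tendsto_of_le_of_le tendsto_const_nhds h3 (fun N => zero_le)
    fun N => ?_
  have hm : AEStronglyMeasurable (mollify N w) volume := (continuous_mollify N hw).aestronglyMeasurable
  have hsplit : smoothing N c w - w = (mollify N w - w) + mixRate N • ((fun _ => c) - mollify N w) := by
    ext x
    simp only [smoothing, Pi.sub_apply, Pi.add_apply, Pi.smul_apply, sub_smul, smul_sub, one_smul]
    abel
  rw [hsplit]
  refine (eLpNorm_add_le (hm.sub hw.aestronglyMeasurable)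
    ((aestronglyMeasurable_const.sub hm).const_smul _) le_rfl).trans ?_
  refine add_le_add le_rfl ?_
  rw [eLpNorm_const_smul]
  refine mul_le_mul_right ((eLpNorm_sub_le aestronglyMeasurable_const hm le_rfl).trans
    (add_le_add ?_ ?_)) _
  · rw [eLpNorm_one_eq_lintegral_enorm]; simp
  · rw [eLpNorm_one_eq_lintegral_enorm]; exact lintegral_enorm_mollify_le N hw

theorem lintegral_enorm_smoothing_sub_le (N : ℕ) (c : E) {w : Torus d → E} (hw : Integrable w) :
    ∫⁻ x, ‖smoothing N c w x - w x‖ₑ ≤ (∫⁻ x, ‖w x‖ₑ) + ‖c‖ₑ + ∫⁻ x, ‖w x‖ₑ := by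
  have h1 : ∀ x, ‖smoothing N c w x - w x‖ₑ ≤ ‖mollify N w x‖ₑ + ‖c‖ₑ + ‖w x‖ₑ := by
    intro x
    have hδ := mixRate_mem N
    have e1 : ∀ (a : ℝ) (v : E), a ∈ Icc (0 : ℝ) 1 → ‖a • v‖ₑ ≤ ‖v‖ₑ := by
      intro a v ha
      rw [enorm_smul, Real.enorm_of_nonneg ha.1]
      exact mul_le_of_le_one_left' (ENNReal.ofReal_le_one.2 ha.2)
    refine enorm_sub_le.trans (add_le_add ((enorm_add_le _ _).trans (add_le_add ?_ ?_)) le_rfl)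
    · exact e1 _ _ ⟨by linarith [hδ.2], by linarith [hδ.1]⟩
    · exact e1 _ _ hδ
  refine (lintegral_mono h1).trans ?_
  rw [lintegral_add_right' _ hw.aestronglyMeasurable.enorm, lintegral_add_right _ measurable_const]
  simp only [lintegral_const, measure_univ, mul_one]
  exact add_le_add (add_le_add (lintegral_enorm_mollify_le N hw) le_rfl) le_rfl

/-- Almost every time slice converges in L¹, and the slice errors are dominated by 2‖w τ‖₁ + ‖c‖,
which is integrable in time. -/
theorem tendsto_eLpNorm_smoothing_prod [CompleteSpace E] (c : E) {w : ℝ → Torus d → E}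
    (hw : StronglyMeasurable (Function.uncurry w)) {ν : Measure ℝ} [IsFiniteMeasure ν]
    (hi : Integrable (Function.uncurry w) (ν.prod volume)) :
    Tendsto (fun N => eLpNorm
      ((fun q : ℝ × Torus d => smoothing N c (w q.1) q.2) - Function.uncurry w) 1
      (ν.prod volume)) atTop (𝓝 0) := by
  have hm : ∀ N, StronglyMeasurable
      ((fun q : ℝ × Torus d => smoothing N c (w q.1) q.2) - Function.uncurry w) :=
    fun N => (stronglyMeasurable_smoothing N c hw).sub hw
  simp only [eLpNorm_one_eq_lintegral_enorm]
  have e : ∀ N, ∫⁻ q, ‖((fun q : ℝ × Torus d => smoothing N c (w q.1) q.2) - Function.uncurry w) q‖ₑ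
      ∂(ν.prod volume) = ∫⁻ τ, (∫⁻ x, ‖smoothing N c (w τ) x - w τ x‖ₑ) ∂ν := by
    intro N
    rw [lintegral_prod _ (hm N).enorm.aemeasurable]
    rfl
  simp only [e]
  have hae : ∀ᵐ τ ∂ν, Integrable (w τ) := hi.prod_right_ae
  have h0 : Tendsto (fun N => ∫⁻ τ, (∫⁻ x, ‖smoothing N c (w τ) x - w τ x‖ₑ) ∂ν) atTop
      (𝓝 (∫⁻ _, 0 ∂ν)) := by
    refine tendsto_lintegral_of_dominated_convergence'
      (fun τ => (∫⁻ x, ‖w τ x‖ₑ) + ‖c‖ₑ + ∫⁻ x, ‖w τ x‖ₑ) (fun N => ?_) (fun N => ?_) ?_ ?_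
    · exact (Measurable.lintegral_prod_right' (hm N).enorm).aemeasurable
    · filter_upwards [hae] with τ hτ using lintegral_enorm_smoothing_sub_le N c hτ
    · have hmw : Measurable fun τ => ∫⁻ x, ‖w τ x‖ₑ := Measurable.lintegral_prod_right' hw.enorm
      have hfin : ∫⁻ τ, (∫⁻ x, ‖w τ x‖ₑ) ∂ν ≠ ∞ := by
        have := hi.2.ne
        rwa [lintegral_prod _ hw.enorm.aemeasurable] at this
      rw [lintegral_add_right _ hmw, lintegral_add_right _ measurable_const]
      refine ENNReal.add_ne_top.2 ⟨ENNReal.add_ne_top.2 ⟨hfin, ?_⟩, hfin⟩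
      rw [lintegral_const]
      exact ENNReal.mul_ne_top enorm_ne_top (measure_ne_top _ _)
    · filter_upwards [hae] with τ hτ
      have := tendsto_eLpNorm_smoothing c hτ
      simpa only [eLpNorm_one_eq_lintegral_enorm, Pi.sub_apply] using this
  rwa [lintegral_zero] at h0

/-- The free energy of a profile with values in `[0, 1]`. -/
def freeEnergy (U : Torus d → ℝ) (u : Torus d → ℝ) : ℝ :=
  ∫ x, (U x * u x - Real.binEntropy (u x))

theorem binEntropy_mem {r : ℝ} (hr : r ∈ Icc (0 : ℝ) 1) : Real.binEntropy r ∈ Icc (0 : ℝ) 1 := by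
  refine ⟨Real.binEntropy_nonneg hr.1 hr.2, Real.binEntropy_le_log_two.trans ?_⟩
  have := Real.log_two_lt_d9
  linarith

theorem abs_freeEnergy_integrand_le {U : Torus d → ℝ} {C : ℝ} (hC : ∀ x, ‖U x‖ ≤ C) {r : ℝ}
    (hr : r ∈ Icc (0 : ℝ) 1) (x : Torus d) : ‖U x * r - Real.binEntropy r‖ ≤ C + 1 := by
  have h1 := binEntropy_mem hr
  have h2 : ‖U x * r‖ ≤ C := by
    rw [norm_mul, Real.norm_of_nonneg hr.1]
    exact (mul_le_of_le_one_right (norm_nonneg _) hr.2).trans (hC x)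
  refine (norm_sub_le _ _).trans (add_le_add h2 ?_)
  rw [Real.norm_of_nonneg h1.1]
  exact h1.2

theorem abs_freeEnergy_le {U : Torus d → ℝ} {C : ℝ} (hC : ∀ x, ‖U x‖ ≤ C) {u : Torus d → ℝ}
    (hu : ∀ᵐ x, u x ∈ Icc (0 : ℝ) 1) : |freeEnergy U u| ≤ C + 1 := by
  have := norm_integral_le_of_norm_le_const (μ := (volume : Measure (Torus d)))
    (hu.mono fun x hx => abs_freeEnergy_integrand_le hC hx x)
  simpa [freeEnergy] using this

/-- Every subsequence has a further one that converges almost everywhere; the entropy is continuous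
and bounded on [0, 1], so dominated convergence applies. -/
theorem tendsto_freeEnergy {U : Torus d → ℝ} (hU : Continuous U) {u : ℕ → Torus d → ℝ}
    {u₀ : Torus d → ℝ} (hu : ∀ n, AEMeasurable (u n)) (h01 : ∀ n, ∀ᵐ x, u n x ∈ Icc (0 : ℝ) 1)
    (h : TendstoInMeasure volume u atTop u₀) :
    Tendsto (fun n => freeEnergy U (u n)) atTop (𝓝 (freeEnergy U u₀)) := by
  obtain ⟨C, -, hC⟩ := exists_bound_of_continuous hU
  refine tendsto_of_subseq_tendsto fun ns hns => ?_
  have h' : TendstoInMeasure volume (fun i => u (ns i)) atTop u₀ :=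
    fun ε hε => (h ε hε).comp hns
  obtain ⟨ms, hms, hae⟩ := h'.exists_seq_tendsto_ae
  refine ⟨ms, ?_⟩
  refine tendsto_integral_of_dominated_convergence (fun _ => C + 1) (fun n => ?_)
    (integrable_const _) (fun n => ?_) ?_
  · have : AEMeasurable (fun x => U x * u (ns (ms n)) x - Real.binEntropy (u (ns (ms n)) x)) :=
      (hU.measurable.aemeasurable.mul (hu _)).sub
        (Real.binEntropy_continuous.measurable.comp_aemeasurable (hu _))
    exact this.aestronglyMeasurable
  · filter_upwards [h01 (ns (ms n))] with x hx using abs_freeEnergy_integrand_le hC hx x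
  · filter_upwards [hae] with x hx
    exact (hx.const_mul _).sub ((Real.binEntropy_continuous.tendsto _).comp hx)

end SmoothingLimit

/-! ### The entropy balance along a path -/

section EntropyBalance

variable {d : ℕ}

/-- Neither operation raises the energy: mollification by Jensen's inequality, mixing by
`sqQuot_mix_le`. -/
theorem lintegral_sqQuot_smoothing_le (N : ℕ) {u : Torus d → ℝ}
    {v : Torus d → EuclideanSpace ℝ (Fin d)} (hu : Integrable u) (h01 : ∀ x, u x ∈ Icc (0 : ℝ) 1)
    (hv : Integrable v) :
    ∫⁻ x, sqQuot (smoothing N 0 v x) (4 * mobility (smoothing N (1 / 2 : ℝ) u x)) ≤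
      ∫⁻ x, sqQuot (v x) (4 * mobility (u x)) := by
  have hm : AEMeasurable fun x => sqQuot (v x) (4 * mobility (u x)) :=
    hv.aemeasurable.sqQuot ((measurable_mobility.comp_aemeasurable hu.aemeasurable).const_mul 4)
  rw [← lintegral_mollify N hm]
  refine lintegral_mono fun x => ?_
  refine le_trans ?_ (sqQuot_mollify_le N hu hv h01 x)
  have h := sqQuot_mix_le (mollify N v x) (mollify_mem_Icc N h01 x) (mixRate_mem N)
  simpa only [smoothing, smul_zero, add_zero, smul_eq_mul, mul_one_div] using h

theorem smoothing_add (N : ℕ) {v w : Torus d → EuclideanSpace ℝ (Fin d)} (hv : Integrable v)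
    (hw : Integrable w) (x : Torus d) :
    smoothing N 0 (fun y => v y + w y) x = smoothing N 0 v x + smoothing N 0 w x := by
  have : mollify N (fun y => v y + w y) x = mollify N v x + mollify N w x := by
    simp only [mollify, smul_add]
    exact integral_add (integrable_comp_sub_smul (continuous_kernel N) hv x)
      (integrable_comp_sub_smul (continuous_kernel N) hw x)
  simp only [smoothing, this, smul_add, smul_zero, add_zero]

section Product

variable {ν : Measure ℝ} [IsFiniteMeasure ν]

theorem lintegral_sqQuot_smoothing_prod_le (N : ℕ) {ρ : ℝ → Torus d → ℝ}
    {w : ℝ → Torus d → EuclideanSpace ℝ (Fin d)} (hρ : Measurable (Function.uncurry ρ))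
    (h01 : ∀ t x, ρ t x ∈ Icc (0 : ℝ) 1) (hw : Measurable (Function.uncurry w))
    (hi : Integrable (Function.uncurry w) (ν.prod volume)) :
    ∫⁻ q, sqQuot (smoothing N 0 (w q.1) q.2)
        (4 * mobility (smoothing N (1 / 2 : ℝ) (ρ q.1) q.2)) ∂(ν.prod volume) ≤
      ∫⁻ q, sqQuot (w q.1 q.2) (4 * mobility (ρ q.1 q.2)) ∂(ν.prod volume) := by
  have m1 := (stronglyMeasurable_smoothing N (0 : EuclideanSpace ℝ (Fin d))
    hw.stronglyMeasurable).measurable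
  have m2 := (stronglyMeasurable_smoothing N (1 / 2 : ℝ) hρ.stronglyMeasurable).measurable
  have m3 : Measurable fun q : ℝ × Torus d => w q.1 q.2 := hw
  have m4 : Measurable fun q : ℝ × Torus d => ρ q.1 q.2 := hρ
  rw [lintegral_prod _ (by fun_prop), lintegral_prod _ (by fun_prop)]
  refine lintegral_mono_ae ?_
  filter_upwards [hi.prod_right_ae] with τ hτ
  refine lintegral_sqQuot_smoothing_le N ?_ (h01 τ) hτ
  exact Integrable.of_bound hρ.of_uncurry_left.aestronglyMeasurable 1
    (Eventually.of_forall fun x => by rw [Real.norm_of_nonneg (h01 τ x).1]; exact (h01 τ x).2)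

variable {E : Type*} [NormedAddCommGroup E] [NormedSpace ℝ E]

theorem integrable_integral_comp_sub {K : Torus d → ℝ} (hK : Continuous K) {w : ℝ → Torus d → E}
    (hw : StronglyMeasurable (Function.uncurry w))
    (hi : Integrable (Function.uncurry w) (ν.prod volume)) :
    Integrable (fun q : ℝ × Torus d => ∫ y, K (q.2 - y) • w q.1 y) (ν.prod volume) := by
  obtain ⟨C, hC0, hC⟩ := exists_bound_of_continuous hK
  have h1 : Integrable (fun q : ℝ × Torus d => C * ∫ y, ‖w q.1 y‖) (ν.prod volume) :=
    ((hi.norm.integral_prod_left).comp_fst volume).const_mul C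
  refine h1.mono' (stronglyMeasurable_integral_comp_sub hK hw).aestronglyMeasurable ?_
  have h2 : ∀ᵐ q : ℝ × Torus d ∂(ν.prod volume), Integrable (w q.1) :=
    Measure.quasiMeasurePreserving_fst.ae hi.prod_right_ae
  filter_upwards [h2] with q hq
  rw [← integral_const_mul]
  refine norm_integral_le_of_norm_le (hq.norm.const_mul C) (Eventually.of_forall fun y => ?_)
  rw [norm_smul]
  exact mul_le_mul_of_nonneg_right (hC _) (norm_nonneg _)

theorem integrable_smoothing (N : ℕ) (c : E) {w : ℝ → Torus d → E}
    (hw : StronglyMeasurable (Function.uncurry w))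
    (hi : Integrable (Function.uncurry w) (ν.prod volume)) :
    Integrable (fun q : ℝ × Torus d => smoothing N c (w q.1) q.2) (ν.prod volume) :=
  ((integrable_integral_comp_sub (continuous_kernel N) hw hi).smul (1 - mixRate N)).add
    (integrable_const _)

end Product

/-- A vector field of finite energy is square integrable. -/
theorem memLp_of_lintegral_sqQuot {α : Type*} [MeasurableSpace α] {μ : Measure α} {r : α → ℝ}
    {v : α → EuclideanSpace ℝ (Fin d)} (hv : AEMeasurable v μ) (h01 : ∀ᵐ x ∂μ, r x ∈ Icc (0 : ℝ) 1)
    (hE : ∫⁻ x, sqQuot (v x) (4 * mobility (r x)) ∂μ ≠ ∞) : MemLp v 2 μ := by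
  refine ⟨hv.aestronglyMeasurable, ?_⟩
  rw [eLpNorm_lt_top_iff_lintegral_rpow_enorm_lt_top (by simp) (by simp)]
  refine lt_of_le_of_lt (lintegral_mono_ae ?_) hE.lt_top
  filter_upwards [h01] with x hx
  refine le_trans (le_of_eq ?_) (ofReal_sq_norm_le_sqQuot (v x)
    (mul_nonneg zero_le_four (mobility_nonneg hx)) (by linarith [mobility_le (r x)]))
  rw [ENNReal.toReal_ofNat, ENNReal.rpow_ofNat, ENNReal.ofReal_pow (norm_nonneg _), ofReal_norm]

/-- Expansion of the square when a drift `σ F` is added. -/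
theorem lintegral_sqQuot_add {α : Type*} [MeasurableSpace α] {μ : Measure α} [IsFiniteMeasure μ]
    {r : α → ℝ} {v F : α → EuclideanSpace ℝ (Fin d)} (hr : AEMeasurable r μ)
    (hv : AEMeasurable v μ) (hF : AEMeasurable F μ) {C : ℝ} (hC : ∀ x, ‖F x‖ ≤ C)
    (h01 : ∀ᵐ x ∂μ, r x ∈ Icc (0 : ℝ) 1)
    (hE : ∫⁻ x, sqQuot (v x) (4 * mobility (r x)) ∂μ ≠ ∞) :
    0 ≤ (∫⁻ x, sqQuot (v x) (4 * mobility (r x)) ∂μ).toReal + (∫ x, inner ℝ (v x) (F x) ∂μ) / 2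
        + (∫ x, mobility (r x) * ‖F x‖ ^ 2 ∂μ) / 4 ∧
    ∫⁻ x, sqQuot (v x + mobility (r x) • F x) (4 * mobility (r x)) ∂μ =
      ENNReal.ofReal ((∫⁻ x, sqQuot (v x) (4 * mobility (r x)) ∂μ).toReal
        + (∫ x, inner ℝ (v x) (F x) ∂μ) / 2 + (∫ x, mobility (r x) * ‖F x‖ ^ 2 ∂μ) / 4) := by
  have hmob : AEMeasurable (fun x => mobility (r x)) μ := measurable_mobility.comp_aemeasurable hr
  have hvi : Integrable v μ := (memLp_of_lintegral_sqQuot hv h01 hE).integrable one_le_two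
  have hae := ae_lt_top' (hv.sqQuot (hmob.const_mul 4)) hE
  have i1 : Integrable (fun x => ‖v x‖ ^ 2 / (4 * mobility (r x))) μ := by
    refine ⟨((hv.norm.pow_const 2).div (hmob.const_mul 4)).aestronglyMeasurable, ?_⟩
    refine lt_of_le_of_lt (lintegral_mono_ae ?_) hE.lt_top
    filter_upwards [hae, h01] with x hx h1
    have hb := mul_nonneg zero_le_four (mobility_nonneg h1)
    rw [(sqQuot_eq_of_ne_top hb hx.ne).1, Real.enorm_of_nonneg (by positivity)]
  have e1 : (∫⁻ x, sqQuot (v x) (4 * mobility (r x)) ∂μ).toReal =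
      ∫ x, ‖v x‖ ^ 2 / (4 * mobility (r x)) ∂μ := by
    rw [integral_eq_lintegral_of_nonneg_ae _ i1.aestronglyMeasurable]
    · congr 1
      refine lintegral_congr_ae ?_
      filter_upwards [hae, h01] with x hx h1
      exact (sqQuot_eq_of_ne_top (mul_nonneg zero_le_four (mobility_nonneg h1)) hx.ne).1
    · filter_upwards [h01] with x h1
      have hb := mul_nonneg zero_le_four (mobility_nonneg h1)
      simp only [Pi.zero_apply]
      positivity
  have i2 : Integrable (fun x => inner ℝ (v x) (F x)) μ := by
    refine (hvi.norm.mul_const C).mono' (hv.inner hF).aestronglyMeasurable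
      (Eventually.of_forall fun x => ?_)
    exact (norm_inner_le_norm _ _).trans (mul_le_mul_of_nonneg_left (hC x) (norm_nonneg _))
  have i3 : Integrable (fun x => mobility (r x) * ‖F x‖ ^ 2) μ := by
    refine Integrable.of_bound ((hmob.mul (hF.norm.pow_const 2)).aestronglyMeasurable)
      (1 / 4 * C ^ 2) ?_
    filter_upwards [h01] with x h1
    have h2 := mobility_nonneg h1
    rw [Real.norm_of_nonneg (by positivity)]
    exact mul_le_mul (mobility_le _) (pow_le_pow_left₀ (norm_nonneg _) (hC x) 2) (by positivity)
      (by norm_num)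
  set Q : α → ℝ := fun x => ‖v x‖ ^ 2 / (4 * mobility (r x)) + inner ℝ (v x) (F x) / 2
    + mobility (r x) * ‖F x‖ ^ 2 / 4 with hQ
  have i4 : Integrable (fun x => ‖v x‖ ^ 2 / (4 * mobility (r x)) + inner ℝ (v x) (F x) / 2) μ :=
    i1.add (i2.div_const 2)
  have iQ : Integrable Q μ := i4.add (i3.div_const 4)
  have eQ : ∫ x, Q x ∂μ = (∫⁻ x, sqQuot (v x) (4 * mobility (r x)) ∂μ).toReal
      + (∫ x, inner ℝ (v x) (F x) ∂μ) / 2 + (∫ x, mobility (r x) * ‖F x‖ ^ 2 ∂μ) / 4 := by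
    rw [e1, hQ, integral_add i4 (i3.div_const 4), integral_add i1 (i2.div_const 2),
      integral_div, integral_div]
  have hpt : ∀ᵐ x ∂μ, 0 ≤ Q x ∧
      sqQuot (v x + mobility (r x) • F x) (4 * mobility (r x)) = ENNReal.ofReal (Q x) := by
    filter_upwards [hae, h01] with x hx h1
    have hb := mul_nonneg zero_le_four (mobility_nonneg h1)
    rcases (mobility_nonneg h1).eq_or_lt with h0 | h0
    -- Where σ vanishes, finite energy forces v = 0, and both sides are zero.
    · have hv0 := (sqQuot_eq_of_ne_top hb hx.ne).2 (by rw [← h0, mul_zero])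
      simp [hQ, ← h0, hv0, sqQuot_zero_left]
    · have e : Q x = ‖v x + mobility (r x) • F x‖ ^ 2 / (4 * mobility (r x)) := by
        rw [norm_add_sq_real, inner_smul_right, norm_smul, Real.norm_of_nonneg h0.le]
        simp only [hQ]
        field_simp
        ring
      rw [sqQuot_of_pos _ (by positivity), e]
      exact ⟨by positivity, rfl⟩
  rw [← eQ]
  refine ⟨integral_nonneg_of_ae (hpt.mono fun x hx => hx.1), ?_⟩
  rw [ofReal_integral_eq_lintegral_ofReal iQ (hpt.mono fun x hx => hx.1)]
  exact lintegral_congr_ae (hpt.mono fun x hx => hx.2)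

end EntropyBalance

/-! ### The entropy balance of the smoothed density -/

section Balance

variable {d : ℕ} {p m : ℝ} {z : PathSpace d p} {ρ : ℝ → Torus d → ℝ}
  {g j : ℝ → Torus d → EuclideanSpace ℝ (Fin d)}

/-- This is the continuity equation tested with y ↦ kernel N (x - y); the constant mixed in cancels
in the difference. -/
theorem HasDensities.smoothing_sub (h : HasDensities m z ρ g j) (N : ℕ) (x : Torus d) {t : ℝ}
    (ht : 0 ≤ t) :
    smoothing N (1 / 2 : ℝ) (ρ t) x - smoothing N (1 / 2 : ℝ) (ρ 0) x =
      ∫ τ in (0 : ℝ)..t, smoothedVelocity N (j τ) x := by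
  have h1 := h.integral_density_sub ((isTrigPoly_kernel (d := d) N).comp_sub_left x) ht
  have h2 : ∫ τ in (0 : ℝ)..t, smoothedVelocity N (j τ) x =
      (1 - mixRate N) * ∫ τ in (0 : ℝ)..t, transport j (fun y => kernel N (x - y)) τ := by
    rw [← intervalIntegral.integral_const_mul]
    rfl
  rw [h2, ← h1]
  simp only [smoothing, mollify, smul_eq_mul, mul_comm (ρ _ _)]
  ring

theorem HasDensities.intervalIntegrable_smoothedVelocity (h : HasDensities m z ρ g j) (N : ℕ)
    (x : Torus d) (a b : ℝ) :
    IntervalIntegrable (fun τ => smoothedVelocity N (j τ) x) volume a b :=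
  (h.intervalIntegrable_transport (fun k => (((isTrigPoly_kernel (d := d) N).comp_sub_left
    x).torusContDiff.hasPDeriv le_top k).2) a b).const_mul _

/-- The derivative of the free energy density along a path with values in a compact subset of
`(0, 1)`. -/
theorem exists_lipschitzOnWith_freeEnergy (u : ℝ) {δ : ℝ} (hδ : 0 < δ) :
    ∃ K : ℝ≥0, LipschitzOnWith K (fun r => u * r - Real.binEntropy r) (Icc δ (1 - δ)) := by
  have hd : ∀ r ∈ Icc δ (1 - δ), HasDerivAt (fun r => u * r - Real.binEntropy r)
      (Real.log r - Real.log (1 - r) + u) r := by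
    intro r hr
    have h0 : r ≠ 0 := by linarith [hr.1]
    have h1 : r ≠ 1 := by linarith [hr.2]
    refine (((hasDerivAt_id r).const_mul u).sub (Real.hasDerivAt_binEntropy h0 h1)).congr_deriv ?_
    ring
  have hc : ContinuousOn (fun r => Real.log r - Real.log (1 - r) + u) (Icc δ (1 - δ)) := by
    refine ContinuousOn.add (ContinuousOn.sub ?_ ?_) continuousOn_const
    · exact Real.continuousOn_log.mono fun r hr => by
        simp only [mem_compl_iff, mem_singleton_iff]; linarith [hr.1]
    · exact Real.continuousOn_log.comp (by fun_prop) fun r hr => by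
        simp only [mem_compl_iff, mem_singleton_iff]; linarith [hr.2]
  obtain ⟨K, hK⟩ := isCompact_Icc.exists_bound_of_continuousOn hc
  refine ⟨K.toNNReal, (convex_Icc _ _).lipschitzOnWith_of_nnnorm_hasDerivWithin_le
    (fun r hr => (hd r hr).hasDerivWithinAt) fun r hr => ?_⟩
  rw [← NNReal.coe_le_coe, coe_nnnorm]
  exact (hK r hr).trans (Real.le_coe_toNNReal K)

/-- At a fixed x the smoothed density is absolutely continuous in time with values in a compact part
of (0, 1), where the entropy is Lipschitz, so the chain rule applies. -/
theorem HasDensities.freeEnergy_integrand_sub (h : HasDensities m z ρ g j) (N : ℕ) (x : Torus d)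
    {T : ℝ} (hT : 0 ≤ T) (u : ℝ) :
    (u * smoothing N (1 / 2 : ℝ) (ρ T) x - Real.binEntropy (smoothing N (1 / 2 : ℝ) (ρ T) x)) -
        (u * smoothing N (1 / 2 : ℝ) (ρ 0) x - Real.binEntropy (smoothing N (1 / 2 : ℝ) (ρ 0) x)) =
      ∫ τ in (0 : ℝ)..T, (Real.log (smoothing N (1 / 2 : ℝ) (ρ τ) x)
        - Real.log (1 - smoothing N (1 / 2 : ℝ) (ρ τ) x) + u) * smoothedVelocity N (j τ) x := by
  obtain ⟨K, hK⟩ := exists_lipschitzOnWith_freeEnergy u (half_pos (mixRate_pos N))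
  refine sub_eq_integral_deriv_comp (r := fun t => smoothing N (1 / 2 : ℝ) (ρ t) x)
    (φ := fun r => u * r - Real.binEntropy r)
    (φ' := fun r => Real.log r - Real.log (1 - r) + u) hT
    (h.intervalIntegrable_smoothedVelocity N x 0 T) (fun t ht => h.smoothing_sub N x ht.1)
    (fun t _ => smoothing_mem N (h.density_mem t) x) (fun r hr => ?_) hK
  have hδ := mixRate_pos N
  have h0 : r ≠ 0 := by linarith [hr.1]
  have h1 : r ≠ 1 := by linarith [hr.2]
  refine (((hasDerivAt_id r).const_mul u).sub (Real.hasDerivAt_binEntropy h0 h1)).congr_deriv ?_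
  ring

theorem HasDensities.stronglyMeasurable_smoothing_density (h : HasDensities m z ρ g j) (N : ℕ) :
    StronglyMeasurable (fun q : ℝ × Torus d => smoothing N (1 / 2 : ℝ) (ρ q.1) q.2) :=
  stronglyMeasurable_smoothing N _ h.measurable_density.stronglyMeasurable

theorem HasDensities.integrable_smoothedVelocity (h : HasDensities m z ρ g j) (N : ℕ) (a b : ℝ) :
    Integrable (fun q : ℝ × Torus d => smoothedVelocity N (j q.1) q.2)
      ((volume.restrict (uIcc a b)).prod volume) := by
  simp only [smoothedVelocity_eq]
  refine (integrable_finsetSum _ fun k _ => Integrable.const_mul ?_ _).neg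
  exact integrable_integral_comp_sub (hasPDeriv_kernel N k).2 (w := fun τ y => j τ y k)
    ((EuclideanSpace.proj (𝕜 := ℝ) k).continuous.measurable.comp
      h.measurable_current).stronglyMeasurable (Integrable.coord (h.integrable_current a b) k)

/-- A uniform bound for continuous functions of the smoothed density. -/
theorem exists_bound_comp_smoothing {φ : ℝ → ℝ} (hφ : ContinuousOn φ (Ioo 0 1)) (N : ℕ) :
    ∃ C, ∀ u : Torus d → ℝ, (∀ x, u x ∈ Icc (0 : ℝ) 1) →
      ∀ x, ‖φ (smoothing N (1 / 2 : ℝ) u x)‖ ≤ C := by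
  have hδ := mixRate_pos N
  obtain ⟨K, hK⟩ := (isCompact_Icc (a := mixRate N / 2)
    (b := 1 - mixRate N / 2)).exists_bound_of_continuousOn
    (hφ.mono fun r hr => ⟨by linarith [hr.1], by linarith [hr.2]⟩)
  exact ⟨K, fun u hu x => hK _ (smoothing_mem N hu x)⟩

theorem continuousOn_logit : ContinuousOn (fun r => Real.log r - Real.log (1 - r)) (Ioo 0 1) :=
  fun _ hr => (hasDerivAt_logit hr).continuousAt.continuousWithinAt

theorem continuousOn_inv_mobility : ContinuousOn (fun r => (mobility r)⁻¹) (Ioo 0 1) :=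
  continuous_mobility.continuousOn.inv₀ fun _ hr => (mobility_pos hr).ne'

theorem freeEnergy_integrable {U : Torus d → ℝ} (hU : Continuous U) {u : Torus d → ℝ}
    (hu : AEMeasurable u) (h01 : ∀ᵐ x, u x ∈ Icc (0 : ℝ) 1) :
    Integrable fun x => U x * u x - Real.binEntropy (u x) := by
  obtain ⟨C, -, hC⟩ := exists_bound_of_continuous hU
  refine Integrable.of_bound (AEMeasurable.aestronglyMeasurable ?_) (C + 1)
    (h01.mono fun x hx => abs_freeEnergy_integrand_le hC hx x)
  exact (hU.measurable.aemeasurable.mul hu).sub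
    (Real.binEntropy_continuous.measurable.comp_aemeasurable hu)

theorem integrable_inner_of_memLp {α : Type*} [MeasurableSpace α] {μ : Measure α}
    {v w : α → EuclideanSpace ℝ (Fin d)} (hv : MemLp v 2 μ) (hw : MemLp w 2 μ) :
    Integrable (fun x => inner ℝ (v x) (w x)) μ :=
  (hv.norm.integrable_mul hw.norm).mono' (hv.1.inner hw.1)
    (Eventually.of_forall fun _ => norm_inner_le_norm _ _)

/-- The total dissipation rate along the smoothed path. -/
theorem HasDensities.freeEnergy_smoothing_sub (h : HasDensities m z ρ g j) (N : ℕ) {T : ℝ}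
    (hT : 0 ≤ T) {U : Torus d → ℝ} (hU : TorusContDiff 2 U)
    (hG : MemLp (fun q : ℝ × Torus d => smoothing N 0 (g q.1) q.2) 2
      ((volume.restrict (Icc 0 T)).prod volume))
    (hJ : MemLp (fun q : ℝ × Torus d => smoothing N 0 (j q.1) q.2) 2
      ((volume.restrict (Icc 0 T)).prod volume)) :
    Integrable (fun q : ℝ × Torus d => (mobility (smoothing N (1 / 2 : ℝ) (ρ q.1) q.2))⁻¹ *
        inner ℝ (smoothing N 0 (g q.1) q.2) (smoothing N 0 (j q.1) q.2))
        ((volume.restrict (Icc 0 T)).prod volume) ∧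
    Integrable (fun q : ℝ × Torus d => inner ℝ (grad U q.2) (smoothing N 0 (j q.1) q.2))
        ((volume.restrict (Icc 0 T)).prod volume) ∧
    freeEnergy U (smoothing N (1 / 2 : ℝ) (ρ T)) - freeEnergy U (smoothing N (1 / 2 : ℝ) (ρ 0)) =
      ∫ q, ((mobility (smoothing N (1 / 2 : ℝ) (ρ q.1) q.2))⁻¹ *
        inner ℝ (smoothing N 0 (g q.1) q.2) (smoothing N 0 (j q.1) q.2)
        + inner ℝ (grad U q.2) (smoothing N 0 (j q.1) q.2))
        ∂((volume.restrict (Icc 0 T)).prod volume) := by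
  set μ := (volume.restrict (Icc 0 T)).prod (volume : Measure (Torus d)) with hμ
  have huI : uIcc 0 T = Icc 0 T := uIcc_of_le hT
  have mR := (h.stronglyMeasurable_smoothing_density N).measurable
  have cU : Continuous U := hU.continuous
  have cgrad : Continuous (grad U) := continuous_grad hU (by norm_num)
  obtain ⟨CU, -, hCU⟩ := exists_bound_of_continuous cU
  obtain ⟨Cg, -, hCg⟩ := exists_bound_of_continuous cgrad
  obtain ⟨Cl, hCl⟩ := exists_bound_comp_smoothing (d := d) continuousOn_logit N
  obtain ⟨Cm, hCm⟩ := exists_bound_comp_smoothing (d := d) continuousOn_inv_mobility N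
  have i1 : Integrable (fun q : ℝ × Torus d =>
      (mobility (smoothing N (1 / 2 : ℝ) (ρ q.1) q.2))⁻¹ *
        inner ℝ (smoothing N 0 (g q.1) q.2) (smoothing N 0 (j q.1) q.2)) μ :=
    (integrable_inner_of_memLp hG hJ).bdd_mul
      ((measurable_mobility.comp mR).inv.aestronglyMeasurable)
      (Eventually.of_forall fun q => hCm _ (h.density_mem q.1) q.2)
  have i2 : Integrable (fun q : ℝ × Torus d =>
      inner ℝ (grad U q.2) (smoothing N 0 (j q.1) q.2)) μ := by
    refine ((hJ.integrable one_le_two).norm.const_mul Cg).mono'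
      ((cgrad.comp continuous_snd).aestronglyMeasurable.inner hJ.1)
      (Eventually.of_forall fun q => ?_)
    exact (norm_inner_le_norm _ _).trans (mul_le_mul_of_nonneg_right (hCg _) (norm_nonneg _))
  refine ⟨i1, i2, ?_⟩
  have iV : Integrable (fun q : ℝ × Torus d => smoothedVelocity N (j q.1) q.2) μ := by
    rw [hμ, ← huI]; exact h.integrable_smoothedVelocity N 0 T
  have iF : Integrable (fun q : ℝ × Torus d => (Real.log (smoothing N (1 / 2 : ℝ) (ρ q.1) q.2)
        - Real.log (1 - smoothing N (1 / 2 : ℝ) (ρ q.1) q.2) + U q.2)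
        * smoothedVelocity N (j q.1) q.2) μ := by
    refine iV.bdd_mul (c := Cl + CU) ?_ (Eventually.of_forall fun q => ?_)
    · exact (((Real.measurable_log.comp mR).sub (Real.measurable_log.comp
        (measurable_const.sub mR))).add (cU.measurable.comp measurable_snd)).aestronglyMeasurable
    · exact (norm_add_le _ _).trans (add_le_add (hCl _ (h.density_mem q.1) q.2) (hCU _))
  have e1 : freeEnergy U (smoothing N (1 / 2 : ℝ) (ρ T))
      - freeEnergy U (smoothing N (1 / 2 : ℝ) (ρ 0)) =
      ∫ x, ∫ τ in Icc 0 T, (Real.log (smoothing N (1 / 2 : ℝ) (ρ τ) x)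
        - Real.log (1 - smoothing N (1 / 2 : ℝ) (ρ τ) x) + U x) * smoothedVelocity N (j τ) x := by
    have hI : ∀ t, Integrable fun x => U x * smoothing N (1 / 2 : ℝ) (ρ t) x
        - Real.binEntropy (smoothing N (1 / 2 : ℝ) (ρ t) x) := fun t =>
      freeEnergy_integrable cU
        (continuous_smoothing N _ (h.integrable_density t)).measurable.aemeasurable
        (Eventually.of_forall fun x => Ioo_subset_Icc_self
          (smoothing_mem_Ioo N (h.density_mem t) x))
    unfold freeEnergy
    rw [← integral_sub (hI T) (hI 0)]
    refine integral_congr_ae (Eventually.of_forall fun x => ?_)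
    simp only
    rw [h.freeEnergy_integrand_sub N x hT (U x), intervalIntegral.integral_of_le hT,
      integral_Icc_eq_integral_Ioc]
  have i12 : Integrable (fun q : ℝ × Torus d =>
      (mobility (smoothing N (1 / 2 : ℝ) (ρ q.1) q.2))⁻¹ *
        inner ℝ (smoothing N 0 (g q.1) q.2) (smoothing N 0 (j q.1) q.2)
        + inner ℝ (grad U q.2) (smoothing N 0 (j q.1) q.2)) μ := i1.add i2
  -- The chain rule was used in time at fixed x. After exchanging the integrals, the integration by
  -- parts is done in space at fixed time.
  rw [e1, ← integral_prod_symm _ iF, integral_prod _ iF, integral_prod _ i12]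
  have hJi : Integrable (Function.uncurry j) μ := by
    rw [hμ, ← huI]; exact h.integrable_current 0 T
  refine integral_congr_ae ?_
  filter_upwards [ae_restrict_of_ae h.weak_gradient, hJi.prod_right_ae] with τ h1 h2
  exact integral_potential_mul_velocity N h1 (h.density_mem τ) h2 hU

end Balance

/-! ### The pathwise lower bound for the action -/

section Pathwise

variable {d : ℕ}

theorem sqQuot_four_mul_le (v : EuclideanSpace ℝ (Fin d)) {b : ℝ} (hb : 0 ≤ b) :
    sqQuot v (4 * b) ≤ sqQuot v b :=
  ENNReal.div_le_div_left (ENNReal.ofReal_le_ofReal (by linarith)) _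

theorem sqQuot_add_le (v w : EuclideanSpace ℝ (Fin d)) {b : ℝ} (hb : 0 ≤ b) :
    sqQuot (v + w) (4 * b) ≤ sqQuot v b + sqQuot w b := by
  rcases hb.eq_or_lt with rfl | hb
  · by_cases hv : v = 0
    · by_cases hw : w = 0
      · simp [hv, hw, sqQuot_zero_left]
      · simp [sqQuot_of_nonpos hw le_rfl]
    · simp [sqQuot_of_nonpos hv le_rfl]
  · rw [sqQuot_of_pos _ hb, sqQuot_of_pos _ hb, sqQuot_of_pos _ (by positivity),
      ← ENNReal.ofReal_add (by positivity) (by positivity), ← add_div]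
    refine ENNReal.ofReal_le_ofReal ((div_le_div_iff₀ (by positivity) hb).2 ?_)
    have h1 : ‖v + w‖ ^ 2 ≤ 2 * (‖v‖ ^ 2 + ‖w‖ ^ 2) := by
      have := norm_add_le v w
      nlinarith [sq_nonneg (‖v‖ - ‖w‖), norm_nonneg (v + w)]
    nlinarith [mul_le_mul_of_nonneg_right h1 hb.le, sq_nonneg ‖v‖, sq_nonneg ‖w‖]

theorem sqQuot_eq_inner (v : EuclideanSpace ℝ (Fin d)) {b : ℝ} (hb : 0 < b) :
    sqQuot v (4 * b) = ENNReal.ofReal (b⁻¹ * inner ℝ v v / 4) := by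
  rw [sqQuot_of_pos v (by positivity), real_inner_self_eq_norm_sq]
  congr 1
  field_simp

variable {p m : ℝ} {z : PathSpace d p} {ρ : ℝ → Torus d → ℝ}
  {g j : ℝ → Torus d → EuclideanSpace ℝ (Fin d)}

theorem HasDensities.energy_ne_top (h : HasDensities m z ρ g j) {T : ℝ} (hT : 0 < T) :
    ∫⁻ q, sqQuot (g q.1 q.2) (4 * mobility (ρ q.1 q.2))
        ∂((volume.restrict (Icc 0 T)).prod volume) ≠ ∞ ∧
    ∫⁻ q, sqQuot (j q.1 q.2) (4 * mobility (ρ q.1 q.2))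
        ∂((volume.restrict (Icc 0 T)).prod volume) ≠ ∞ ∧
    ∫⁻ q, sqQuot (j q.1 q.2 + g q.1 q.2) (4 * mobility (ρ q.1 q.2))
        ∂((volume.restrict (Icc 0 T)).prod volume) ≠ ∞ := by
  have mρ : Measurable fun q : ℝ × Torus d => ρ q.1 q.2 := h.measurable_density
  have mσ : Measurable fun q : ℝ × Torus d => mobility (ρ q.1 q.2) := measurable_mobility.comp mρ
  have key : ∀ w : ℝ → Torus d → EuclideanSpace ℝ (Fin d), Measurable (Function.uncurry w) →
      (∫⁻ t in Icc (-T) T, ∫⁻ x, sqQuot (w t x) (mobility (ρ t x)) < ∞) →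
      ∫⁻ q, sqQuot (w q.1 q.2) (mobility (ρ q.1 q.2))
        ∂((volume.restrict (Icc 0 T)).prod volume) ≠ ∞ := by
    intro w hw hE
    have mw : Measurable fun q : ℝ × Torus d => w q.1 q.2 := hw
    rw [lintegral_prod _ (mw.sqQuot mσ).aemeasurable]
    refine (lt_of_le_of_lt (lintegral_mono' (Measure.restrict_mono ?_ le_rfl) le_rfl) hE).ne
    exact Icc_subset_Icc_left (by linarith)
  have hg := key g h.measurable_gradient (h.gradient_energy T hT)
  have hj := key j h.measurable_current (h.current_energy T hT)
  have mg : Measurable fun q : ℝ × Torus d => g q.1 q.2 := h.measurable_gradient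
  have mj : Measurable fun q : ℝ × Torus d => j q.1 q.2 := h.measurable_current
  have hfour : ∀ w : ℝ → Torus d → EuclideanSpace ℝ (Fin d),
      ∫⁻ q, sqQuot (w q.1 q.2) (4 * mobility (ρ q.1 q.2))
        ∂((volume.restrict (Icc 0 T)).prod volume) ≤
      ∫⁻ q, sqQuot (w q.1 q.2) (mobility (ρ q.1 q.2))
        ∂((volume.restrict (Icc 0 T)).prod volume) := fun w =>
    lintegral_mono fun q => sqQuot_four_mul_le _ (mobility_nonneg (h.density_mem q.1 q.2))
  have hsum : ∫⁻ q, sqQuot (j q.1 q.2 + g q.1 q.2) (4 * mobility (ρ q.1 q.2))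
        ∂((volume.restrict (Icc 0 T)).prod volume) ≤
      ∫⁻ q, (sqQuot (j q.1 q.2) (mobility (ρ q.1 q.2)) + sqQuot (g q.1 q.2) (mobility (ρ q.1 q.2)))
        ∂((volume.restrict (Icc 0 T)).prod volume) :=
    lintegral_mono fun q => sqQuot_add_le _ _ (mobility_nonneg (h.density_mem q.1 q.2))
  rw [lintegral_add_left (mj.sqQuot mσ)] at hsum
  exact ⟨((hfour g).trans_lt hg.lt_top).ne, ((hfour j).trans_lt hj.lt_top).ne,
    (hsum.trans_lt (ENNReal.add_lt_top.2 ⟨hj.lt_top, hg.lt_top⟩)).ne⟩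

theorem HasDensities.integrable_current_Icc (h : HasDensities m z ρ g j) {T : ℝ} (hT : 0 < T) :
    Integrable (Function.uncurry j) ((volume.restrict (Icc 0 T)).prod volume) := by
  rw [← uIcc_of_le hT.le]; exact h.integrable_current 0 T

theorem HasDensities.integrable_gradient_Icc (h : HasDensities m z ρ g j) {T : ℝ} (hT : 0 < T) :
    Integrable (Function.uncurry g) ((volume.restrict (Icc 0 T)).prod volume) := by
  rw [← uIcc_of_le hT.le]; exact (h.memLp_gradient 0 T).integrable one_le_two

/-- For the smoothed density R, gradient G and current J, |J + G|²/4σ(R) - J·G/2σ(R) = (|J|² +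
|G|²)/4σ(R). By the entropy balance the integral of the subtracted term is half the increment of the
free energy minus half of ∫ ∇U·J. Dropping |J|² and bounding the energy of J + G by that of j + g
leaves the claim. The potential enters only linearly, so the drift σ∇U never has to be smoothed. -/
theorem HasDensities.lintegral_smoothing_gradient_le (h : HasDensities m z ρ g j) (N : ℕ) {T : ℝ}
    (hT : 0 < T) {U : Torus d → ℝ} (hU : TorusContDiff 2 U) {X : ℝ}
    (hX : X = (∫⁻ q, sqQuot (j q.1 q.2 + g q.1 q.2) (4 * mobility (ρ q.1 q.2))
        ∂((volume.restrict (Icc 0 T)).prod volume)).toReal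
      - (freeEnergy U (smoothing N (1 / 2 : ℝ) (ρ T))
        - freeEnergy U (smoothing N (1 / 2 : ℝ) (ρ 0))) / 2
      + (∫ q : ℝ × Torus d, inner ℝ (grad U q.2) (smoothing N 0 (j q.1) q.2)
        ∂((volume.restrict (Icc 0 T)).prod volume)) / 2) :
    0 ≤ X ∧ ∫⁻ q, sqQuot (smoothing N 0 (g q.1) q.2)
        (4 * mobility (smoothing N (1 / 2 : ℝ) (ρ q.1) q.2))
        ∂((volume.restrict (Icc 0 T)).prod volume) ≤ ENNReal.ofReal X := by
  obtain ⟨hEg, hEj, hEs⟩ := h.energy_ne_top hT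
  have hgi := h.integrable_gradient_Icc hT
  have hji := h.integrable_current_Icc hT
  set μ := (volume.restrict (Icc 0 T)).prod (volume : Measure (Torus d)) with hμ
  have mg : Measurable fun q : ℝ × Torus d => smoothing N 0 (g q.1) q.2 :=
    (stronglyMeasurable_smoothing N _ h.measurable_gradient.stronglyMeasurable).measurable
  have mj : Measurable fun q : ℝ × Torus d => smoothing N 0 (j q.1) q.2 :=
    (stronglyMeasurable_smoothing N _ h.measurable_current.stronglyMeasurable).measurable
  have mR := (h.stronglyMeasurable_smoothing_density N).measurable
  have hR : ∀ q : ℝ × Torus d, smoothing N (1 / 2 : ℝ) (ρ q.1) q.2 ∈ Ioo (0 : ℝ) 1 :=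
    fun q => smoothing_mem_Ioo N (h.density_mem q.1) q.2
  have hG : MemLp (fun q : ℝ × Torus d => smoothing N 0 (g q.1) q.2) 2 μ :=
    memLp_of_lintegral_sqQuot mg.aemeasurable
      (Eventually.of_forall fun q => Ioo_subset_Icc_self (hR q))
      (lt_of_le_of_lt (lintegral_sqQuot_smoothing_prod_le N h.measurable_density h.density_mem
        h.measurable_gradient hgi) hEg.lt_top).ne
  have hJ : MemLp (fun q : ℝ × Torus d => smoothing N 0 (j q.1) q.2) 2 μ :=
    memLp_of_lintegral_sqQuot mj.aemeasurable
      (Eventually.of_forall fun q => Ioo_subset_Icc_self (hR q))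
      (lt_of_le_of_lt (lintegral_sqQuot_smoothing_prod_le N h.measurable_density h.density_mem
        h.measurable_current hji) hEj.lt_top).ne
  have hS : MemLp (fun q : ℝ × Torus d =>
      smoothing N 0 (j q.1) q.2 + smoothing N 0 (g q.1) q.2) 2 μ := hJ.add hG
  obtain ⟨i1, i2, hbal⟩ := h.freeEnergy_smoothing_sub N hT.le hU hG hJ
  rw [integral_add i1 i2] at hbal
  obtain ⟨Cm, hCm⟩ := exists_bound_comp_smoothing (d := d) continuousOn_inv_mobility N
  have hquad : ∀ {v : ℝ × Torus d → EuclideanSpace ℝ (Fin d)}, MemLp v 2 μ →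
      Integrable (fun q => (mobility (smoothing N (1 / 2 : ℝ) (ρ q.1) q.2))⁻¹ *
        inner ℝ (v q) (v q) / 4) μ := fun hv =>
    ((integrable_inner_of_memLp hv hv).bdd_mul
      ((measurable_mobility.comp mR).inv.aestronglyMeasurable)
      (Eventually.of_forall fun q => hCm _ (h.density_mem q.1) q.2)).div_const 4
  have hnn : ∀ (v : ℝ × Torus d → EuclideanSpace ℝ (Fin d)) q,
      0 ≤ (mobility (smoothing N (1 / 2 : ℝ) (ρ q.1) q.2))⁻¹ * inner ℝ (v q) (v q) / 4 := by
    intro v q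
    have := mobility_pos (hR q)
    rw [real_inner_self_eq_norm_sq]
    positivity
  have hval : ∀ {v : ℝ × Torus d → EuclideanSpace ℝ (Fin d)}, MemLp v 2 μ →
      ∫⁻ q, sqQuot (v q) (4 * mobility (smoothing N (1 / 2 : ℝ) (ρ q.1) q.2)) ∂μ =
        ENNReal.ofReal (∫ q, (mobility (smoothing N (1 / 2 : ℝ) (ρ q.1) q.2))⁻¹ *
          inner ℝ (v q) (v q) / 4 ∂μ) := by
    intro v hv
    rw [ofReal_integral_eq_lintegral_ofReal (hquad hv) (Eventually.of_forall (hnn v))]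
    exact lintegral_congr fun q => sqQuot_eq_inner _ (mobility_pos (hR q))
  have hsum : ∫ q : ℝ × Torus d, (mobility (smoothing N (1 / 2 : ℝ) (ρ q.1) q.2))⁻¹ *
      inner ℝ (smoothing N 0 (j q.1) q.2 + smoothing N 0 (g q.1) q.2)
        (smoothing N 0 (j q.1) q.2 + smoothing N 0 (g q.1) q.2) / 4 ∂μ ≤
      (∫⁻ q, sqQuot (j q.1 q.2 + g q.1 q.2) (4 * mobility (ρ q.1 q.2)) ∂μ).toReal := by
    rw [← ENNReal.ofReal_le_iff_le_toReal hEs, ← hval hS]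
    refine le_trans (le_of_eq ?_) (lintegral_sqQuot_smoothing_prod_le N
      (w := fun τ x => j τ x + g τ x) h.measurable_density h.density_mem
      (h.measurable_current.add h.measurable_gradient) (hji.add hgi))
    refine lintegral_congr_ae ?_
    have h2 : ∀ᵐ q : ℝ × Torus d ∂μ, Integrable (j q.1) :=
      Measure.quasiMeasurePreserving_fst.ae hji.prod_right_ae
    have h3 : ∀ᵐ q : ℝ × Torus d ∂μ, Integrable (g q.1) :=
      Measure.quasiMeasurePreserving_fst.ae hgi.prod_right_ae
    filter_upwards [h2, h3] with q hq1 hq2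
    rw [smoothing_add N hq1 hq2]
  have hle : ∫ q : ℝ × Torus d, (mobility (smoothing N (1 / 2 : ℝ) (ρ q.1) q.2))⁻¹ *
      inner ℝ (smoothing N 0 (g q.1) q.2) (smoothing N 0 (g q.1) q.2) / 4 ∂μ ≤ X := by
    have i3 := (hquad hS).sub (i1.div_const 2)
    have h4 := integral_mono (hquad hG) i3 (fun q => by
      have hb := mobility_pos (hR q)
      simp only [Pi.sub_apply, inner_add_left, inner_add_right]
      rw [real_inner_comm (smoothing N 0 (g q.1) q.2) (smoothing N 0 (j q.1) q.2)]
      have h5 : 0 ≤ (mobility (smoothing N (1 / 2 : ℝ) (ρ q.1) q.2))⁻¹ *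
        inner ℝ (smoothing N 0 (j q.1) q.2) (smoothing N 0 (j q.1) q.2) := by
          rw [real_inner_self_eq_norm_sq]; positivity
      linarith)
    have h6 := integral_sub (hquad hS) (i1.div_const 2)
    have h7 := integral_div (μ := μ) 2 fun q : ℝ × Torus d =>
      (mobility (smoothing N (1 / 2 : ℝ) (ρ q.1) q.2))⁻¹ *
        inner ℝ (smoothing N 0 (g q.1) q.2) (smoothing N 0 (j q.1) q.2)
    simp only [Pi.sub_apply] at h4
    rw [h6, h7] at h4
    rw [hX]
    linarith
  exact ⟨(integral_nonneg (hnn _)).trans hle, (hval hG).trans_le (ENNReal.ofReal_le_ofReal hle)⟩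

theorem HasDensities.tendsto_freeEnergy_smoothing (h : HasDensities m z ρ g j) {U : Torus d → ℝ}
    (hU : Continuous U) (t : ℝ) :
    Tendsto (fun N => freeEnergy U (smoothing N (1 / 2 : ℝ) (ρ t))) atTop
      (𝓝 (freeEnergy U (ρ t))) := by
  have hi := h.integrable_density t
  have hc : ∀ N, Continuous (smoothing N (1 / 2 : ℝ) (ρ t)) := fun N => continuous_smoothing N _ hi
  exact tendsto_freeEnergy hU (fun N => (hc N).measurable.aemeasurable)
    (fun N => Eventually.of_forall fun x =>
      Ioo_subset_Icc_self (smoothing_mem_Ioo N (h.density_mem t) x))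
    (tendstoInMeasure_of_eLpNorm_one (fun N => (hc N).aestronglyMeasurable)
      hi.aestronglyMeasurable (tendsto_eLpNorm_smoothing _ hi))

/-- The limit N → ∞ of the smoothed inequality: the free energies and the pairing of the current
with ∇U converge, and the gradient energy is lower semicontinuous. -/
theorem HasDensities.lintegral_gradient_le (h : HasDensities m z ρ g j) {T : ℝ}
    (hT : 0 < T) {U : Torus d → ℝ} (hU : TorusContDiff 2 U) :
    (∫⁻ q, sqQuot (g q.1 q.2) (4 * mobility (ρ q.1 q.2))
        ∂((volume.restrict (Icc 0 T)).prod volume)).toReal ≤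
      (∫⁻ q, sqQuot (j q.1 q.2 + g q.1 q.2) (4 * mobility (ρ q.1 q.2))
        ∂((volume.restrict (Icc 0 T)).prod volume)).toReal
      - (freeEnergy U (ρ T) - freeEnergy U (ρ 0)) / 2
      + (∫ q : ℝ × Torus d, inner ℝ (grad U q.2) (j q.1 q.2)
        ∂((volume.restrict (Icc 0 T)).prod volume)) / 2 := by
  have hgi := h.integrable_gradient_Icc hT
  have hji := h.integrable_current_Icc hT
  set μ := (volume.restrict (Icc 0 T)).prod (volume : Measure (Torus d)) with hμ
  have sg := h.measurable_gradient.stronglyMeasurable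
  have sj := h.measurable_current.stronglyMeasurable
  have sρ := h.measurable_density.stronglyMeasurable
  have hρi : Integrable (Function.uncurry ρ) μ := Integrable.of_bound sρ.aestronglyMeasurable 1
    (Eventually.of_forall fun q => by
      rw [Function.uncurry, Real.norm_of_nonneg (h.density_mem _ _).1]
      exact (h.density_mem _ _).2)
  have cgrad : Continuous (grad U) := continuous_grad hU (by norm_num)
  obtain ⟨Cg, hCg0, hCg⟩ := exists_bound_of_continuous cgrad
  have hinner : ∀ {v : ℝ × Torus d → EuclideanSpace ℝ (Fin d)}, Integrable v μ →
      Integrable (fun q => inner ℝ (grad U q.2) (v q)) μ := fun hv =>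
    (hv.norm.const_mul Cg).mono'
      ((cgrad.comp continuous_snd).aestronglyMeasurable.inner hv.1)
      (Eventually.of_forall fun q => (norm_inner_le_norm _ _).trans
        (mul_le_mul_of_nonneg_right (hCg _) (norm_nonneg _)))
  have hlimJ : Tendsto (fun N => ∫ q : ℝ × Torus d,
      inner ℝ (grad U q.2) (smoothing N 0 (j q.1) q.2) ∂μ) atTop
      (𝓝 (∫ q : ℝ × Torus d, inner ℝ (grad U q.2) (j q.1 q.2) ∂μ)) := by
    refine tendsto_integral_of_L1' _ (hinner hji).1
      (Eventually.of_forall fun N => hinner (integrable_smoothing N 0 sj hji)) ?_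
    have h1 := ENNReal.Tendsto.const_mul (a := ENNReal.ofReal Cg)
      (tendsto_eLpNorm_smoothing_prod 0 sj hji) (Or.inr ENNReal.ofReal_ne_top)
    rw [mul_zero] at h1
    refine tendsto_of_tendsto_of_tendsto_of_le_of_le tendsto_const_nhds h1 (fun N => zero_le)
      fun N => ?_
    refine eLpNorm_le_mul_eLpNorm_of_ae_le_mul (Eventually.of_forall fun q => ?_) 1
    simp only [Pi.sub_apply, Function.uncurry]
    rw [← inner_sub_right]
    exact (norm_inner_le_norm _ _).trans (mul_le_mul_of_nonneg_right (hCg _) (norm_nonneg _))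
  have hX := (((h.tendsto_freeEnergy_smoothing hU.continuous T).sub
    (h.tendsto_freeEnergy_smoothing hU.continuous 0)).div_const 2).const_sub
    (∫⁻ q, sqQuot (j q.1 q.2 + g q.1 q.2) (4 * mobility (ρ q.1 q.2)) ∂μ).toReal
  have hX' := hX.add (hlimJ.div_const 2)
  have key := fun N => h.lintegral_smoothing_gradient_le N hT hU rfl
  refine ENNReal.toReal_le_of_le_ofReal (ge_of_tendsto' hX' fun N => (key N).1) ?_
  have mrN : ∀ N, Measurable (fun q : ℝ × Torus d => smoothing N (1 / 2 : ℝ) (ρ q.1) q.2) :=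
    fun N => (h.stronglyMeasurable_smoothing_density N).measurable
  have mgN : ∀ N, StronglyMeasurable (fun q : ℝ × Torus d => smoothing N 0 (g q.1) q.2) :=
    fun N => stronglyMeasurable_smoothing N _ sg
  -- Lower semicontinuity is used without drift (F = 0); the drift returns later by expanding
  -- squares.
  have hfin := lintegral_sqQuot_le_of_tendstoInMeasure (μ := μ) (F := fun _ => 0)
    (tendstoInMeasure_of_eLpNorm_one (fun N => (mrN N).aestronglyMeasurable)
      sρ.aestronglyMeasurable (tendsto_eLpNorm_smoothing_prod (1 / 2 : ℝ) sρ hρi))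
    (tendstoInMeasure_of_eLpNorm_one (fun N => (mgN N).aestronglyMeasurable)
      sg.aestronglyMeasurable (tendsto_eLpNorm_smoothing_prod 0 sg hgi))
    (fun N => (mrN N).aemeasurable) (fun N => (mgN N).measurable.aemeasurable)
    (fun N => Eventually.of_forall fun q =>
      Ioo_subset_Icc_self (smoothing_mem_Ioo N (h.density_mem q.1) q.2))
    aemeasurable_const ((ENNReal.continuous_ofReal.tendsto _).comp hX')
    (fun N => by simp only [smul_zero, add_zero]; exact (key N).2)
  simp only [smul_zero, add_zero] at hfin
  exact hfin

/-- The pathwise inequality between the action and the time integral of the Fisher information. -/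
theorem HasDensities.fisher_add_freeEnergy_le (h : HasDensities m z ρ g j) {T : ℝ}
    (hT : 0 < T) {U : Torus d → ℝ} (hU : TorusContDiff 2 U)
    {E : Torus d → EuclideanSpace ℝ (Fin d)} (hE : ∀ x, E x = - grad U x) {C : ℝ}
    (hC : ∀ x, ‖U x‖ ≤ C) :
    (∫⁻ t in Icc 0 T, ∫⁻ x, sqQuot (g t x + mobility (ρ t x) • grad U x) (4 * mobility (ρ t x)))
        + ENNReal.ofReal (freeEnergy U (ρ T) / 2 + (C + 1)) ≤
      (∫⁻ t in Icc 0 T, ∫⁻ x,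
        sqQuot (j t x + g t x - mobility (ρ t x) • E x) (4 * mobility (ρ t x)))
        + ENNReal.ofReal (freeEnergy U (ρ 0) / 2 + (C + 1)) := by
  have hgi := h.integrable_gradient_Icc hT
  have hji := h.integrable_current_Icc hT
  obtain ⟨hEg, hEj, hEs⟩ := h.energy_ne_top hT
  have cgrad : Continuous (grad U) := continuous_grad hU (by norm_num)
  obtain ⟨Cg, hCg0, hCg⟩ := exists_bound_of_continuous cgrad
  have mρ : Measurable fun q : ℝ × Torus d => ρ q.1 q.2 := h.measurable_density
  have mg : Measurable fun q : ℝ × Torus d => g q.1 q.2 := h.measurable_gradient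
  have mj : Measurable fun q : ℝ × Torus d => j q.1 q.2 := h.measurable_current
  have mU : Measurable fun q : ℝ × Torus d => grad U q.2 := cgrad.measurable.comp measurable_snd
  have mjg : Measurable fun q : ℝ × Torus d => j q.1 q.2 + g q.1 q.2 := mj.add mg
  have mmob : Measurable fun q : ℝ × Torus d => mobility (ρ q.1 q.2) := by fun_prop
  have hmain := h.lintegral_gradient_le hT hU
  set μ := (volume.restrict (Icc 0 T)).prod (volume : Measure (Torus d)) with hμ
  have h01 : ∀ᵐ q : ℝ × Torus d ∂μ, ρ q.1 q.2 ∈ Icc (0 : ℝ) 1 :=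
    Eventually.of_forall fun q => h.density_mem _ _
  have e1 : ∫⁻ t in Icc 0 T, ∫⁻ x,
      sqQuot (g t x + mobility (ρ t x) • grad U x) (4 * mobility (ρ t x)) =
      ∫⁻ q, sqQuot (g q.1 q.2 + mobility (ρ q.1 q.2) • grad U q.2) (4 * mobility (ρ q.1 q.2)) ∂μ := by
    have mm : Measurable fun q : ℝ × Torus d =>
        sqQuot (g q.1 q.2 + mobility (ρ q.1 q.2) • grad U q.2) (4 * mobility (ρ q.1 q.2)) :=
      (mg.add (mmob.smul mU)).sqQuot (mmob.const_mul 4)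
    rw [hμ, lintegral_prod _ mm.aemeasurable]
  have e2 : ∫⁻ t in Icc 0 T, ∫⁻ x,
      sqQuot (j t x + g t x - mobility (ρ t x) • E x) (4 * mobility (ρ t x)) =
      ∫⁻ q, sqQuot (j q.1 q.2 + g q.1 q.2 + mobility (ρ q.1 q.2) • grad U q.2)
        (4 * mobility (ρ q.1 q.2)) ∂μ := by
    have mm : Measurable fun q : ℝ × Torus d =>
        sqQuot (j q.1 q.2 + g q.1 q.2 + mobility (ρ q.1 q.2) • grad U q.2)
          (4 * mobility (ρ q.1 q.2)) :=
      (mjg.add (mmob.smul mU)).sqQuot (mmob.const_mul 4)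
    rw [hμ, lintegral_prod _ mm.aemeasurable]
    simp only [hE, smul_neg, sub_neg_eq_add]
  -- Both squares with drift are expanded. The terms ∫ ∇ρ·∇U/2 and ∫ σ|∇U|²/4 occur on both sides
  -- and cancel; what is left is the inequality without drift.
  obtain ⟨hn1, hv1⟩ := lintegral_sqQuot_add mρ.aemeasurable mg.aemeasurable mU.aemeasurable
    (fun q => hCg q.2) h01 hEg
  obtain ⟨hn2, hv2⟩ := lintegral_sqQuot_add mρ.aemeasurable mjg.aemeasurable mU.aemeasurable
    (fun q => hCg q.2) h01 hEs
  have hinner : ∀ {v : ℝ × Torus d → EuclideanSpace ℝ (Fin d)}, Integrable v μ →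
      Integrable (fun q => inner ℝ (v q) (grad U q.2)) μ := fun hv =>
    (hv.norm.mul_const Cg).mono' (hv.1.inner (cgrad.comp continuous_snd).aestronglyMeasurable)
      (Eventually.of_forall fun q => (norm_inner_le_norm _ _).trans
        (mul_le_mul_of_nonneg_left (hCg _) (norm_nonneg _)))
  have hsplit : ∫ q, inner ℝ (j q.1 q.2 + g q.1 q.2) (grad U q.2) ∂μ =
      (∫ q : ℝ × Torus d, inner ℝ (grad U q.2) (j q.1 q.2) ∂μ)
        + ∫ q : ℝ × Torus d, inner ℝ (g q.1 q.2) (grad U q.2) ∂μ := by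
    have i1 : Integrable (fun q : ℝ × Torus d => inner ℝ (j q.1 q.2) (grad U q.2)) μ := hinner hji
    have i2 : Integrable (fun q : ℝ × Torus d => inner ℝ (g q.1 q.2) (grad U q.2)) μ := hinner hgi
    simp only [inner_add_left]
    rw [integral_add i1 i2]
    simp only [real_inner_comm]
  -- Since the free energy is at least -(C + 1), adding C + 1 to its half makes it nonnegative, as
  -- needed for an inequality in [0, ∞].
  have hΦ : ∀ t, 0 ≤ freeEnergy U (ρ t) / 2 + (C + 1) := fun t => by
    have := abs_le.1 (abs_freeEnergy_le hC (u := ρ t) (Eventually.of_forall (h.density_mem t)))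
    have h0 : 0 ≤ C := (norm_nonneg _).trans (hC 0)
    linarith [this.1]
  rw [e1, e2, hv1, hv2, ← ENNReal.ofReal_add hn1 (hΦ T), ← ENNReal.ofReal_add hn2 (hΦ 0)]
  refine ENNReal.ofReal_le_ofReal ?_
  rw [hsplit]
  linarith

end Pathwise

/-! ### Regularised functionals of a measure -/

section Regularised

variable {d : ℕ}

/-- The convolution of the kernel `K` with the measure `μ`. -/
def convolve (K : Torus d → ℝ) (μ : FiniteMeasure (Torus d)) (x : Torus d) : ℝ :=
  ∫ y, K (x - y) ∂(μ : Measure (Torus d))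

theorem continuous_convolve {K : Torus d → ℝ} (hK : Continuous K) (μ : FiniteMeasure (Torus d)) :
    Continuous (convolve K μ) := by
  obtain ⟨C, -, hC⟩ := exists_bound_of_continuous hK
  refine continuous_of_dominated (bound := fun _ => C)
    (fun x => (hK.comp (continuous_const.sub continuous_id)).aestronglyMeasurable)
    (fun x => Eventually.of_forall fun y => hC _) (integrable_const _)
    (Eventually.of_forall fun y => hK.comp (continuous_id.sub continuous_const))

theorem mPlus_measureReal_univ_le {μ : FiniteMeasure (Torus d)} (hμ : μ ∈ MPlus d) :
    (μ : Measure (Torus d)).real univ ≤ 1 := hμ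

theorem abs_integral_le_of_mPlus {μ : FiniteMeasure (Torus d)} (hμ : μ ∈ MPlus d)
    {f : Torus d → ℝ} {C : ℝ} (hC0 : 0 ≤ C) (hC : ∀ x, ‖f x‖ ≤ C) :
    |∫ x, f x ∂(μ : Measure (Torus d))| ≤ C := by
  refine (norm_integral_le_of_norm_le_const (Eventually.of_forall hC)).trans ?_
  exact mul_le_of_le_one_right hC0 (mPlus_measureReal_univ_le hμ)

/-- The map `ξ` is measurable in the weak sense. -/
def WeaklyMeasurable {Ω : Type*} [MeasurableSpace Ω] (ξ : Ω → FiniteMeasure (Torus d)) : Prop :=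
  ∀ f : C(Torus d, ℝ), Measurable fun ω => ∫ x, f x ∂(ξ ω : Measure (Torus d))

section Measurability

variable {Ω : Type*} [MeasurableSpace Ω] {ξ : Ω → FiniteMeasure (Torus d)}

theorem WeaklyMeasurable.convolve_apply (hξ : WeaklyMeasurable ξ) {K : Torus d → ℝ}
    (hK : Continuous K) (x : Torus d) : Measurable fun ω => convolve K (ξ ω) x :=
  hξ ⟨fun y => K (x - y), hK.comp (continuous_const.sub continuous_id)⟩

theorem WeaklyMeasurable.convolve (hξ : WeaklyMeasurable ξ) {K : Torus d → ℝ}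
    (hK : Continuous K) : Measurable fun q : Ω × Torus d => convolve K (ξ q.1) q.2 := by
  have h := measurable_uncurry_of_continuous_of_measurable
    (u := fun x ω => WASEP.convolve K (ξ ω) x) (fun ω => continuous_convolve hK (ξ ω))
    (fun x => hξ.convolve_apply hK x)
  exact h.comp measurable_swap

end Measurability

/-- The extension of `|v|² / (4 σ(r))` to all real `r` by a supremum of affine functions. -/
def kinetic (v : EuclideanSpace ℝ (Fin d)) (r : ℝ) : ℝ≥0∞ :=
  ⨆ q : EuclideanSpace ℝ (Fin d), ENNReal.ofReal (2 * inner ℝ q v - ‖q‖ ^ 2 * (4 * mobility r))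

theorem kinetic_eq_sqQuot (v : EuclideanSpace ℝ (Fin d)) {r : ℝ} (hr : r ∈ Icc (0 : ℝ) 1) :
    kinetic v r = sqQuot v (4 * mobility r) :=
  (sqQuot_eq_iSup v (mul_nonneg zero_le_four (mobility_nonneg hr))).symm

theorem ofReal_sq_norm_le_kinetic (v : EuclideanSpace ℝ (Fin d)) (r : ℝ) :
    ENNReal.ofReal (‖v‖ ^ 2) ≤ kinetic v r := by
  refine le_trans (ENNReal.ofReal_le_ofReal ?_) (le_iSup (fun q : EuclideanSpace ℝ (Fin d) =>
    ENNReal.ofReal (2 * inner ℝ q v - ‖q‖ ^ 2 * (4 * mobility r))) v)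
  rw [real_inner_self_eq_norm_sq]
  nlinarith [mobility_le r, sq_nonneg ‖v‖]

/-- Outside [0, 1] the mobility is negative, so the expression grows quadratically along any
direction q; a direction exists because 1 ≤ d. Finite Fisher information thus carries the constraint
0 ≤ ρ ≤ 1. -/
theorem mem_Icc_of_kinetic_ne_top (hd : 1 ≤ d) {v : EuclideanSpace ℝ (Fin d)} {r : ℝ}
    (h : kinetic v r ≠ ∞) : r ∈ Icc (0 : ℝ) 1 := by
  by_contra hr
  have hneg : mobility r < 0 := by
    unfold mobility
    by_contra h0
    push Not at h0
    refine hr ⟨?_, ?_⟩ <;> nlinarith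
  apply h
  refine iSup_eq_top.2 fun c hc => ?_
  set e : EuclideanSpace ℝ (Fin d) := EuclideanSpace.single ⟨0, hd⟩ 1 with he
  have hen : ‖e‖ = 1 := by simp [he]
  set b := -(4 * mobility r) with hb
  have hb0 : 0 < b := by linarith
  obtain ⟨s, hs0, hs⟩ : ∃ s : ℝ, 0 ≤ s ∧ c.toReal + 2 * s * |inner ℝ e v| + 1 ≤ s ^ 2 * b := by
    set A := |inner ℝ e v| with hA
    refine ⟨(c.toReal + 2 * A + 1) / b + 1, by positivity, ?_⟩
    have h1 : ((c.toReal + 2 * A + 1) / b + 1) * b = c.toReal + 2 * A + 1 + b := by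
      field_simp
    have hA0 : 0 ≤ A := abs_nonneg _
    have hc0 : 0 ≤ c.toReal := ENNReal.toReal_nonneg
    have hs1 : 1 ≤ (c.toReal + 2 * A + 1) / b + 1 := by
      have : 0 ≤ (c.toReal + 2 * A + 1) / b := by positivity
      linarith
    nlinarith
  refine ⟨s • e, ?_⟩
  rw [ENNReal.lt_ofReal_iff_toReal_lt hc.ne, inner_smul_left, norm_smul, hen,
    Real.norm_of_nonneg hs0]
  simp only [RCLike.conj_to_real, mul_one]
  have := neg_abs_le (inner ℝ e v)
  nlinarith

theorem measurable_kinetic :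
    Measurable fun q : EuclideanSpace ℝ (Fin d) × ℝ => kinetic q.1 q.2 := by
  have h : LowerSemicontinuous fun q : EuclideanSpace ℝ (Fin d) × ℝ => kinetic q.1 q.2 := by
    refine lowerSemicontinuous_iSup fun q => Continuous.lowerSemicontinuous ?_
    refine ENNReal.continuous_ofReal.comp ?_
    fun_prop
  exact h.measurable

/-- The gradient of the convolution of `μ` with `kernel N`. -/
def smoothGradient (N : ℕ) (μ : FiniteMeasure (Torus d)) (x : Torus d) :
    EuclideanSpace ℝ (Fin d) :=
  WithLp.toLp 2 fun k => convolve (pderiv k (kernel N)) μ x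

/-- The Fisher information of the mollified measure. -/
def mollifiedFisher (N : ℕ) (μ : FiniteMeasure (Torus d)) : ℝ≥0∞ :=
  ∫⁻ x, kinetic (smoothGradient N μ x) (convolve (kernel N) μ x)

/-- The Fisher information of a measure. -/
def fisherInformation (μ : FiniteMeasure (Torus d)) : ℝ≥0∞ := ⨆ N, mollifiedFisher N μ

section Measurability

variable {Ω : Type*} [MeasurableSpace Ω] {ξ : Ω → FiniteMeasure (Torus d)}

theorem WeaklyMeasurable.measurable_smoothGradient (hξ : WeaklyMeasurable ξ) (N : ℕ) :
    Measurable fun q : Ω × Torus d => smoothGradient N (ξ q.1) q.2 := by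
  have h1 : Measurable fun (q : Ω × Torus d) (k : Fin d) =>
      WASEP.convolve (pderiv k (kernel N)) (ξ q.1) q.2 :=
    measurable_pi_lambda _ fun k => hξ.convolve (hasPDeriv_kernel N k).2
  unfold smoothGradient
  exact (WithLp.measurable_toLp 2 (Fin d → ℝ)).comp h1

theorem WeaklyMeasurable.measurable_smoothGradient_prodMk (hξ : WeaklyMeasurable ξ) (N : ℕ) :
    Measurable fun q : Ω × Torus d =>
      (smoothGradient N (ξ q.1) q.2, WASEP.convolve (kernel N) (ξ q.1) q.2) :=
  (hξ.measurable_smoothGradient N).prodMk (hξ.convolve (continuous_kernel N))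

theorem WeaklyMeasurable.kinetic_uncurry (hξ : WeaklyMeasurable ξ) (N : ℕ) :
    Measurable fun q : Ω × Torus d =>
      kinetic (smoothGradient N (ξ q.1) q.2) (WASEP.convolve (kernel N) (ξ q.1) q.2) := by
  have h := (measurable_kinetic (d := d)).comp (hξ.measurable_smoothGradient_prodMk N)
  exact h

theorem WeaklyMeasurable.mollifiedFisher (hξ : WeaklyMeasurable ξ) (N : ℕ) :
    Measurable fun ω => mollifiedFisher N (ξ ω) :=
  (hξ.kinetic_uncurry N).lintegral_prod_right'

theorem WeaklyMeasurable.fisherInformation (hξ : WeaklyMeasurable ξ) :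
    Measurable fun ω => fisherInformation (ξ ω) :=
  Measurable.iSup fun N => hξ.mollifiedFisher N

/-- The measure `ν` is the barycentre of `ξ` under `Q`. -/
def IsBarycenter (Q : Measure Ω) (ξ : Ω → FiniteMeasure (Torus d))
    (ν : FiniteMeasure (Torus d)) : Prop :=
  ∀ f : C(Torus d, ℝ), ∫ ω, (∫ x, f x ∂(ξ ω : Measure (Torus d))) ∂Q =
    ∫ x, f x ∂(ν : Measure (Torus d))

theorem WeaklyMeasurable.integrable (hξ : WeaklyMeasurable ξ) (h1 : ∀ ω, ξ ω ∈ MPlus d)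
    (Q : Measure Ω) [IsFiniteMeasure Q] (f : C(Torus d, ℝ)) :
    Integrable (fun ω => ∫ x, f x ∂(ξ ω : Measure (Torus d))) Q :=
  Integrable.of_bound (hξ f).aestronglyMeasurable ‖f‖ (Eventually.of_forall fun ω =>
    abs_integral_le_of_mPlus (h1 ω) (norm_nonneg _) f.norm_coe_le_norm)

/-- Jensen's inequality for the mollified Fisher information. -/
theorem WeaklyMeasurable.mollifiedFisher_le (hξ : WeaklyMeasurable ξ) (h1 : ∀ ω, ξ ω ∈ MPlus d)
    {Q : Measure Ω} [IsProbabilityMeasure Q] {ν : FiniteMeasure (Torus d)}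
    (hν : IsBarycenter Q ξ ν) (N : ℕ) :
    WASEP.mollifiedFisher N ν ≤ ∫⁻ ω, WASEP.mollifiedFisher N (ξ ω) ∂Q := by
  unfold WASEP.mollifiedFisher
  rw [lintegral_lintegral_swap (hξ.kinetic_uncurry N).aemeasurable]
  refine lintegral_mono fun x => iSup_le fun q => ?_
  have hb : ∀ {K : Torus d → ℝ}, Continuous K →
      Integrable (fun ω => WASEP.convolve K (ξ ω) x) Q ∧
      ∫ ω, WASEP.convolve K (ξ ω) x ∂Q = WASEP.convolve K ν x := fun hK =>
    ⟨hξ.integrable h1 Q ⟨fun y => _, hK.comp (continuous_const.sub continuous_id)⟩,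
      hν ⟨fun y => _, hK.comp (continuous_const.sub continuous_id)⟩⟩
  set a := WASEP.convolve (kernel N) ν x with ha
  -- For fixed x and q, the tangent line of the mobility at the value a of the barycentre gives a
  -- lower bound that is affine in the measure, hence integrates exactly to its value at the
  -- barycentre.
  set F : Ω → ℝ := fun ω => 2 * inner ℝ q (smoothGradient N (ξ ω) x) -
    ‖q‖ ^ 2 * (4 * (a ^ 2 + (1 - 2 * a) * WASEP.convolve (kernel N) (ξ ω) x)) with hF
  have hinner : ∀ μ : FiniteMeasure (Torus d), inner ℝ q (smoothGradient N μ x) =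
      ∑ k, q k * WASEP.convolve (pderiv k (kernel N)) μ x := fun μ => inner_eq_sum _ _
  have i0 := fun k => hb (hasPDeriv_kernel (d := d) N k).2
  have i1 : Integrable (fun ω => ∑ k, q k * WASEP.convolve (pderiv k (kernel N)) (ξ ω) x) Q :=
    integrable_finsetSum _ fun k _ => (i0 k).1.const_mul _
  obtain ⟨i2, e2⟩ := hb (continuous_kernel (d := d) N)
  have i3 : Integrable
      (fun ω => 4 * (a ^ 2 + (1 - 2 * a) * WASEP.convolve (kernel N) (ξ ω) x)) Q :=
    ((integrable_const _).add (i2.const_mul _)).const_mul _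
  have iF : Integrable F Q := by
    simp only [hF, hinner]
    exact (i1.const_mul 2).sub (i3.const_mul _)
  have eF : ∫ ω, F ω ∂Q = 2 * inner ℝ q (smoothGradient N ν x) - ‖q‖ ^ 2 * (4 * mobility a) := by
    simp only [hF, hinner]
    rw [integral_sub (i1.const_mul 2) (i3.const_mul _), integral_const_mul, integral_const_mul,
      integral_const_mul, integral_add (integrable_const _) (i2.const_mul _), integral_const_mul,
      integral_finsetSum _ fun k _ => (i0 k).1.const_mul _, e2]
    simp only [integral_const_mul, (i0 _).2, integral_const, probReal_univ, one_smul]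
    unfold mobility
    ring
  rw [← eF]
  refine (ofReal_integral_le_lintegral iF).trans (lintegral_mono fun ω => ?_)
  refine le_trans (ENNReal.ofReal_le_ofReal ?_) (le_iSup (fun q : EuclideanSpace ℝ (Fin d) =>
    ENNReal.ofReal (2 * inner ℝ q (smoothGradient N (ξ ω) x) -
      ‖q‖ ^ 2 * (4 * mobility (WASEP.convolve (kernel N) (ξ ω) x)))) q)
  simp only [hF]
  have := mobility_le_affine a (WASEP.convolve (kernel N) (ξ ω) x)
  nlinarith [sq_nonneg ‖q‖]

theorem WeaklyMeasurable.fisherInformation_le (hξ : WeaklyMeasurable ξ)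
    (h1 : ∀ ω, ξ ω ∈ MPlus d) {Q : Measure Ω} [IsProbabilityMeasure Q]
    {ν : FiniteMeasure (Torus d)} (hν : IsBarycenter Q ξ ν) :
    WASEP.fisherInformation ν ≤ ∫⁻ ω, WASEP.fisherInformation (ξ ω) ∂Q :=
  iSup_le fun N => (hξ.mollifiedFisher_le h1 hν N).trans
    (lintegral_mono fun _ => le_iSup (fun N => WASEP.mollifiedFisher N _) N)

end Measurability

/-- Truncation to the unit interval. -/
def clamp (r : ℝ) : ℝ := max 0 (min 1 r)

theorem clamp_mem (r : ℝ) : clamp r ∈ Icc (0 : ℝ) 1 :=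
  ⟨le_max_left _ _, max_le zero_le_one (min_le_left _ _)⟩

theorem clamp_of_mem {r : ℝ} (hr : r ∈ Icc (0 : ℝ) 1) : clamp r = r := by
  rw [clamp, min_eq_right hr.2, max_eq_right hr.1]

theorem continuous_clamp : Continuous clamp := by unfold clamp; fun_prop

theorem abs_clamp_sub_le (a b : ℝ) : |clamp a - clamp b| ≤ |a - b| := by
  unfold clamp
  have h1 := abs_max_sub_max_le_max 0 (min 1 a) 0 (min 1 b)
  have h2 := abs_min_sub_min_le_max 1 a 1 b
  rw [sub_self, abs_zero] at h1 h2
  exact h1.trans (max_le (abs_nonneg _) (h2.trans (max_le (abs_nonneg _) le_rfl)))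

theorem mobility_clamp_le (a b : ℝ) : mobility (clamp a) ≤ mobility (clamp b) + |a - b| := by
  have h1 := abs_clamp_sub_le a b
  have ha := clamp_mem a
  have hb := clamp_mem b
  have h2 := abs_le.1 h1
  unfold mobility
  rcases le_total (clamp a) (clamp b) with h | h <;> nlinarith [ha.1, ha.2, hb.1, hb.2]

end Regularised

/-! ### Measures of finite Fisher information -/

section WeakLimit

/-- Closed balls of the dual are weak-* compact, so the sequence converges along an ultrafilter, and
no subsequence has to be extracted. -/
theorem exists_tendsto_inner_hyperfilter {H : Type*} [NormedAddCommGroup H] [InnerProductSpace ℝ H]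
    [CompleteSpace H] {x : ℕ → H} {C : ℝ} (h : ∀ n, ‖x n‖ ≤ C) :
    ∃ x₀ : H, ∀ y, Tendsto (fun n => inner ℝ (x n) y) (hyperfilter ℕ) (𝓝 (inner ℝ x₀ y)) := by
  set u : ℕ → WeakDual ℝ H := fun n =>
    WeakDual.toStrongDual.symm (InnerProductSpace.toDual ℝ H (x n)) with hu
  have hK := WeakDual.isCompact_closedBall (𝕜 := ℝ) (E := H) 0 C
  obtain ⟨L, -, hL⟩ := hK.ultrafilter_le_nhds ((hyperfilter ℕ).map u) (by
    rw [le_principal_iff, Ultrafilter.mem_coe, Ultrafilter.mem_map]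
    refine Filter.univ_mem' fun n => ?_
    simpa [hu] using h n)
  refine ⟨(InnerProductSpace.toDual ℝ H).symm (WeakDual.toStrongDual L), fun y => ?_⟩
  have h1 : Tendsto (fun n => u n y) (hyperfilter ℕ) (𝓝 (L y)) :=
    ((WeakDual.eval_continuous y).tendsto L).comp hL
  have h2 : inner ℝ ((InnerProductSpace.toDual ℝ H).symm (WeakDual.toStrongDual L)) y = L y := by
    rw [InnerProductSpace.toDual_symm_apply]
    rfl
  rw [h2]
  exact h1

end WeakLimit

section FisherInformation

variable {d : ℕ}

theorem tendsto_integral_mollify_mul {u φ : Torus d → ℝ} (hu : Integrable u) (hφ : Continuous φ) :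
    Tendsto (fun N => ∫ x, mollify N u x * φ x) atTop (𝓝 (∫ x, u x * φ x)) := by
  obtain ⟨C, hC0, hC⟩ := exists_bound_of_continuous hφ
  simp only [integral_mollify_mul _ hu hφ]
  refine tendsto_integral_of_dominated_convergence (fun x => ‖u x‖ * C) (fun N => ?_)
    (hu.norm.mul_const C) (fun N => Eventually.of_forall fun x => ?_)
    (Eventually.of_forall fun x => (tendsto_mollify hφ x).const_mul _)
  · exact hu.aestronglyMeasurable.mul
      (continuous_mollify N (continuous_integrable hφ)).aestronglyMeasurable
  · rw [norm_mul]
    exact mul_le_mul_of_nonneg_left (norm_mollify_le N hC x) (norm_nonneg _)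

theorem integrable_of_mem_Icc {ρ : Torus d → ℝ} (hρ : AEMeasurable ρ)
    (h01 : ∀ x, ρ x ∈ Icc (0 : ℝ) 1) : Integrable ρ :=
  Integrable.of_bound hρ.aestronglyMeasurable 1 (Eventually.of_forall fun x => by
    rw [Real.norm_of_nonneg (h01 x).1]; exact (h01 x).2)

/-! #### Measures with a bounded density -/

section Density

variable {μ : FiniteMeasure (Torus d)} {ρ : Torus d → ℝ} {g : Torus d → EuclideanSpace ℝ (Fin d)}

theorem integral_of_density (hρ : Measurable ρ) (h01 : ∀ x, ρ x ∈ Icc (0 : ℝ) 1)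
    (hμ : (μ : Measure (Torus d)) = volume.withDensity fun x => ENNReal.ofReal (ρ x))
    (f : Torus d → ℝ) : ∫ x, f x ∂(μ : Measure (Torus d)) = ∫ x, f x * ρ x := by
  rw [hμ, integral_withDensity_eq_integral_toReal_smul hρ.ennreal_ofReal (by simp)]
  refine integral_congr_ae (Eventually.of_forall fun x => ?_)
  simp [ENNReal.toReal_ofReal (h01 x).1, mul_comm]

theorem convolve_of_density (hρ : Measurable ρ) (h01 : ∀ x, ρ x ∈ Icc (0 : ℝ) 1)
    (hμ : (μ : Measure (Torus d)) = volume.withDensity fun x => ENNReal.ofReal (ρ x))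
    (K : Torus d → ℝ) (x : Torus d) : convolve K μ x = ∫ y, K (x - y) • ρ y :=
  integral_of_density hρ h01 hμ fun y => K (x - y)

theorem smoothGradient_of_density (hρ : Measurable ρ) (h01 : ∀ x, ρ x ∈ Icc (0 : ℝ) 1)
    (hμ : (μ : Measure (Torus d)) = volume.withDensity fun x => ENNReal.ofReal (ρ x))
    (hg : HasWeakGradient ρ g) (N : ℕ) (x : Torus d) : smoothGradient N μ x = mollify N g x := by
  ext k
  have h1 := (hg.hasPDeriv_mollify N k).pderiv_eq
  have h2 := (hasPDeriv_integral_comp_sub (hasPDeriv_kernel (d := d) N k).1 (continuous_kernel N)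
    (hasPDeriv_kernel N k).2 hg.1).pderiv_eq
  rw [← congrFun h1 x]
  change convolve (pderiv k (kernel N)) μ x = _
  rw [convolve_of_density hρ h01 hμ, ← congrFun h2 x]
  rfl

theorem mollifiedFisher_of_density (hρ : Measurable ρ) (h01 : ∀ x, ρ x ∈ Icc (0 : ℝ) 1)
    (hμ : (μ : Measure (Torus d)) = volume.withDensity fun x => ENNReal.ofReal (ρ x))
    (hg : HasWeakGradient ρ g) (N : ℕ) : mollifiedFisher N μ =
      ∫⁻ x, sqQuot (mollify N g x) (4 * mobility (mollify N ρ x)) := by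
  refine lintegral_congr fun x => ?_
  have h1 : convolve (kernel N) μ x = mollify N ρ x := convolve_of_density hρ h01 hμ _ x
  rw [smoothGradient_of_density hρ h01 hμ hg, h1, kinetic_eq_sqQuot _ (mollify_mem_Icc N h01 x)]

theorem fisherInformation_le_of_density (hρ : Measurable ρ) (h01 : ∀ x, ρ x ∈ Icc (0 : ℝ) 1)
    (hμ : (μ : Measure (Torus d)) = volume.withDensity fun x => ENNReal.ofReal (ρ x))
    (hg : HasWeakGradient ρ g) :
    fisherInformation μ ≤ ∫⁻ x, sqQuot (g x) (4 * mobility (ρ x)) := by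
  refine iSup_le fun N => ?_
  have hm : AEMeasurable fun x => sqQuot (g x) (4 * mobility (ρ x)) :=
    hg.2.1.aemeasurable.sqQuot ((measurable_mobility.comp hρ).aemeasurable.const_mul 4)
  rw [mollifiedFisher_of_density hρ h01 hμ hg, ← lintegral_mollify N hm]
  exact lintegral_mono fun x => sqQuot_mollify_le N hg.1 hg.2.1 h01 x

/-- Mollifications converge in L¹ and the energy is lower semicontinuous. With the Jensen bound
above, the supremum over N equals the energy of the density. -/
theorem le_fisherInformation_of_density (hρ : Measurable ρ) (h01 : ∀ x, ρ x ∈ Icc (0 : ℝ) 1)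
    (hμ : (μ : Measure (Torus d)) = volume.withDensity fun x => ENNReal.ofReal (ρ x))
    (hg : HasWeakGradient ρ g) :
    ∫⁻ x, sqQuot (g x) (4 * mobility (ρ x)) ≤ fisherInformation μ := by
  have cρ : ∀ N, Continuous (mollify N ρ) := fun N => continuous_mollify N hg.1
  have cg : ∀ N, Continuous (mollify N g) := fun N => continuous_mollify N hg.2.1
  have h := lintegral_sqQuot_le_of_tendstoInMeasure (μ := (volume : Measure (Torus d)))
    (F := fun _ => 0) (c := fun _ => fisherInformation μ)
    (tendstoInMeasure_of_eLpNorm_one (fun N => (cρ N).aestronglyMeasurable)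
      hg.1.aestronglyMeasurable (tendsto_eLpNorm_mollify hg.1))
    (tendstoInMeasure_of_eLpNorm_one (fun N => (cg N).aestronglyMeasurable)
      hg.2.1.aestronglyMeasurable (tendsto_eLpNorm_mollify hg.2.1))
    (fun N => (cρ N).measurable.aemeasurable) (fun N => (cg N).measurable.aemeasurable)
    (fun N => Eventually.of_forall fun x => mollify_mem_Icc N h01 x)
    aemeasurable_const tendsto_const_nhds
    (fun N => by
      simp only [smul_zero, add_zero]
      rw [← mollifiedFisher_of_density hρ h01 hμ hg]
      exact le_iSup (fun N => mollifiedFisher N μ) N)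
  simp only [smul_zero, add_zero] at h
  exact h

end Density

/-! #### Existence of the density and of its gradient -/

variable {μ : FiniteMeasure (Torus d)}

theorem integral_convolve_mul (N : ℕ) (μ : FiniteMeasure (Torus d)) {f : Torus d → ℝ}
    (hf : Continuous f) :
    ∫ x, mollify N f x ∂(μ : Measure (Torus d)) = ∫ y, f y * convolve (kernel N) μ y := by
  simp only [mollify, convolve, smul_eq_mul, ← integral_const_mul]
  rw [integral_integral_swap]
  · refine integral_congr_ae (Eventually.of_forall fun y => ?_)
    refine integral_congr_ae (Eventually.of_forall fun x => ?_)
    simp only [kernel_sub_comm N x y, mul_comm]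
  · have hc : Continuous (Function.uncurry fun x y : Torus d => kernel N (x - y) * f y) :=
      ((continuous_kernel N).comp (continuous_fst.sub continuous_snd)).mul (hf.comp continuous_snd)
    obtain ⟨C, hC⟩ := (isCompact_univ (X := Torus d × Torus d)).exists_bound_of_continuousOn
      hc.continuousOn
    exact Integrable.of_bound hc.aestronglyMeasurable C
      (Eventually.of_forall fun q => hC q (mem_univ q))

theorem integral_le_of_convolve_mem
    (h : ∀ N, ∀ᵐ x, convolve (kernel N) μ x ∈ Icc (0 : ℝ) 1) {f : Torus d → ℝ}
    (hf : Continuous f) (hf0 : ∀ x, 0 ≤ f x) :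
    ∫ x, f x ∂(μ : Measure (Torus d)) ≤ ∫ x, f x := by
  obtain ⟨C, hC0, hC⟩ := exists_bound_of_continuous hf
  have hlim : Tendsto (fun N => ∫ x, mollify N f x ∂(μ : Measure (Torus d))) atTop
      (𝓝 (∫ x, f x ∂(μ : Measure (Torus d)))) :=
    tendsto_integral_of_dominated_convergence (fun _ => C)
      (fun N => (continuous_mollify N (continuous_integrable hf)).aestronglyMeasurable)
      (integrable_const _) (fun N => Eventually.of_forall fun x => norm_mollify_le N hC x)
      (Eventually.of_forall fun x => tendsto_mollify hf x)
  refine le_of_tendsto' hlim fun N => ?_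
  rw [integral_convolve_mul N μ hf]
  refine integral_mono_ae (continuous_integrable
    (hf.mul (continuous_convolve (continuous_kernel N) μ))) (continuous_integrable hf) ?_
  filter_upwards [h N] with x hx
  exact mul_le_of_le_one_right (hf0 x) hx.2

/-- The comparison holds for integrals of nonnegative continuous functions; it passes to closed sets
by approximating their indicators, and to measurable sets by inner regularity. -/
theorem le_volume_of_convolve_mem
    (h : ∀ N, ∀ᵐ x, convolve (kernel N) μ x ∈ Icc (0 : ℝ) 1) :
    (μ : Measure (Torus d)) ≤ volume := by
  have h1 : ∀ f : BoundedContinuousFunction (Torus d) ℝ≥0,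
      ∫⁻ x, f x ∂(μ : Measure (Torus d)) ≤ ∫⁻ x, f x := by
    intro f
    rw [← ENNReal.toReal_le_toReal
      (BoundedContinuousFunction.lintegral_lt_top_of_nnreal _ f).ne
      (BoundedContinuousFunction.lintegral_lt_top_of_nnreal _ f).ne,
      BoundedContinuousFunction.toReal_lintegral_coe_eq_integral,
      BoundedContinuousFunction.toReal_lintegral_coe_eq_integral]
    exact integral_le_of_convolve_mem h (NNReal.continuous_coe.comp f.continuous)
      fun x => NNReal.coe_nonneg _
  have h2 : ∀ F : Set (Torus d), IsClosed F → (μ : Measure (Torus d)) F ≤ volume F := fun F hF =>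
    le_of_tendsto_of_tendsto' (HasOuterApproxClosed.tendsto_lintegral_apprSeq hF _)
      (HasOuterApproxClosed.tendsto_lintegral_apprSeq hF _) fun n => h1 _
  refine Measure.le_iff.2 fun s hs => ?_
  rw [hs.measure_eq_iSup_isClosed_of_ne_top (measure_ne_top _ _)]
  exact iSup₂_le fun K hK => iSup_le fun hc => (h2 K hc).trans (measure_mono hK)

theorem exists_density_of_le_volume (h : (μ : Measure (Torus d)) ≤ volume) :
    ∃ ρ : Torus d → ℝ, Measurable ρ ∧ (∀ x, ρ x ∈ Icc (0 : ℝ) 1) ∧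
      (μ : Measure (Torus d)) = volume.withDensity fun x => ENNReal.ofReal (ρ x) := by
  set D := (μ : Measure (Torus d)).rnDeriv volume with hD
  have hm : Measurable D := Measure.measurable_rnDeriv _ _
  -- The derivative is at most 1 only almost everywhere; the minimum makes the bound hold at every
  -- point.
  refine ⟨fun x => (min (D x) 1).toReal, (hm.min measurable_const).ennreal_toReal, fun x =>
    ⟨ENNReal.toReal_nonneg, ?_⟩, ?_⟩
  · have := ENNReal.toReal_mono ENNReal.one_ne_top (min_le_right (D x) 1)
    simpa using this
  · have hle : D ≤ᵐ[volume] 1 := Measure.rnDeriv_le_one_of_le h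
    rw [← Measure.withDensity_rnDeriv_eq _ _ (Measure.absolutelyContinuous_of_le h)]
    refine withDensity_congr_ae ?_
    filter_upwards [hle] with x hx
    rw [ENNReal.ofReal_toReal (ne_top_of_le_ne_top ENNReal.one_ne_top (min_le_right _ _)),
      min_eq_left (show D x ≤ 1 from hx)]

/-- The mollified gradients are bounded in L² by the Fisher information, because |v|² ≤ `kinetic v
r`. Their weak limit is a weak gradient, since the mollified densities satisfy the integration by
parts and converge when tested. -/
theorem exists_weakGradient {ρ : Torus d → ℝ} (hρ : Measurable ρ) (h01 : ∀ x, ρ x ∈ Icc (0 : ℝ) 1)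
    (hμ : (μ : Measure (Torus d)) = volume.withDensity fun x => ENNReal.ofReal (ρ x))
    (hW : fisherInformation μ ≠ ∞) : ∃ g, HasWeakGradient ρ g := by
  have hρi : Integrable ρ := integrable_of_mem_Icc hρ.aemeasurable h01
  have cG : ∀ N k, Continuous (convolve (pderiv k (kernel N)) μ) := fun N k =>
    continuous_convolve (hasPDeriv_kernel N k).2 μ
  have hL : ∀ N k, MemLp (convolve (pderiv k (kernel N)) μ) 2 volume := fun N k => by
    obtain ⟨C, -, hC⟩ := exists_bound_of_continuous (cG N k)
    exact MemLp.of_bound (cG N k).aestronglyMeasurable C (Eventually.of_forall hC)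
  have hbound : ∀ N k, ‖(hL N k).toLp‖ ≤ (fisherInformation μ ^ (1 / 2 : ℝ)).toReal := by
    intro N k
    rw [Lp.norm_toLp]
    refine ENNReal.toReal_mono (ENNReal.rpow_ne_top_of_nonneg (by norm_num) hW) ?_
    rw [eLpNorm_eq_lintegral_rpow_enorm_toReal (by simp) (by simp)]
    simp only [ENNReal.toReal_ofNat]
    refine ENNReal.rpow_le_rpow ?_ (by norm_num)
    refine le_trans (lintegral_mono fun x => ?_) (le_iSup (fun N => mollifiedFisher N μ) N)
    refine le_trans ?_ (ofReal_sq_norm_le_kinetic _ _)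
    rw [ENNReal.rpow_ofNat, ← ofReal_norm, ← ENNReal.ofReal_pow (norm_nonneg _)]
    refine ENNReal.ofReal_le_ofReal (pow_le_pow_left₀ (norm_nonneg _) ?_ 2)
    exact norm_coord_le (smoothGradient N μ x) k
  choose g hg using fun k => exists_tendsto_inner_hyperfilter (fun N => hbound N k)
  have hgi : ∀ k, Integrable (g k) := fun k => (Lp.memLp (g k)).integrable one_le_two
  refine ⟨fun x => WithLp.toLp 2 fun k => g k x, hρi, ?_, fun φ hφ k => ?_⟩
  · have h1 : Integrable fun x => ∑ k, g k x • (EuclideanSpace.single k (1 : ℝ)) :=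
      integrable_finsetSum _ fun k _ => (hgi k).smul_const _
    refine h1.congr (Eventually.of_forall fun x => ?_)
    ext l
    simp [Pi.single_apply]
  · have cφ : Continuous φ := hφ.continuous
    obtain ⟨dφ, cdφ⟩ := hφ.hasPDeriv le_top k
    have hφL : MemLp φ 2 volume := by
      obtain ⟨C, -, hC⟩ := exists_bound_of_continuous cφ
      exact MemLp.of_bound cφ.aestronglyMeasurable C (Eventually.of_forall hC)
    have h1 := hg k hφL.toLp
    have h2 : ∀ N, inner ℝ (hL N k).toLp hφL.toLp = - ∫ x, mollify N ρ x * pderiv k φ x := by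
      intro N
      have hd : HasPDeriv k (mollify N ρ) (convolve (pderiv k (kernel N)) μ) := by
        have := hasPDeriv_integral_comp_sub (hasPDeriv_kernel (d := d) N k).1 (continuous_kernel N)
          (hasPDeriv_kernel N k).2 hρi
        refine this.congr (fun x => rfl) fun x => ?_
        exact convolve_of_density hρ h01 hμ _ x
      rw [hd.integral_mul_eq dφ (continuous_mollify N hρi) (cG N k) cφ cdφ, neg_neg, L2.inner_def]
      refine integral_congr_ae ?_
      filter_upwards [(hL N k).coeFn_toLp, hφL.coeFn_toLp] with x h3 h4
      rw [h3, h4]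
      simp [mul_comm]
    have h3 : inner ℝ (g k) hφL.toLp = ∫ x, g k x * φ x := by
      rw [L2.inner_def]
      refine integral_congr_ae ?_
      filter_upwards [hφL.coeFn_toLp] with x h4
      rw [h4]
      simp [mul_comm]
    simp only [h2, h3] at h1
    -- The limit along `atTop` is also the limit along the finer hyperfilter, so the two limits can
    -- be identified.
    have h4 := (tendsto_integral_mollify_mul hρi cdφ).neg.mono_left Nat.hyperfilter_le_atTop
    have h5 := tendsto_nhds_unique h4 h1
    linarith

theorem measurable_kinetic_convolve (N : ℕ) (μ : FiniteMeasure (Torus d)) :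
    Measurable fun x => kinetic (smoothGradient N μ x) (convolve (kernel N) μ x) := by
  have hm : WeaklyMeasurable fun _ : Unit => μ := fun f => measurable_const
  have h := (hm.kinetic_uncurry N).comp (measurable_prodMk_left (x := ()))
  exact h

/-- A measure of finite Fisher information has a density with values in the unit interval and a
weak gradient. -/
theorem exists_density_of_fisherInformation_ne_top (hd : 1 ≤ d)
    (hW : fisherInformation μ ≠ ∞) :
    ∃ (ρ : Torus d → ℝ) (g : Torus d → EuclideanSpace ℝ (Fin d)), Measurable ρ ∧
      (∀ x, ρ x ∈ Icc (0 : ℝ) 1) ∧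
      (μ : Measure (Torus d)) = (volume.withDensity fun x => ENNReal.ofReal (ρ x)) ∧
      HasWeakGradient ρ g := by
  have h1 : ∀ N, ∀ᵐ x, convolve (kernel N) μ x ∈ Icc (0 : ℝ) 1 := by
    intro N
    have hk := measurable_kinetic_convolve N μ
    have hN : mollifiedFisher N μ ≠ ∞ :=
      ne_top_of_le_ne_top hW (le_iSup (fun N => mollifiedFisher N μ) N)
    filter_upwards [ae_lt_top hk hN] with x hx
    exact mem_Icc_of_kinetic_ne_top hd hx.ne
  obtain ⟨ρ, hρ, h01, hμ⟩ := exists_density_of_le_volume (le_volume_of_convolve_mem h1)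
  obtain ⟨g, hg⟩ := exists_weakGradient hρ h01 hμ hW
  exact ⟨ρ, g, hρ, h01, hμ, hg⟩

end FisherInformation

/-! ### The measurable minorant of the rate -/

section Minorant

variable {d : ℕ}

/-- The Laplacian on the torus. -/
def laplacian (U : Torus d → ℝ) (x : Torus d) : ℝ := ∑ k, pderiv k (pderiv k U) x

theorem continuous_laplacian {U : Torus d → ℝ} (hU : TorusContDiff 2 U) :
    Continuous (laplacian U) :=
  continuous_finsetSum _ fun k _ => ((hU.torusContDiff_pderiv k).hasPDeriv le_rfl k).2

/-- Integration by parts against the gradient of a `C²` function. -/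
theorem HasWeakGradient.integral_inner_grad {ρ : Torus d → ℝ}
    {g : Torus d → EuclideanSpace ℝ (Fin d)} (h : HasWeakGradient ρ g) {U : Torus d → ℝ}
    (hU : TorusContDiff 2 U) :
    ∫ x, inner ℝ (g x) (grad U x) = - ∫ x, ρ x * laplacian U x := by
  have hd := fun k => hU.hasPDeriv (by norm_num) k
  have hdd := fun k => (hU.torusContDiff_pderiv k).hasPDeriv le_rfl k
  have key : ∀ k, ∫ x, g x k * pderiv k U x = - ∫ x, ρ x * pderiv k (pderiv k U) x := by
    intro k
    have hgk : Integrable fun x => g x k := Integrable.coord h.2.1 k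
    -- A partial derivative of U is only C¹, not an admissible test function. The identity is proved
    -- for the mollified density and passed to the limit.
    have h1 := tendsto_integral_mollify_mul hgk (hd k).2
    have h2 := (tendsto_integral_mollify_mul h.1 (hdd k).2).neg
    refine tendsto_nhds_unique h1 (h2.congr fun N => ?_)
    have h3 := h.hasPDeriv_mollify N k
    simp only [mollify_coord N h.2.1] at h3
    rw [h3.integral_mul_eq (hdd k).1 (continuous_mollify N h.1) (continuous_mollify N hgk) (hd k).2
      (hdd k).2, neg_neg]
  have hb : ∀ {u φ : Torus d → ℝ}, Integrable u → Continuous φ →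
      Integrable fun x => u x * φ x := fun hu hφ => by
    obtain ⟨C, -, hC⟩ := exists_bound_of_continuous hφ
    exact hu.mul_bdd hφ.aestronglyMeasurable (Eventually.of_forall hC)
  simp only [inner_eq_sum, laplacian, Finset.mul_sum]
  rw [integral_finsetSum _ fun k _ => ?_, integral_finsetSum _ fun k _ => hb h.1 (hdd k).2,
    ← Finset.sum_neg_distrib]
  · exact Finset.sum_congr rfl fun k _ => key k
  · exact hb (Integrable.coord h.2.1 k) (hd k).2

/-! #### The mobility term -/

/-- The integral of `h` against the mobility of the mollified measure. -/
def mollifiedMobility (N : ℕ) (h : Torus d → ℝ) (μ : FiniteMeasure (Torus d)) : ℝ≥0∞ :=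
  ∫⁻ x, ENNReal.ofReal (mobility (clamp (convolve (kernel N) μ x)) * h x)

theorem WeaklyMeasurable.mollifiedMobility {Ω : Type*} [MeasurableSpace Ω]
    {ξ : Ω → FiniteMeasure (Torus d)} (hξ : WeaklyMeasurable ξ) (N : ℕ) {h : Torus d → ℝ}
    (hh : Continuous h) : Measurable fun ω => mollifiedMobility N h (ξ ω) := by
  have h1 : Measurable fun q : Ω × Torus d =>
      ENNReal.ofReal (mobility (clamp (WASEP.convolve (kernel N) (ξ q.1) q.2)) * h q.2) :=
    ENNReal.measurable_ofReal.comp (((continuous_mobility.comp continuous_clamp).measurable.comp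
      (hξ.convolve (continuous_kernel N))).mul (hh.measurable.comp measurable_snd))
  exact h1.lintegral_prod_right'

theorem mollifiedMobility_le_const (N : ℕ) {h : Torus d → ℝ} {H : ℝ} (h0 : ∀ x, 0 ≤ h x)
    (hH : ∀ x, h x ≤ H) (μ : FiniteMeasure (Torus d)) :
    mollifiedMobility N h μ ≤ ENNReal.ofReal H := by
  have : mollifiedMobility N h μ ≤ ∫⁻ _ : Torus d, ENNReal.ofReal H := by
    refine lintegral_mono fun x => ENNReal.ofReal_le_ofReal ?_
    have h1 := mobility_nonneg (clamp_mem (convolve (kernel N) μ x))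
    have h2 := mobility_le (clamp (convolve (kernel N) μ x))
    nlinarith [h0 x, hH x]
  simpa using this

/-- The mobility is 1-Lipschitz on [0, 1]. This estimate stands in for Jensen's inequality, which
fails for the concave mobility term. -/
theorem mollifiedMobility_le_add (N : ℕ) {h : Torus d → ℝ} {H ε : ℝ}
    (h0 : ∀ x, 0 ≤ h x) (hH : ∀ x, h x ≤ H) (hε : 0 ≤ ε) {μ ν : FiniteMeasure (Torus d)}
    (hμν : ∀ x, |convolve (kernel N) μ x - convolve (kernel N) ν x| ≤ ε) :
    mollifiedMobility N h μ ≤ mollifiedMobility N h ν + ENNReal.ofReal (ε * H) := by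
  have h1 : mollifiedMobility N h ν + ENNReal.ofReal (ε * H) =
      ∫⁻ x, (ENNReal.ofReal (mobility (clamp (convolve (kernel N) ν x)) * h x)
        + ENNReal.ofReal (ε * H)) := by
    rw [lintegral_add_right _ measurable_const]
    simp [mollifiedMobility]
  rw [h1]
  refine lintegral_mono fun x => ?_
  have h2 := mobility_nonneg (clamp_mem (convolve (kernel N) ν x))
  have h3 : 0 ≤ H := (h0 x).trans (hH x)
  rw [← ENNReal.ofReal_add (mul_nonneg h2 (h0 x)) (mul_nonneg hε h3)]
  refine ENNReal.ofReal_le_ofReal ?_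
  have h4 := mobility_clamp_le (convolve (kernel N) μ x) (convolve (kernel N) ν x)
  nlinarith [hμν x, h0 x, hH x, mul_le_mul_of_nonneg_right (h4.trans (add_le_add le_rfl (hμν x)))
    (h0 x), mul_le_mul_of_nonneg_left (hH x) hε]

theorem integrable_mobility_mul {ρ h : Torus d → ℝ} (hρ : Measurable ρ)
    (h01 : ∀ x, ρ x ∈ Icc (0 : ℝ) 1) (hh : Continuous h) :
    Integrable fun x => mobility (ρ x) * h x := by
  refine (continuous_integrable hh).bdd_mul (c := 1 / 4)
    (measurable_mobility.comp hρ).aestronglyMeasurable (Eventually.of_forall fun x => ?_)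
  rw [Real.norm_of_nonneg (mobility_nonneg (h01 x))]
  exact mobility_le _

section Density

variable {μ : FiniteMeasure (Torus d)} {ρ : Torus d → ℝ}

theorem clamp_convolve_of_density (hρ : Measurable ρ) (h01 : ∀ x, ρ x ∈ Icc (0 : ℝ) 1)
    (hμ : (μ : Measure (Torus d)) = volume.withDensity fun x => ENNReal.ofReal (ρ x)) (N : ℕ)
    (x : Torus d) : clamp (convolve (kernel N) μ x) = mollify N ρ x := by
  have h1 : convolve (kernel N) μ x = mollify N ρ x := convolve_of_density hρ h01 hμ _ x
  rw [h1, clamp_of_mem (mollify_mem_Icc N h01 x)]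

/-- The Lipschitz bound and the L¹ convergence of the mollified densities. It ensures that
`lowerRate` of a profile does not exceed its true rate increased by C. -/
theorem limsup_mollifiedMobility_le {h : Torus d → ℝ} (hρ : Measurable ρ)
    (h01 : ∀ x, ρ x ∈ Icc (0 : ℝ) 1)
    (hμ : (μ : Measure (Torus d)) = volume.withDensity fun x => ENNReal.ofReal (ρ x))
    (hh : Continuous h) (h0 : ∀ x, 0 ≤ h x) :
    limsup (fun N => mollifiedMobility N h μ) atTop ≤
      ENNReal.ofReal (∫ x, mobility (ρ x) * h x) := by
  obtain ⟨H, hH0, hH⟩ := exists_bound_of_continuous hh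
  have hρi := integrable_of_mem_Icc hρ.aemeasurable h01
  have hS : ENNReal.ofReal (∫ x, mobility (ρ x) * h x) =
      ∫⁻ x, ENNReal.ofReal (mobility (ρ x) * h x) :=
    ofReal_integral_eq_lintegral_ofReal (integrable_mobility_mul hρ h01 hh)
      (Eventually.of_forall fun x => mul_nonneg (mobility_nonneg (h01 x)) (h0 x))
  have hle : ∀ N, mollifiedMobility N h μ ≤ ENNReal.ofReal (∫ x, mobility (ρ x) * h x)
      + ENNReal.ofReal H * eLpNorm (mollify N ρ - ρ) 1 volume := by
    intro N
    have hm : Measurable fun x => ‖(mollify N ρ - ρ) x‖ₑ :=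
      ((continuous_mollify N hρi).measurable.sub hρ).enorm
    rw [hS, eLpNorm_one_eq_lintegral_enorm, ← lintegral_const_mul _ hm, mollifiedMobility,
      ← lintegral_add_right _ (hm.const_mul _)]
    refine lintegral_mono fun x => ?_
    rw [clamp_convolve_of_density hρ h01 hμ, ← ofReal_norm, ← ENNReal.ofReal_mul hH0,
      ← ENNReal.ofReal_add (mul_nonneg (mobility_nonneg (h01 x)) (h0 x))
        (mul_nonneg hH0 (norm_nonneg _))]
    refine ENNReal.ofReal_le_ofReal ?_
    have h1 := mobility_clamp_le (mollify N ρ x) (ρ x)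
    rw [clamp_of_mem (mollify_mem_Icc N h01 x), clamp_of_mem (h01 x)] at h1
    have h2 := hH x
    rw [Real.norm_of_nonneg (h0 x)] at h2
    rw [Pi.sub_apply, Real.norm_eq_abs]
    nlinarith [mul_le_mul_of_nonneg_right h1 (h0 x),
      mul_le_mul_of_nonneg_right h2 (abs_nonneg (mollify N ρ x - ρ x))]
  have hlim : Tendsto (fun N => ENNReal.ofReal (∫ x, mobility (ρ x) * h x)
      + ENNReal.ofReal H * eLpNorm (mollify N ρ - ρ) 1 volume) atTop
      (𝓝 (ENNReal.ofReal (∫ x, mobility (ρ x) * h x))) := by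
    have h1 := (ENNReal.Tendsto.const_mul (a := ENNReal.ofReal H)
      (tendsto_eLpNorm_mollify hρi) (Or.inr ENNReal.ofReal_ne_top)).const_add
      (ENNReal.ofReal (∫ x, mobility (ρ x) * h x))
    simpa using h1
  rw [← hlim.limsup_eq]
  exact limsup_le_limsup (Eventually.of_forall hle)

theorem mollify_mobility_le (N : ℕ) (hρ : Measurable ρ) (h01 : ∀ x, ρ x ∈ Icc (0 : ℝ) 1)
    (x : Torus d) : mollify N (fun y => mobility (ρ y)) x ≤ mobility (mollify N ρ x) := by
  have hρi := integrable_of_mem_Icc hρ.aemeasurable h01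
  set a := mollify N ρ x with ha
  have hκ : Integrable fun y : Torus d => kernel N (x - y) :=
    continuous_integrable ((continuous_kernel N).comp (continuous_const.sub continuous_id))
  have i1 : Integrable fun y => kernel N (x - y) * ρ y :=
    integrable_comp_sub_smul (continuous_kernel N) hρi x
  have i2 : Integrable fun y => kernel N (x - y) * mobility (ρ y) := by
    have h2 := integrable_mobility_mul hρ h01 (continuous_const (y := (1 : ℝ)))
    simp only [mul_one] at h2
    exact integrable_comp_sub_smul (continuous_kernel N) h2 x
  have h1 : mollify N (fun y => mobility (ρ y)) x ≤
      ∫ y, (a ^ 2 * kernel N (x - y) + (1 - 2 * a) * (kernel N (x - y) * ρ y)) := by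
    refine integral_mono i2 ((hκ.const_mul _).add (i1.const_mul _)) fun y => ?_
    have := mul_le_mul_of_nonneg_left (mobility_le_affine a (ρ y)) (kernel_nonneg N (x - y))
    simp only [smul_eq_mul]
    linarith
  refine h1.trans (le_of_eq ?_)
  rw [integral_add (hκ.const_mul _) (i1.const_mul _), integral_const_mul, integral_const_mul,
    integral_kernel_sub]
  change a ^ 2 * 1 + (1 - 2 * a) * a = _
  unfold mobility
  ring

/-- Here concavity helps: h is replaced by its mollification, the mollification is moved onto σ(ρ),
and `mollify_mobility_le` applies. The bound holds for each single N, which makes the argument with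
finitely many cells possible. -/
theorem integral_mobility_mul_le {h : Torus d → ℝ} (hρ : Measurable ρ)
    (h01 : ∀ x, ρ x ∈ Icc (0 : ℝ) 1)
    (hμ : (μ : Measure (Torus d)) = volume.withDensity fun x => ENNReal.ofReal (ρ x))
    (hh : Continuous h) (h0 : ∀ x, 0 ≤ h x) (N : ℕ) :
    ENNReal.ofReal (∫ x, mobility (ρ x) * h x) ≤
      mollifiedMobility N h μ + eLpNorm (mollify N h - h) 1 volume := by
  have hhi := continuous_integrable hh
  have hρi := integrable_of_mem_Icc hρ.aemeasurable h01
  have hσi : Integrable fun x => mobility (ρ x) := by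
    have h2 := integrable_mobility_mul hρ h01 (continuous_const (y := (1 : ℝ)))
    simpa only [mul_one] using h2
  have i1 := integrable_mobility_mul hρ h01 hh
  have i2 := integrable_mobility_mul hρ h01 (continuous_mollify N hhi)
  have hd : ∫ x, mobility (ρ x) * h x ≤ (∫ x, mobility (mollify N ρ x) * h x)
      + ∫ x, ‖(mollify N h - h) x‖ := by
    have e1 : ∫ x, mobility (ρ x) * mollify N h x ≤ ∫ x, mobility (mollify N ρ x) * h x := by
      rw [← integral_mollify_mul N hσi hh]
      refine integral_mono ?_ ?_ fun x =>
        mul_le_mul_of_nonneg_right (mollify_mobility_le N hρ h01 x) (h0 x)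
      · exact continuous_integrable ((continuous_mollify N hσi).mul hh)
      · exact continuous_integrable
          ((continuous_mobility.comp (continuous_mollify N hρi)).mul hh)
    have e2 : ∫ x, (mobility (ρ x) * h x - mobility (ρ x) * mollify N h x) ≤
        ∫ x, ‖(mollify N h - h) x‖ := by
      refine integral_mono (i1.sub i2)
        (continuous_integrable ((continuous_mollify N hhi).sub hh).norm) fun x => ?_
      have h1 := mobility_nonneg (h01 x)
      have h2 := mobility_le (ρ x)
      simp only [Pi.sub_apply, Real.norm_eq_abs, ← mul_sub]
      have h3 := neg_abs_le (mollify N h x - h x)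
      nlinarith [abs_nonneg (mollify N h x - h x)]
    rw [integral_sub i1 i2] at e2
    linarith
  refine (ENNReal.ofReal_le_ofReal hd).trans (ENNReal.ofReal_add_le.trans (add_le_add ?_ ?_))
  · rw [ofReal_integral_eq_lintegral_ofReal]
    · refine le_of_eq (lintegral_congr fun x => ?_)
      rw [clamp_convolve_of_density hρ h01 hμ]
    · exact continuous_integrable ((continuous_mobility.comp (continuous_mollify N hρi)).mul hh)
    · exact Eventually.of_forall fun x =>
        mul_nonneg (mobility_nonneg (mollify_mem_Icc N h01 x)) (h0 x)
  · rw [eLpNorm_one_eq_lintegral_enorm, ofReal_integral_norm_eq_lintegral_enorm]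
    exact continuous_integrable ((continuous_mollify N hhi).sub hh)

end Density

/-! #### The free energy of a measure -/

/-- The free energy of a measure, normalised to be nonnegative. -/
def measureFreeEnergy (U : Torus d → ℝ) (C : ℝ) (μ : FiniteMeasure (Torus d)) : ℝ≥0∞ :=
  limsup (fun N => ENNReal.ofReal
    (freeEnergy U (fun x => clamp (convolve (kernel N) μ x)) / 2 + (C + 1))) atTop

theorem WeaklyMeasurable.measureFreeEnergy {Ω : Type*} [MeasurableSpace Ω]
    {ξ : Ω → FiniteMeasure (Torus d)} (hξ : WeaklyMeasurable ξ) {U : Torus d → ℝ}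
    (hU : Continuous U) (C : ℝ) : Measurable fun ω => measureFreeEnergy U C (ξ ω) := by
  refine Measurable.limsup fun N => ENNReal.measurable_ofReal.comp
    (Measurable.add_const (Measurable.div_const ?_ 2) _)
  have h1 : Measurable fun q : Ω × Torus d => clamp (WASEP.convolve (kernel N) (ξ q.1) q.2) :=
    continuous_clamp.measurable.comp (hξ.convolve (continuous_kernel N))
  have h2 : Measurable fun q : Ω × Torus d =>
      U q.2 * clamp (WASEP.convolve (kernel N) (ξ q.1) q.2)
        - Real.binEntropy (clamp (WASEP.convolve (kernel N) (ξ q.1) q.2)) :=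
    ((hU.measurable.comp measurable_snd).mul h1).sub
      (Real.binEntropy_continuous.measurable.comp h1)
  exact h2.stronglyMeasurable.integral_prod_right'.measurable

theorem measureFreeEnergy_le {U : Torus d → ℝ} {C : ℝ} (hC : ∀ x, ‖U x‖ ≤ C)
    (μ : FiniteMeasure (Torus d)) : measureFreeEnergy U C μ ≤ ENNReal.ofReal (2 * (C + 1)) := by
  refine limsup_le_of_le (by isBoundedDefault) (Eventually.of_forall fun N =>
    ENNReal.ofReal_le_ofReal ?_)
  have h1 := abs_le.1 (abs_freeEnergy_le hC (u := fun x => clamp (convolve (kernel N) μ x))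
    (Eventually.of_forall fun x => clamp_mem _))
  have h2 : 0 ≤ C := (norm_nonneg _).trans (hC 0)
  linarith [h1.2]

/-- On a profile the free energies of the mollifications converge. The limsup serves only to have a
measurable functional on all measures. -/
theorem measureFreeEnergy_of_density {μ : FiniteMeasure (Torus d)} {ρ : Torus d → ℝ}
    (hρ : Measurable ρ) (h01 : ∀ x, ρ x ∈ Icc (0 : ℝ) 1)
    (hμ : (μ : Measure (Torus d)) = volume.withDensity fun x => ENNReal.ofReal (ρ x))
    {U : Torus d → ℝ} (hU : Continuous U) (C : ℝ) :
    measureFreeEnergy U C μ = ENNReal.ofReal (freeEnergy U ρ / 2 + (C + 1)) := by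
  have hρi := integrable_of_mem_Icc hρ.aemeasurable h01
  have hc : ∀ N, Continuous (mollify N ρ) := fun N => continuous_mollify N hρi
  have h1 : Tendsto (fun N => freeEnergy U (mollify N ρ)) atTop (𝓝 (freeEnergy U ρ)) :=
    tendsto_freeEnergy hU (fun N => (hc N).measurable.aemeasurable)
      (fun N => Eventually.of_forall (mollify_mem_Icc N h01))
      (tendstoInMeasure_of_eLpNorm_one (fun N => (hc N).aestronglyMeasurable)
        hρi.aestronglyMeasurable (tendsto_eLpNorm_mollify hρi))
  have h2 := (ENNReal.continuous_ofReal.tendsto _).comp ((h1.div_const 2).add_const (C + 1))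
  rw [← h2.limsup_eq, measureFreeEnergy]
  refine congrArg (fun u => limsup u atTop) (funext fun N => ?_)
  simp only [Function.comp_apply]
  rw [show (fun x => clamp (convolve (kernel N) μ x)) = mollify N ρ from
    funext fun x => clamp_convolve_of_density hρ h01 hμ N x]

/-! #### The minorant -/

/-- The pairing of a measure with the drift, normalised to be nonnegative. -/
def driftTerm (U : Torus d → ℝ) (C : ℝ) (μ : FiniteMeasure (Torus d)) : ℝ≥0∞ :=
  ENNReal.ofReal (C - (∫ x, laplacian U x ∂(μ : Measure (Torus d))) / 2)

/-- A measurable substitute for the rate `∫ |∇ρ + σ(ρ) ∇U|² / (4 σ(ρ))`, increased by `C`. -/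
def lowerRate (U : Torus d → ℝ) (C : ℝ) (μ : FiniteMeasure (Torus d)) : ℝ≥0∞ :=
  fisherInformation μ + driftTerm U C μ
    + limsup (fun N => mollifiedMobility N (fun x => ‖grad U x‖ ^ 2 / 4) μ) atTop

theorem continuous_sq_norm_grad {U : Torus d → ℝ} (hU : TorusContDiff 2 U) :
    Continuous fun x => ‖grad U x‖ ^ 2 / 4 :=
  ((continuous_grad hU (by norm_num)).norm.pow 2).div_const 4

theorem WeaklyMeasurable.driftTerm {Ω : Type*} [MeasurableSpace Ω]
    {ξ : Ω → FiniteMeasure (Torus d)} (hξ : WeaklyMeasurable ξ) {U : Torus d → ℝ}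
    (hU : TorusContDiff 2 U) (C : ℝ) : Measurable fun ω => driftTerm U C (ξ ω) :=
  ENNReal.measurable_ofReal.comp
    (((hξ ⟨laplacian U, continuous_laplacian hU⟩).div_const 2).const_sub C)

theorem WeaklyMeasurable.lowerRate {Ω : Type*} [MeasurableSpace Ω]
    {ξ : Ω → FiniteMeasure (Torus d)} (hξ : WeaklyMeasurable ξ) {U : Torus d → ℝ}
    (hU : TorusContDiff 2 U) (C : ℝ) : Measurable fun ω => lowerRate U C (ξ ω) :=
  (hξ.fisherInformation.add (hξ.driftTerm hU C)).add
    (Measurable.limsup fun N => hξ.mollifiedMobility N (continuous_sq_norm_grad hU))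

section Density

variable {μ : FiniteMeasure (Torus d)} {ρ : Torus d → ℝ} {g : Torus d → EuclideanSpace ℝ (Fin d)}

/-- The rate of a profile in terms of its three contributions. -/
theorem rate_add_const_eq (hρ : Measurable ρ) (h01 : ∀ x, ρ x ∈ Icc (0 : ℝ) 1)
    (hμ : (μ : Measure (Torus d)) = volume.withDensity fun x => ENNReal.ofReal (ρ x))
    (hg : HasWeakGradient ρ g) (hE : ∫⁻ x, sqQuot (g x) (4 * mobility (ρ x)) ≠ ∞)
    {U : Torus d → ℝ} (hU : TorusContDiff 2 U) {C : ℝ} (hC : ∀ x, ‖laplacian U x‖ ≤ C)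
    (hμ1 : μ ∈ MPlus d) :
    (∫⁻ x, sqQuot (g x + mobility (ρ x) • grad U x) (4 * mobility (ρ x))) + ENNReal.ofReal C =
      (∫⁻ x, sqQuot (g x) (4 * mobility (ρ x))) + driftTerm U C μ
        + ENNReal.ofReal (∫ x, mobility (ρ x) * (‖grad U x‖ ^ 2 / 4)) := by
  have cgrad : Continuous (grad U) := continuous_grad hU (by norm_num)
  obtain ⟨Cg, -, hCg⟩ := exists_bound_of_continuous cgrad
  obtain ⟨h1, h2⟩ := lintegral_sqQuot_add hρ.aemeasurable hg.2.1.aemeasurable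
    cgrad.measurable.aemeasurable hCg (Eventually.of_forall h01) hE
  have hC0 : 0 ≤ C := (norm_nonneg _).trans (hC 0)
  have hl := abs_le.1 (abs_integral_le_of_mPlus hμ1 hC0 hC)
  have hS : 0 ≤ ∫ x, mobility (ρ x) * (‖grad U x‖ ^ 2 / 4) :=
    integral_nonneg fun x => mul_nonneg (mobility_nonneg (h01 x)) (by positivity)
  have hS' : (∫ x, mobility (ρ x) * ‖grad U x‖ ^ 2) / 4 =
      ∫ x, mobility (ρ x) * (‖grad U x‖ ^ 2 / 4) := by
    rw [← integral_div]
    simp only [mul_div_assoc]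
  -- Integration by parts makes the cross term linear in the measure, so it is defined without a
  -- gradient and is compatible with barycentres.
  have hlap : ∫ x, inner ℝ (g x) (grad U x) =
      - ∫ x, laplacian U x ∂(μ : Measure (Torus d)) := by
    rw [hg.integral_inner_grad hU, integral_of_density hρ h01 hμ]
    simp only [mul_comm]
  rw [hS', hlap] at h1 h2
  rw [h2, driftTerm, ← ENNReal.ofReal_toReal hE,
    ENNReal.toReal_ofReal ENNReal.toReal_nonneg, ← ENNReal.ofReal_add h1 hC0,
    ← ENNReal.ofReal_add ENNReal.toReal_nonneg (by linarith [hl.2]),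
    ← ENNReal.ofReal_add (add_nonneg ENNReal.toReal_nonneg (by linarith [hl.2])) hS]
  congr 1
  ring

theorem lowerRate_le_of_density (hρ : Measurable ρ) (h01 : ∀ x, ρ x ∈ Icc (0 : ℝ) 1)
    (hμ : (μ : Measure (Torus d)) = volume.withDensity fun x => ENNReal.ofReal (ρ x))
    (hg : HasWeakGradient ρ g) (hE : ∫⁻ x, sqQuot (g x) (4 * mobility (ρ x)) ≠ ∞)
    {U : Torus d → ℝ} (hU : TorusContDiff 2 U) {C : ℝ} (hC : ∀ x, ‖laplacian U x‖ ≤ C)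
    (hμ1 : μ ∈ MPlus d) :
    lowerRate U C μ ≤
      (∫⁻ x, sqQuot (g x + mobility (ρ x) • grad U x) (4 * mobility (ρ x))) + ENNReal.ofReal C := by
  rw [rate_add_const_eq hρ h01 hμ hg hE hU hC hμ1]
  exact add_le_add (add_le_add (fisherInformation_le_of_density hρ h01 hμ hg) le_rfl)
    (limsup_mollifiedMobility_le hρ h01 hμ (continuous_sq_norm_grad hU) fun x => by positivity)

end Density

/-- The rate functional is bounded by the regularised contributions. -/
theorem fisherFunctional_add_const_le (hd : 1 ≤ d) {m : ℝ} {μ : FiniteMeasure (Torus d)}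
    (hμ1 : μ ∈ MPlus d) (hm : (μ.mass : ℝ) = m) {U : Torus d → ℝ} (hU : TorusContDiff 2 U) {C : ℝ}
    (hC : ∀ x, ‖laplacian U x‖ ≤ C) (N : ℕ) :
    fisherFunctional m U μ + ENNReal.ofReal C ≤
      fisherInformation μ + driftTerm U C μ
        + (mollifiedMobility N (fun x => ‖grad U x‖ ^ 2 / 4) μ
        + eLpNorm (mollify N (fun x => ‖grad U x‖ ^ 2 / 4) - fun x => ‖grad U x‖ ^ 2 / 4) 1
          (volume : Measure (Torus d))) := by
  by_cases hW : fisherInformation μ = ∞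
  · simp [hW]
  obtain ⟨ρ, g, hρ, h01, hμ, hg⟩ := exists_density_of_fisherInformation_ne_top hd hW
  have hle := le_fisherInformation_of_density hρ h01 hμ hg
  have h1 : fisherFunctional m U μ ≤
      ∫⁻ x, sqQuot (g x + mobility (ρ x) • grad U x) (4 * mobility (ρ x)) :=
    iInf_le_of_le ρ (iInf_le_of_le g (iInf_le_of_le ⟨hm, hρ, h01, hμ, hg⟩ le_rfl))
  refine (add_le_add h1 le_rfl).trans ?_
  rw [rate_add_const_eq hρ h01 hμ hg (ne_top_of_le_ne_top hW hle) hU hC hμ1]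
  exact add_le_add (add_le_add hle le_rfl)
    (integral_mobility_mul_le hρ h01 hμ (continuous_sq_norm_grad hU) (fun x => by positivity) N)

end Minorant

/-! ### Jensen's inequality for finite convex combinations -/

section Jensen

/-- Induction on the index set: the remaining weights are renormalised by their total b. Measures
form only a module over the nonnegative reals, so nothing is subtracted. -/
theorem sum_smul_mem_and_le {F ι : Type*} [AddCommMonoid F] [Module ℝ≥0 F] {s : Set F}
    {f : F → ℝ≥0∞} (hf : ConvexOn ℝ≥0 s f) (t : Finset ι) :
    ∀ (w : ι → ℝ≥0) (x : ι → F), ∑ i ∈ t, w i = 1 → (∀ i ∈ t, x i ∈ s) →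
      ∑ i ∈ t, w i • x i ∈ s ∧ f (∑ i ∈ t, w i • x i) ≤ ∑ i ∈ t, w i • f (x i) := by
  classical
  induction t using Finset.induction_on with
  | empty => intro w x hw; simp at hw
  | insert i t hi ih =>
    intro w x hw hx
    rw [Finset.sum_insert hi] at hw
    rw [Finset.sum_insert hi, Finset.sum_insert hi]
    have hxi := hx i (Finset.mem_insert_self i t)
    have hxt : ∀ j ∈ t, x j ∈ s := fun j hj => hx j (Finset.mem_insert_of_mem hj)
    by_cases hb : ∑ j ∈ t, w j = 0
    · have hz : ∀ j ∈ t, w j = 0 := Finset.sum_eq_zero_iff.1 hb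
      have hwi : w i = 1 := by rw [← hw, hb, add_zero]
      rw [Finset.sum_eq_zero (fun j hj => by rw [hz j hj, zero_smul]),
        Finset.sum_eq_zero (fun j hj => by rw [hz j hj, zero_smul]), hwi]
      simpa using hxi
    · set b := ∑ j ∈ t, w j
      obtain ⟨h1, h2⟩ := ih (fun j => b⁻¹ * w j) x
        (by rw [← Finset.mul_sum, inv_mul_cancel₀ hb]) hxt
      have hsum : ∀ {M : Type _} [AddCommMonoid M] [Module ℝ≥0 M] (y : ι → M),
          b • ∑ j ∈ t, (b⁻¹ * w j) • y j = ∑ j ∈ t, w j • y j := by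
        intro M _ _ y
        rw [Finset.smul_sum]
        refine Finset.sum_congr rfl fun j _ => ?_
        rw [smul_smul, mul_inv_cancel_left₀ hb]
      have hs : ∑ j ∈ t, w j • f (x j) = b • ∑ j ∈ t, (b⁻¹ * w j) • f (x j) := by
        rw [Finset.smul_sum]
        refine Finset.sum_congr rfl fun j _ => ?_
        rw [smul_smul, mul_inv_cancel_left₀ hb]
      rw [← hsum x, hs]
      exact ⟨hf.1 hxi h1 zero_le zero_le hw, (hf.2 hxi h1 zero_le zero_le hw).trans
        (add_le_add le_rfl (smul_le_smul_of_nonneg_left h2 zero_le))⟩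

end Jensen

/-! ### Barycentres and partitions into small cells -/

section Barycenter

variable {d : ℕ} {Ω : Type*} [MeasurableSpace Ω] {ξ : Ω → FiniteMeasure (Torus d)}

/-- The Riesz–Markov–Kakutani theorem for the positive functional that sends f to the mean of ∫ f
dξ. -/
theorem WeaklyMeasurable.exists_isBarycenter (hξ : WeaklyMeasurable ξ) (h1 : ∀ ω, ξ ω ∈ MPlus d)
    (Q : Measure Ω) [IsProbabilityMeasure Q] : ∃ ν ∈ MPlus d, IsBarycenter Q ξ ν := by
  let L : CompactlySupportedContinuousMap (Torus d) ℝ →ₗ[ℝ] ℝ :=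
    { toFun := fun f => ∫ ω, (∫ x, f x ∂(ξ ω : Measure (Torus d))) ∂Q
      map_add' := fun f g => by
        have h : ∀ ω, ∫ x, (f + g) x ∂(ξ ω : Measure (Torus d)) =
            (∫ x, f x ∂(ξ ω : Measure (Torus d))) + ∫ x, g x ∂(ξ ω : Measure (Torus d)) :=
          fun ω => integral_add (f.integrable) (g.integrable)
        simp only [h]
        exact integral_add (hξ.integrable h1 Q f.toContinuousMap)
          (hξ.integrable h1 Q g.toContinuousMap)
      map_smul' := fun c f => by
        have h : ∀ ω, ∫ x, (c • f) x ∂(ξ ω : Measure (Torus d)) =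
            c * ∫ x, f x ∂(ξ ω : Measure (Torus d)) := fun ω => integral_const_mul c _
        simp only [h, integral_const_mul, RingHom.id_apply, smul_eq_mul] }
  have hL : ∀ f, 0 ≤ f → 0 ≤ L f := fun f hf =>
    integral_nonneg fun ω => integral_nonneg fun x => hf x
  let Λ := PositiveLinearMap.mk₀ L hL
  have hΛ : ∀ f : C(Torus d, ℝ), ∫ x, f x ∂(RealRMK.rieszMeasure Λ) =
      ∫ ω, (∫ x, f x ∂(ξ ω : Measure (Torus d))) ∂Q := fun f =>
    RealRMK.integral_rieszMeasure Λ (CompactlySupportedContinuousMap.continuousMapEquiv f)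
  refine ⟨⟨RealRMK.rieszMeasure Λ, inferInstance⟩, ?_, fun f => (hΛ f).symm⟩
  have h := hΛ 1
  simp only [ContinuousMap.one_apply, integral_const, smul_eq_mul, mul_one] at h
  change (RealRMK.rieszMeasure Λ).real univ ≤ 1
  rw [h]
  refine (integral_mono_of_nonneg (g := fun _ => (1 : ℝ))
    (Eventually.of_forall fun ω => measureReal_nonneg) (integrable_const _)
    (Eventually.of_forall fun ω => mPlus_measureReal_univ_le (h1 ω))).trans ?_
  simp

/-- The convolutions of the measures of mass at most one with a fixed continuous function form
a totally bounded set; here is a finite measurable partition into small pieces. -/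
theorem WeaklyMeasurable.exists_partition (hξ : WeaklyMeasurable ξ) (h1 : ∀ ω, ξ ω ∈ MPlus d)
    {K : Torus d → ℝ} (hK : Continuous K) {ε : ℝ} (hε : 0 < ε) :
    ∃ (n B : ℕ) (i : Ω → Fin n → Fin (B + 1)), Measurable i ∧
      ∀ ω ω', i ω = i ω' → ∀ x, |WASEP.convolve K (ξ ω) x - WASEP.convolve K (ξ ω') x| ≤ ε := by
  obtain ⟨C, hC0, hC⟩ := exists_bound_of_continuous hK
  have hε3 : 0 < ε / 3 := by positivity
  -- ε is split in three: from x to a point of a δ-net for ω, between ω and ω' at that point, and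
  -- back to x for ω'.
  obtain ⟨δ, hδ, hKδ⟩ := Metric.uniformContinuous_iff.1
    (CompactSpace.uniformContinuous_of_continuous hK) (ε / 3) hε3
  obtain ⟨s, -, hs⟩ := (isCompact_univ (X := Torus d)).elim_finite_subcover_image
    (b := univ) (c := fun x => Metric.ball x δ) (fun x _ => Metric.isOpen_ball)
    (fun x _ => mem_iUnion₂.2 ⟨x, mem_univ _, Metric.mem_ball_self hδ⟩)
  obtain ⟨hsf, hs⟩ := hs
  obtain ⟨n, y, hy⟩ : ∃ (n : ℕ) (y : Fin n → Torus d), range y = s := by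
    obtain ⟨n, e, he⟩ := hsf.fin_param
    exact ⟨n, e, he.2⟩
  have hb : ∀ ω x, |WASEP.convolve K (ξ ω) x| ≤ C := fun ω x =>
    abs_integral_le_of_mPlus (h1 ω) hC0 fun z => hC _
  -- At each net point the convolution lies in [-C, C]. The label of ω records, for each net point,
  -- which interval of length ε/3 contains the value, and B bounds the labels.
  set B : ℕ := ⌊(2 * C) / (ε / 3)⌋₊
  let v : Ω → Fin n → ℝ := fun ω l => (WASEP.convolve K (ξ ω) (y l) + C) / (ε / 3)
  have hv0 : ∀ ω l, 0 ≤ v ω l := fun ω l =>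
    div_nonneg (by linarith [(abs_le.1 (hb ω (y l))).1]) hε3.le
  have hvB : ∀ ω l, ⌊v ω l⌋₊ < B + 1 := fun ω l => Nat.lt_succ_of_le (Nat.floor_le_floor
    (div_le_div_of_nonneg_right (by linarith [(abs_le.1 (hb ω (y l))).2]) hε3.le))
  have hlip : ∀ ω x x', dist x x' < δ →
      |WASEP.convolve K (ξ ω) x - WASEP.convolve K (ξ ω) x'| ≤ ε / 3 := by
    intro ω x x' hx
    have hc : ∀ z, Continuous fun w => K (z - w) := fun z =>
      hK.comp (continuous_const.sub continuous_id)
    unfold WASEP.convolve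
    rw [← integral_sub
      ((hc x).integrable_of_hasCompactSupport (HasCompactSupport.of_compactSpace _))
      ((hc x').integrable_of_hasCompactSupport (HasCompactSupport.of_compactSpace _))]
    refine abs_integral_le_of_mPlus (h1 ω) hε3.le fun z => ?_
    have := hKδ (a := x - z) (b := x' - z) (by rwa [dist_sub_right])
    exact (Real.dist_eq _ _ ▸ this).le
  refine ⟨n, B, fun ω l => ⟨⌊v ω l⌋₊, hvB ω l⟩, ?_, ?_⟩
  · refine measurable_pi_lambda _ fun l => ?_
    have hm : Measurable fun ω => ⌊v ω l⌋₊ :=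
      Nat.measurable_floor.comp (((hξ.convolve_apply hK (y l)).add_const C).div_const _)
    refine measurable_to_countable' fun k => ?_
    have : (fun ω => (⟨⌊v ω l⌋₊, hvB ω l⟩ : Fin (B + 1))) ⁻¹' {k} =
        (fun ω => ⌊v ω l⌋₊) ⁻¹' {(k : ℕ)} := by
      ext ω
      simp [Fin.ext_iff]
    rw [this]
    exact hm (measurableSet_singleton _)
  · intro ω ω' hi x
    obtain ⟨z, hz, hxz⟩ := mem_iUnion₂.1 (hs (mem_univ x))
    rw [← hy] at hz
    obtain ⟨l, rfl⟩ := hz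
    have hfl : ⌊v ω l⌋₊ = ⌊v ω' l⌋₊ := by simpa using congrFun hi l
    have h3 : |v ω l - v ω' l| ≤ 1 := by
      have a1 := Nat.floor_le (hv0 ω l)
      have a2 := Nat.lt_floor_add_one (v ω l)
      have a3 := Nat.floor_le (hv0 ω' l)
      have a4 := Nat.lt_floor_add_one (v ω' l)
      rw [hfl] at a1 a2
      rw [abs_le]
      constructor <;> linarith
    have h4 : |WASEP.convolve K (ξ ω) (y l) - WASEP.convolve K (ξ ω') (y l)| ≤ ε / 3 := by
      have : v ω l - v ω' l =
          (WASEP.convolve K (ξ ω) (y l) - WASEP.convolve K (ξ ω') (y l)) / (ε / 3) := by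
        simp only [v]; ring
      rw [this, abs_div, abs_of_pos hε3, div_le_one hε3] at h3
      exact h3
    have h5 := abs_le.1 (hlip ω x (y l) hxz)
    have h6 := abs_le.1 (hlip ω' x (y l) hxz)
    have h7 := abs_le.1 h4
    rw [abs_le]
    constructor <;> linarith [h5.1, h5.2, h6.1, h6.2, h7.1, h7.2]

end Barycenter

/-! ### Jensen's inequality for the rate, with the concave term treated cell by cell -/

section JensenRate

variable {d : ℕ} {Ω : Type*} [MeasurableSpace Ω] {ξ : Ω → FiniteMeasure (Torus d)}
  {ν : FiniteMeasure (Torus d)}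

theorem IsBarycenter.mass_eq {Q : Measure Ω} [IsProbabilityMeasure Q] (hν : IsBarycenter Q ξ ν)
    {m : ℝ} (hm : ∀ᵐ ω ∂Q, ((ξ ω).mass : ℝ) = m) : (ν.mass : ℝ) = m := by
  have h := hν 1
  simp only [ContinuousMap.one_apply, integral_const, smul_eq_mul, mul_one] at h
  change (ν : Measure (Torus d)).real univ = m
  have hm' : (fun ω => (ξ ω : Measure (Torus d)).real univ) =ᵐ[Q] fun _ => m := hm
  rw [← h, integral_congr_ae hm']
  simp

theorem norm_laplacian_bound_nonneg {U : Torus d → ℝ} {C : ℝ} (hC : ∀ x, ‖laplacian U x‖ ≤ C) :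
    0 ≤ C := (norm_nonneg _).trans (hC 0)

theorem WeaklyMeasurable.driftTerm_le (hξ : WeaklyMeasurable ξ) (h1 : ∀ ω, ξ ω ∈ MPlus d)
    {Q : Measure Ω} [IsProbabilityMeasure Q] (hν : IsBarycenter Q ξ ν) {U : Torus d → ℝ}
    (hU : TorusContDiff 2 U) {C : ℝ} (hC : ∀ x, ‖laplacian U x‖ ≤ C) :
    WASEP.driftTerm U C ν ≤ ∫⁻ ω, WASEP.driftTerm U C (ξ ω) ∂Q := by
  let f : C(Torus d, ℝ) := ⟨laplacian U, continuous_laplacian hU⟩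
  have hC0 := norm_laplacian_bound_nonneg hC
  have hi : Integrable (fun ω => (∫ x, f x ∂(ξ ω : Measure (Torus d))) / 2) Q :=
    (hξ.integrable h1 Q f).div_const 2
  have hf : ∀ ω, |∫ x, f x ∂(ξ ω : Measure (Torus d))| ≤ C := fun ω =>
    abs_integral_le_of_mPlus (h1 ω) hC0 hC
  have h2 : C - (∫ x, laplacian U x ∂(ν : Measure (Torus d))) / 2 =
      ∫ ω, (C - (∫ x, f x ∂(ξ ω : Measure (Torus d))) / 2) ∂Q := by
    rw [integral_sub (integrable_const _) hi, integral_div, hν f]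
    simp [f]
  unfold WASEP.driftTerm
  have hi2 : Integrable (fun ω => C - (∫ x, f x ∂(ξ ω : Measure (Torus d))) / 2) Q :=
    (integrable_const _).sub hi
  rw [h2, ofReal_integral_eq_lintegral_ofReal hi2 (Eventually.of_forall fun ω => ?_)]
  · rfl
  · have := abs_le.1 (hf ω)
    simp only [Pi.zero_apply]
    linarith

/-- Jensen's inequality up to a small error for measures concentrated on a small set. -/
theorem WeaklyMeasurable.fisherFunctional_add_const_le (hd : 1 ≤ d) (hξ : WeaklyMeasurable ξ)
    (h1 : ∀ ω, ξ ω ∈ MPlus d) {Q : Measure Ω} [IsProbabilityMeasure Q]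
    (hν1 : ν ∈ MPlus d) (hν : IsBarycenter Q ξ ν) {m : ℝ}
    (hm : ∀ᵐ ω ∂Q, ((ξ ω).mass : ℝ) = m) {U : Torus d → ℝ} (hU : TorusContDiff 2 U) {C H ε : ℝ}
    (hC : ∀ x, ‖laplacian U x‖ ≤ C) (hH : ∀ x, ‖grad U x‖ ^ 2 / 4 ≤ H) (hε : 0 ≤ ε) (N : ℕ)
    (hclose : ∀ᵐ ω ∂Q, ∀ᵐ ω' ∂Q, ∀ x,
      |WASEP.convolve (kernel N) (ξ ω') x - WASEP.convolve (kernel N) (ξ ω) x| ≤ ε) :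
    fisherFunctional m U ν + ENNReal.ofReal C ≤
      (∫⁻ ω, (WASEP.fisherInformation (ξ ω) + WASEP.driftTerm U C (ξ ω)
        + WASEP.mollifiedMobility N (fun x => ‖grad U x‖ ^ 2 / 4) (ξ ω)) ∂Q)
      + (ENNReal.ofReal (ε * H)
        + eLpNorm (mollify N (fun x => ‖grad U x‖ ^ 2 / 4) - fun x => ‖grad U x‖ ^ 2 / 4) 1
          (volume : Measure (Torus d))) := by
  set h : Torus d → ℝ := fun x => ‖grad U x‖ ^ 2 / 4 with hh
  have h0 : ∀ x, 0 ≤ h x := fun x => by positivity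
  have hcont : Continuous h := continuous_sq_norm_grad hU
  have hconv : ∀ x, Integrable (fun ω => WASEP.convolve (kernel N) (ξ ω) x) Q ∧
      ∫ ω, WASEP.convolve (kernel N) (ξ ω) x ∂Q = WASEP.convolve (kernel N) ν x := fun x =>
    let f : C(Torus d, ℝ) :=
      ⟨fun y => kernel N (x - y), (continuous_kernel N).comp (continuous_const.sub continuous_id)⟩
    ⟨hξ.integrable h1 Q f, hν f⟩
  -- The convolution of ν is the mean of those of ξ, hence within ε of that of almost every ω when Q
  -- lives on one cell.
  have hS : WASEP.mollifiedMobility N h ν ≤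
      (∫⁻ ω, WASEP.mollifiedMobility N h (ξ ω) ∂Q) + ENNReal.ofReal (ε * H) := by
    have hpt : ∀ᵐ ω ∂Q, WASEP.mollifiedMobility N h ν ≤
        WASEP.mollifiedMobility N h (ξ ω) + ENNReal.ofReal (ε * H) := by
      filter_upwards [hclose] with ω hω
      refine mollifiedMobility_le_add N h0 hH hε fun x => ?_
      have hc : WASEP.convolve (kernel N) (ξ ω) x =
          ∫ _, WASEP.convolve (kernel N) (ξ ω) x ∂Q := by simp
      rw [← (hconv x).2, hc, ← integral_sub (hconv x).1 (integrable_const _)]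
      have hn := norm_integral_le_of_norm_le_const (μ := Q) (C := ε)
        (f := fun ω' => WASEP.convolve (kernel N) (ξ ω') x - WASEP.convolve (kernel N) (ξ ω) x)
        (hω.mono fun ω' hω' => hω' x)
      rwa [probReal_univ, mul_one] at hn
    calc WASEP.mollifiedMobility N h ν
      _ = ∫⁻ _, WASEP.mollifiedMobility N h ν ∂Q := by
          rw [lintegral_const, measure_univ, mul_one]
      _ ≤ ∫⁻ ω, (WASEP.mollifiedMobility N h (ξ ω) + ENNReal.ofReal (ε * H)) ∂Q :=
        lintegral_mono_ae hpt
      _ = _ := by rw [lintegral_add_right _ measurable_const, lintegral_const, measure_univ, mul_one]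
  have hF := hξ.fisherInformation_le h1 hν
  have hD := hξ.driftTerm_le h1 hν hU hC
  have mF : Measurable fun ω => WASEP.fisherInformation (ξ ω) := hξ.fisherInformation
  have mD : Measurable fun ω => WASEP.driftTerm U C (ξ ω) := hξ.driftTerm hU C
  have mFD : Measurable fun ω => WASEP.fisherInformation (ξ ω) + WASEP.driftTerm U C (ξ ω) :=
    mF.add mD
  rw [lintegral_add_left mFD, lintegral_add_left mF]
  refine (WASEP.fisherFunctional_add_const_le hd hν1 (hν.mass_eq hm) hU hC N).trans ?_
  refine (add_le_add (add_le_add hF hD) (add_le_add hS le_rfl)).trans (le_of_eq ?_)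
  ring

/-- A finite decomposition of a probability measure into conditional ones decomposes the
barycentre. -/
theorem IsBarycenter.eq_sum {ι : Type*} [Fintype ι] {P : Measure Ω} {Q : ι → Measure Ω}
    (hξ : WeaklyMeasurable ξ) (h1 : ∀ ω, ξ ω ∈ MPlus d) {w : ι → ℝ≥0}
    [∀ l, IsFiniteMeasure (Q l)] (hP : P = ∑ l, w l • Q l) (hν : IsBarycenter P ξ ν)
    {η : ι → FiniteMeasure (Torus d)} (hη : ∀ l, w l ≠ 0 → IsBarycenter (Q l) ξ (η l)) :
    ν = ∑ l, w l • η l := by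
  refine FiniteMeasure.ext_of_forall_integral_eq fun f => ?_
  have h := hν f.toContinuousMap
  have hi : ∀ l ∈ Finset.univ, Integrable
      (fun ω => ∫ x, f x ∂(ξ ω : Measure (Torus d))) (w l • Q l) := fun l _ =>
    (hξ.integrable h1 (Q l) f.toContinuousMap).smul_measure_nnreal
  have hi' : ∀ l ∈ Finset.univ, Integrable f ((w l • η l : FiniteMeasure (Torus d)) :
      Measure (Torus d)) := fun l _ =>
    f.continuous.integrable_of_hasCompactSupport (HasCompactSupport.of_compactSpace _)
  simp only [BoundedContinuousFunction.coe_toContinuousMap] at h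
  rw [← h, hP, integral_finsetSum_measure hi, FiniteMeasure.toMeasure_sum,
    integral_finsetSum_measure hi']
  refine Finset.sum_congr rfl fun l _ => ?_
  rw [FiniteMeasure.toMeasure_smul, integral_smul_nnreal_measure, integral_smul_nnreal_measure]
  by_cases hl : w l = 0
  · rw [hl, zero_smul, zero_smul]
  · exact congrArg (w l • ·) (hη l hl f.toContinuousMap)

/-- P is the combination of its conditional laws on the cells, so ν is the same combination of their
barycentres. Convexity of f is used for this finite combination only; then f ≤ `fisherFunctional m
U` at each barycentre, and Jensen's inequality up to a small error inside each cell. No regularity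
of f is needed. -/
theorem WeaklyMeasurable.convexOn_add_const_le_of_error (hd : 1 ≤ d) (hξ : WeaklyMeasurable ξ)
    (h1 : ∀ ω, ξ ω ∈ MPlus d) {P : Measure Ω} [IsProbabilityMeasure P]
    (hν1 : ν ∈ MPlus d) (hν : IsBarycenter P ξ ν) {m : ℝ}
    (hm : ∀ᵐ ω ∂P, ((ξ ω).mass : ℝ) = m) {U : Torus d → ℝ} (hU : TorusContDiff 2 U) {C H ε : ℝ}
    (hC : ∀ x, ‖laplacian U x‖ ≤ C) (hH : ∀ x, ‖grad U x‖ ^ 2 / 4 ≤ H) (hε : 0 < ε) (N : ℕ)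
    {f : FiniteMeasure (Torus d) → ℝ≥0∞} (hf : ConvexOn ℝ≥0 (MPlus d) f)
    (hfV : ∀ μ ∈ MPlus d, f μ ≤ fisherFunctional m U μ) :
    f ν + ENNReal.ofReal C ≤
      (∫⁻ ω, (WASEP.fisherInformation (ξ ω) + WASEP.driftTerm U C (ξ ω)
        + WASEP.mollifiedMobility N (fun x => ‖grad U x‖ ^ 2 / 4) (ξ ω)) ∂P)
      + (ENNReal.ofReal (ε * H)
        + eLpNorm (mollify N (fun x => ‖grad U x‖ ^ 2 / 4) - fun x => ‖grad U x‖ ^ 2 / 4) 1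
          (volume : Measure (Torus d))) := by
  classical
  obtain ⟨n, B, i, hi, hclose⟩ := hξ.exists_partition h1 (continuous_kernel N) hε
  set G : Ω → ℝ≥0∞ := fun ω => WASEP.fisherInformation (ξ ω) + WASEP.driftTerm U C (ξ ω)
        + WASEP.mollifiedMobility N (fun x => ‖grad U x‖ ^ 2 / 4) (ξ ω)
  set c : ℝ≥0∞ := ENNReal.ofReal (ε * H)
        + eLpNorm (mollify N (fun x => ‖grad U x‖ ^ 2 / 4) - fun x => ‖grad U x‖ ^ 2 / 4) 1
          (volume : Measure (Torus d))
  let w : (Fin n → Fin (B + 1)) → ℝ≥0 := fun l => (P (i ⁻¹' {l})).toNNReal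
  let Q : (Fin n → Fin (B + 1)) → Measure Ω := fun l => ProbabilityTheory.cond P (i ⁻¹' {l})
  have hw : ∀ l, (w l : ℝ≥0∞) = P (i ⁻¹' {l}) := fun l =>
    ENNReal.coe_toNNReal (measure_ne_top _ _)
  have hP : P = ∑ l, w l • Q l := by
    conv_lhs => rw [← ProbabilityTheory.sum_meas_smul_cond_fiber hi P]
    refine Finset.sum_congr rfl fun l _ => ?_
    rw [← hw l]
    rfl
  have hQ : ∀ l, w l ≠ 0 → IsProbabilityMeasure (Q l) := fun l hl =>
    ProbabilityTheory.cond_isProbabilityMeasure (by rw [← hw l]; exact_mod_cast hl)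
  have hQf : ∀ l, IsFiniteMeasure (Q l) := fun l => by
    by_cases hl : w l = 0
    · have : Q l = 0 := ProbabilityTheory.cond_eq_zero_of_meas_eq_zero
        (by rw [← hw l, hl, ENNReal.coe_zero])
      rw [this]; infer_instance
    · have := hQ l hl
      infer_instance
  have hsum : ∑ l, w l = 1 := by
    have h := congrArg (fun μ : Measure Ω => μ univ) hP
    simp only [Measure.finsetSum_apply, measure_univ, Measure.smul_apply] at h
    have h2 : ∀ l, w l • Q l univ = (w l : ℝ≥0∞) := fun l => by
      by_cases hl : w l = 0
      · simp [hl]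
      · have := hQ l hl
        rw [measure_univ, ENNReal.smul_def, smul_eq_mul, mul_one]
    rw [Finset.sum_congr rfl fun l _ => h2 l] at h
    exact_mod_cast h.symm
  -- On a null cell the weight is zero and any measure will do; ν is taken.
  have hη : ∀ l, ∃ η ∈ MPlus d, w l ≠ 0 → IsBarycenter (Q l) ξ η := fun l => by
    by_cases hl : w l = 0
    · exact ⟨ν, hν1, fun h => absurd hl h⟩
    · have := hQ l hl
      obtain ⟨η, hη, hη'⟩ := hξ.exists_isBarycenter h1 (Q l)
      exact ⟨η, hη, fun _ => hη'⟩
  choose η hη1 hη using hη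
  have hν' : ν = ∑ l, w l • η l := IsBarycenter.eq_sum hξ h1 hP hν hη
  have hcell : ∀ l, w l ≠ 0 → f (η l) + ENNReal.ofReal C ≤ (∫⁻ ω, G ω ∂(Q l)) + c := by
    intro l hl
    have := hQ l hl
    have hmem : ∀ᵐ ω ∂(Q l), i ω = l :=
      ProbabilityTheory.ae_cond_mem (hi (measurableSet_singleton l))
    refine (add_le_add (hfV _ (hη1 l)) le_rfl).trans
      (hξ.fisherFunctional_add_const_le hd h1 (hη1 l) (hη l hl)
        (ProbabilityTheory.cond_absolutelyContinuous.ae_le hm) hU hC hH hε.le N ?_)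
    filter_upwards [hmem] with ω hω
    filter_upwards [hmem] with ω' hω'
    exact hclose ω' ω (hω'.trans hω.symm)
  have hconst : ∀ a : ℝ≥0∞, ∑ l, w l • a = a := fun a => by
    rw [← Finset.sum_smul, hsum, one_smul]
  calc f ν + ENNReal.ofReal C
      ≤ (∑ l, w l • f (η l)) + ∑ l, w l • ENNReal.ofReal C := by
        rw [hconst, hν']
        exact add_le_add (sum_smul_mem_and_le hf Finset.univ w η hsum fun l _ => hη1 l).2 le_rfl
    _ = ∑ l, w l • (f (η l) + ENNReal.ofReal C) := by
        rw [← Finset.sum_add_distrib]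
        simp only [smul_add]
    _ ≤ ∑ l, w l • ((∫⁻ ω, G ω ∂(Q l)) + c) := by
        refine Finset.sum_le_sum fun l _ => ?_
        by_cases hl : w l = 0
        · simp [hl]
        · exact smul_le_smul_of_nonneg_left (hcell l hl) zero_le
    _ = (∫⁻ ω, G ω ∂P) + c := by
        simp only [smul_add]
        rw [Finset.sum_add_distrib, hconst]
        congr 1
        conv_rhs => rw [hP]
        rw [lintegral_finsetSum_measure]
        exact Finset.sum_congr rfl fun l _ => (lintegral_smul_measure _ _).symm

/-- Jensen's inequality: a convex function below the Fisher functional is dominated on the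
barycentre by the mean of the lower rate. -/
theorem WeaklyMeasurable.convexOn_add_const_le (hd : 1 ≤ d) (hξ : WeaklyMeasurable ξ)
    (h1 : ∀ ω, ξ ω ∈ MPlus d) {P : Measure Ω} [IsProbabilityMeasure P]
    (hν1 : ν ∈ MPlus d) (hν : IsBarycenter P ξ ν) {m : ℝ}
    (hm : ∀ᵐ ω ∂P, ((ξ ω).mass : ℝ) = m) {U : Torus d → ℝ} (hU : TorusContDiff 2 U) {C : ℝ}
    (hC : ∀ x, ‖laplacian U x‖ ≤ C)
    {f : FiniteMeasure (Torus d) → ℝ≥0∞} (hf : ConvexOn ℝ≥0 (MPlus d) f)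
    (hfV : ∀ μ ∈ MPlus d, f μ ≤ fisherFunctional m U μ) :
    f ν + ENNReal.ofReal C ≤ ∫⁻ ω, WASEP.lowerRate U C (ξ ω) ∂P := by
  have hcont := continuous_sq_norm_grad hU
  obtain ⟨H, hH0, hH⟩ := exists_bound_of_continuous hcont
  have hH' : ∀ x, ‖grad U x‖ ^ 2 / 4 ≤ H := fun x => (le_abs_self _).trans (hH x)
  have h0 : ∀ x, 0 ≤ ‖grad U x‖ ^ 2 / 4 := fun x => by positivity
  have mFD : Measurable fun ω => WASEP.fisherInformation (ξ ω) + WASEP.driftTerm U C (ξ ω) :=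
    hξ.fisherInformation.add (hξ.driftTerm hU C)
  set S : ℕ → Ω → ℝ≥0∞ := fun N ω =>
    WASEP.mollifiedMobility N (fun x => ‖grad U x‖ ^ 2 / 4) (ξ ω)
  set e : ℕ → ℝ≥0∞ := fun N =>
    eLpNorm (mollify N (fun x => ‖grad U x‖ ^ 2 / 4) - fun x => ‖grad U x‖ ^ 2 / 4) 1
          (volume : Measure (Torus d))
  set X : ℝ≥0∞ := ∫⁻ ω, (WASEP.fisherInformation (ξ ω) + WASEP.driftTerm U C (ξ ω)) ∂P
  have he : Tendsto e atTop (𝓝 0) := tendsto_eLpNorm_mollify (continuous_integrable hcont)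
  have mS : ∀ N, Measurable (S N) := fun N => hξ.mollifiedMobility N hcont
  have hSH : ∀ N ω, S N ω ≤ ENNReal.ofReal H := fun N ω => mollifiedMobility_le_const N h0 hH' _
  -- Reverse Fatou with the constant H as a dominating function. It produces one large N for which
  -- the mean mobility term is close to that in `lowerRate`.
  have hfatou : limsup (fun N => ∫⁻ ω, S N ω ∂P) atTop ≤ ∫⁻ ω, limsup (fun N => S N ω) atTop ∂P :=
    limsup_lintegral_le (fun _ => ENNReal.ofReal H) mS
      (fun N => Eventually.of_forall (hSH N)) (by simp)
  have hlim : ∫⁻ ω, limsup (fun N => S N ω) atTop ∂P ≠ ∞ := by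
    refine ne_top_of_le_ne_top (b := ∫⁻ _, ENNReal.ofReal H ∂P) (by simp)
      (lintegral_mono fun ω => ?_)
    exact limsup_le_of_le (by isBoundedDefault) (Eventually.of_forall fun N => hSH N ω)
  have hrate : ∫⁻ ω, WASEP.lowerRate U C (ξ ω) ∂P =
      X + ∫⁻ ω, limsup (fun N => S N ω) atTop ∂P := lintegral_add_left mFD _
  rw [hrate]
  refine ENNReal.le_of_forall_pos_le_add fun δ hδ _ => ?_
  have hδ3 : (0 : ℝ≥0∞) < (δ / 3 : ℝ≥0) := by
    have : 0 < δ / 3 := by positivity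
    exact_mod_cast this
  have ev1 : ∀ᶠ N in atTop, ∫⁻ ω, S N ω ∂P <
      (∫⁻ ω, limsup (fun N => S N ω) atTop ∂P) + (δ / 3 : ℝ≥0) :=
    eventually_lt_of_limsup_lt (hfatou.trans_lt (ENNReal.lt_add_right hlim hδ3.ne'))
  have ev2 : ∀ᶠ N in atTop, e N < (δ / 3 : ℝ≥0) := he.eventually_lt_const hδ3
  obtain ⟨N, hN1, hN2⟩ := (ev1.and ev2).exists
  -- Three errors of size δ/3: the gap in reverse Fatou, the mollification error e N, and H times
  -- the cell size chosen here. H + 1 avoids dividing by zero.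
  have hε : 0 < (δ / 3 : ℝ) / (H + 1) := by positivity
  have hεH : ENNReal.ofReal ((δ / 3 : ℝ) / (H + 1) * H) ≤ (δ / 3 : ℝ≥0) := by
    rw [← ENNReal.ofReal_coe_nnreal]
    refine ENNReal.ofReal_le_ofReal ?_
    rw [div_mul_eq_mul_div, div_le_iff₀ (by positivity)]
    push_cast
    have : (0 : ℝ) ≤ δ / 3 := by positivity
    nlinarith
  have h := hξ.convexOn_add_const_le_of_error hd h1 hν1 hν hm hU hC hH' hε N hf hfV
  rw [lintegral_add_left mFD] at h
  have hδsum : ((δ / 3 : ℝ≥0) : ℝ≥0∞) + ((δ / 3 : ℝ≥0) + (δ / 3 : ℝ≥0)) = δ := by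
    rw [← ENNReal.coe_add, ← ENNReal.coe_add]
    congr 1
    ring
  calc f ν + ENNReal.ofReal C ≤ _ := h
    _ ≤ X + ((∫⁻ ω, limsup (fun N => S N ω) atTop ∂P) + (δ / 3 : ℝ≥0))
        + (((δ / 3 : ℝ≥0) : ℝ≥0∞) + (δ / 3 : ℝ≥0)) :=
      add_le_add (add_le_add le_rfl hN1.le) (add_le_add hεH hN2.le)
    _ = X + (∫⁻ ω, limsup (fun N => S N ω) atTop ∂P) + δ := by
      rw [← hδsum]
      ring

end JensenRate

/-! ### Stationarity and the lower bound for the level-one rate -/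

section LowerBound

variable {d : ℕ} {p m : ℝ}

theorem weaklyMeasurable_dens (t : ℝ) :
    WeaklyMeasurable fun z : PathSpace d p => (z.dens t : FiniteMeasure (Torus d)) :=
  fun f => measurable_integral_dens f t

theorem weaklyMeasurable_dens_uncurry :
    WeaklyMeasurable fun q : ℝ × PathSpace d p => (q.2.dens q.1 : FiniteMeasure (Torus d)) :=
  fun f => measurable_integral_dens_uncurry f

/-- Under a stationary measure the law of the density does not depend on time. -/
theorem lintegral_dens_eq {P : ProbabilityMeasure (PathSpace d p)} (hP : P ∈ stationary d p)
    {G : FiniteMeasure (Torus d) → ℝ≥0∞}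
    (hG : Measurable fun z : PathSpace d p => G (z.dens 0)) (t : ℝ) :
    ∫⁻ z : PathSpace d p, G (z.dens t) ∂(P : Measure (PathSpace d p)) =
      ∫⁻ z : PathSpace d p, G (z.dens 0) ∂(P : Measure (PathSpace d p)) := by
  -- The shift by -t brings the value at time t to time 0.
  rw [← (hP (-t)).lintegral_comp hG]
  refine lintegral_congr fun z => ?_
  simp [timeShift, Cadlag.shift]

variable {U : Torus d → ℝ} {E : Torus d → EuclideanSpace ℝ (Fin d)} {T C C' : ℝ}

/-- At almost every time the slice has finite energy and a weak gradient, so its `lowerRate` is at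
most its rate plus C; the pathwise entropy inequality does the rest. Apart from the action, only
weakly measurable functionals of the density path remain. -/
theorem HasDensities.lintegral_lowerRate_le {z : PathSpace d p} {ρ : ℝ → Torus d → ℝ}
    {g j : ℝ → Torus d → EuclideanSpace ℝ (Fin d)} (h : HasDensities m z ρ g j) (hT : 0 < T)
    (hU : TorusContDiff 2 U) (hE : ∀ x, E x = -grad U x) (hC : ∀ x, ‖laplacian U x‖ ≤ C)
    (hC' : ∀ x, ‖U x‖ ≤ C') :
    (∫⁻ t in Icc 0 T, lowerRate U C (z.dens t)) + measureFreeEnergy U C' (z.dens T) ≤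
      (∫⁻ t in Icc 0 T, ∫⁻ x,
        sqQuot (j t x + g t x - mobility (ρ t x) • E x) (4 * mobility (ρ t x)))
      + ENNReal.ofReal T * ENNReal.ofReal C + measureFreeEnergy U C' (z.dens 0) := by
  have hUc : Continuous U := hU.continuous
  have mρ : ∀ t, Measurable (ρ t) := fun t => h.measurable_density.of_uncurry_left
  have mρ' : Measurable fun q : ℝ × Torus d => ρ q.1 q.2 := h.measurable_density
  have mg : Measurable fun q : ℝ × Torus d => g q.1 q.2 := h.measurable_gradient
  have mσ : Measurable fun q : ℝ × Torus d => 4 * mobility (ρ q.1 q.2) :=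
    (measurable_mobility.comp mρ').const_mul 4
  have mE : Measurable fun q : ℝ × Torus d =>
      sqQuot (g q.1 q.2) (4 * mobility (ρ q.1 q.2)) := mg.sqQuot mσ
  have hfin : ∀ᵐ t ∂(volume.restrict (Icc 0 T)),
      ∫⁻ x, sqQuot (g t x) (4 * mobility (ρ t x)) < ∞ := by
    have h1 := (h.energy_ne_top hT).1
    rw [lintegral_prod _ mE.aemeasurable] at h1
    exact ae_lt_top mE.lintegral_prod_right' h1
  have hle : ∫⁻ t in Icc 0 T, lowerRate U C (z.dens t) ≤
      (∫⁻ t in Icc 0 T, ∫⁻ x, sqQuot (g t x + mobility (ρ t x) • grad U x) (4 * mobility (ρ t x)))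
        + ENNReal.ofReal T * ENNReal.ofReal C := by
    have hc : ENNReal.ofReal T * ENNReal.ofReal C = ∫⁻ _ in Icc 0 T, ENNReal.ofReal C := by
      rw [setLIntegral_const, Real.volume_Icc, sub_zero, mul_comm]
    rw [hc, ← lintegral_add_right _ measurable_const]
    refine lintegral_mono_ae ?_
    filter_upwards [hfin, ae_restrict_of_ae h.weak_gradient] with t ht hg
    exact lowerRate_le_of_density (mρ t) (h.density_mem t) (h.dens_eq t) hg ht.ne hU hC
      (z.dens t).2
  rw [measureFreeEnergy_of_density (mρ T) (h.density_mem T) (h.dens_eq T) hUc,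
    measureFreeEnergy_of_density (mρ 0) (h.density_mem 0) (h.dens_eq 0) hUc]
  have h3 := add_le_add_right (h.fisher_add_freeEnergy_le hT hU hE hC')
    (ENNReal.ofReal T * ENNReal.ofReal C)
  refine (add_le_add hle le_rfl).trans (le_trans (le_of_eq ?_) (h3.trans (le_of_eq ?_))) <;> ring

/-- A path without densities has action ∞, so the bound holds for every path and can be integrated.
-/
theorem lintegral_lowerRate_add_le_action (z : PathSpace d p) (hT : 0 < T)
    (hU : TorusContDiff 2 U) (hE : ∀ x, E x = -grad U x) (hC : ∀ x, ‖laplacian U x‖ ≤ C)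
    (hC' : ∀ x, ‖U x‖ ≤ C') :
    (∫⁻ t in Icc 0 T, lowerRate U C (z.dens t)) + measureFreeEnergy U C' (z.dens T) ≤
      action m T E z + ENNReal.ofReal T * ENNReal.ofReal C
        + measureFreeEnergy U C' (z.dens 0) := by
  simp only [action, ENNReal.iInf_add]
  exact le_iInf fun ρ => le_iInf fun g => le_iInf fun j => le_iInf fun h =>
    h.lintegral_lowerRate_le hT hU hE hC hC'

/-- Under a stationary measure the mean lower rate is at most the mean action per unit time. -/
theorem lintegral_lowerRate_le_lintegral_action {P : ProbabilityMeasure (PathSpace d p)}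
    (hP : P ∈ stationary d p) (hT : 0 < T) (hU : TorusContDiff 2 U)
    (hE : ∀ x, E x = -grad U x) (hC : ∀ x, ‖laplacian U x‖ ≤ C) :
    ENNReal.ofReal T * ∫⁻ z : PathSpace d p, lowerRate U C (z.dens 0)
        ∂(P : Measure (PathSpace d p)) ≤
      (∫⁻ z, action m T E z ∂(P : Measure (PathSpace d p)))
        + ENNReal.ofReal T * ENNReal.ofReal C := by
  have hUc : Continuous U := hU.continuous
  obtain ⟨C', -, hC'⟩ := exists_bound_of_continuous hUc
  have mM : ∀ t, Measurable fun z : PathSpace d p => measureFreeEnergy U C' (z.dens t) :=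
    fun t => (weaklyMeasurable_dens t).measureFreeEnergy hUc C'
  have mL : Measurable fun q : ℝ × PathSpace d p => lowerRate U C (q.2.dens q.1) :=
    weaklyMeasurable_dens_uncurry.lowerRate hU C
  have mL0 : Measurable fun z : PathSpace d p => lowerRate U C (z.dens 0) :=
    (weaklyMeasurable_dens 0).lowerRate hU C
  -- Monotonicity asks for no measurability, and the sums are split using measurability of the
  -- summands other than the action.
  have h := lintegral_mono (μ := (P : Measure (PathSpace d p)))
    fun z : PathSpace d p => lintegral_lowerRate_add_le_action (m := m) z hT hU hE hC hC'
  rw [lintegral_add_right _ (mM T), lintegral_add_right _ (mM 0),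
    lintegral_dens_eq hP (mM 0) T] at h
  have hfin : ∫⁻ z : PathSpace d p, measureFreeEnergy U C' (z.dens 0)
      ∂(P : Measure (PathSpace d p)) ≠ ∞ := by
    refine ne_top_of_le_ne_top (b := ∫⁻ _, ENNReal.ofReal (2 * (C' + 1))
      ∂(P : Measure (PathSpace d p)))
      (by rw [lintegral_const, measure_univ, mul_one]; exact ENNReal.ofReal_ne_top)
      (lintegral_mono fun z => ?_)
    exact measureFreeEnergy_le hC' _
  -- By stationarity the free energies at times T and 0 have the same mean; it is finite, so it
  -- cancels.
  rw [ENNReal.add_le_add_iff_right hfin, lintegral_add_right _ measurable_const,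
    lintegral_const, measure_univ, mul_one] at h
  refine le_trans (le_of_eq ?_) h
  have mL' : Measurable (Function.uncurry
      fun (z : PathSpace d p) (t : ℝ) => lowerRate U C (z.dens t)) := by
    have h' := mL.comp (measurable_swap (α := PathSpace d p) (β := ℝ))
    exact h'
  rw [lintegral_lintegral_swap mL'.aemeasurable,
    lintegral_congr fun t => lintegral_dens_eq hP mL0 t, setLIntegral_const, Real.volume_Icc,
    sub_zero, mul_comm]

theorem convexHullFun_le_levelOneDensityRate (hd : 1 ≤ d) (hT : 0 < T) (hU : TorusContDiff 2 U)
    (hE : ∀ x, E x = -grad U x) {μ : FiniteMeasure (Torus d)} (hμ : μ ∈ MPlus d) :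
    convexHullFun (MPlus d) (fisherFunctional m U) μ ≤ levelOneDensityRate p m T E μ := by
  obtain ⟨C, hC0, hC⟩ := exists_bound_of_continuous (continuous_laplacian hU)
  refine iSup₂_le fun f hf => le_iInf₂ fun P hP => ?_
  obtain ⟨⟨hPs, hPm⟩, hPμ⟩ := hP
  have h1 := (weaklyMeasurable_dens (p := p) 0).convexOn_add_const_le hd (fun z => (z.dens 0).2)
    hμ (hPμ 0) (hPm.mono fun z hz => hz 0) hU hC hf.1 hf.2
  have h2 := (mul_le_mul_right h1 (ENNReal.ofReal T)).trans
    (lintegral_lowerRate_le_lintegral_action (m := m) hPs hT hU hE hC)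
  rw [mul_add, ENNReal.add_le_add_iff_right
    (ENNReal.mul_ne_top ENNReal.ofReal_ne_top ENNReal.ofReal_ne_top)] at h2
  exact (ENNReal.mul_le_iff_le_inv (ENNReal.ofReal_pos.2 hT).ne' ENNReal.ofReal_ne_top).1 h2

end LowerBound

/-! ### Constant paths and the bound by the Fisher functional -/

section ConstantPath

variable {d : ℕ} {p m T : ℝ}

theorem pairing_zero {q : ℝ} (F : Torus d → EuclideanSpace ℝ (Fin d)) :
    pairing (0 : SobolevField d q) F = 0 := by
  have h : ∀ (n : Fin d → ℤ) k, (0 : SobolevField d q) n k = 0 := fun n k => by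
    rw [sobolevField_zero_apply]; rfl
  simp only [pairing, h, zero_mul, Finset.sum_const_zero, tsum_zero]

/-- The constant right-continuous path. -/
def Cadlag.const {S : Type*} [TopologicalSpace S] (c : S) : Cadlag S where
  toFun _ := c
  right_cont _ := continuousWithinAt_const
  left_lim _ := ⟨c, tendsto_const_nhds⟩

/-- The path with constant density and vanishing current. -/
def constPath (p : ℝ) (μ : MPlus d) : PathSpace d p where
  dens := Cadlag.const μ
  curr := Cadlag.const 0
  continuity_eq s t _ f _ := by
    simp [Cadlag.const, pairing_zero]

theorem timeShift_constPath (t : ℝ) (μ : MPlus d) :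
    timeShift t (constPath p μ) = constPath p μ := by
  simp [timeShift, constPath, Cadlag.const, Cadlag.shift, Cadlag.subConst]

/-- The Dirac mass at the constant path. -/
def constLaw (p : ℝ) (μ : MPlus d) : ProbabilityMeasure (PathSpace d p) :=
  ⟨Measure.dirac (constPath p μ), inferInstance⟩

/-- By right-continuity the mass at rational times determines it at all times. Measurability lets
the almost-sure statement be checked under a Dirac mass. -/
theorem exists_measurableSet_subset_massPaths :
    ∃ A : Set (PathSpace d p), MeasurableSet A ∧ A ⊆ massPaths d p m ∧ massPaths d p m ⊆ A := by
  have hmass : ∀ μ : MPlus d, ((μ : FiniteMeasure (Torus d)).mass : ℝ) = MPlus.integral 1 μ := by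
    intro μ
    simp only [MPlus.integral, ContinuousMap.one_apply, integral_const, smul_eq_mul, mul_one]
    rfl
  refine ⟨⋂ q : ℚ, {z | MPlus.integral 1 (z.dens q) = m}, MeasurableSet.iInter fun q =>
    measurable_integral_dens 1 q (measurableSet_singleton m), fun z hz t => ?_, fun z hz => ?_⟩
  · rw [hmass]
    have hr : Tendsto (fun s => MPlus.integral 1 (z.dens s)) (𝓝[>] t)
        (𝓝 (MPlus.integral 1 (z.dens t))) :=
      ((MPlus.uniformContinuous_integral 1).continuous.tendsto _).comp
        ((z.dens.right_cont t).mono Ioi_subset_Ici_self)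
    have hf : ∃ᶠ s in 𝓝[>] t, MPlus.integral 1 (z.dens s) = m := by
      rw [frequently_nhdsWithin_iff, frequently_iff]
      intro V hV
      obtain ⟨ε, hε, hV'⟩ := Metric.mem_nhds_iff.1 hV
      obtain ⟨q, hq1, hq2⟩ := exists_rat_btwn (show t < t + ε by linarith)
      refine ⟨q, hV' ?_, mem_iInter.1 hz q, hq1⟩
      rw [Metric.mem_ball, Real.dist_eq, abs_lt]
      constructor <;> linarith
    by_contra hne
    exact hf (hr.eventually_ne hne)
  · exact mem_iInter.2 fun q => (hmass _).symm.trans (hz q)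

theorem constLaw_mem_stationaryMass {μ : MPlus d}
    (hm : ((μ : FiniteMeasure (Torus d)).mass : ℝ) = m) :
    constLaw p μ ∈ stationaryMass d p m := by
  refine ⟨fun t => ⟨measurable_timeShift t, ?_⟩, ?_⟩
  · change Measure.map (timeShift t) (Measure.dirac (constPath p μ)) = Measure.dirac _
    rw [Measure.map_dirac' (measurable_timeShift t), timeShift_constPath]
  · obtain ⟨A, hA, hsub, hsup⟩ := exists_measurableSet_subset_massPaths (d := d) (p := p) (m := m)
    have h : ∀ᵐ z ∂(Measure.dirac (constPath p μ)), z ∈ A :=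
      (ae_dirac_iff hA).2 (hsup fun _ => hm)
    exact h.mono fun z hz => hsub hz

theorem hasMeanDensity_constLaw (μ : MPlus d) : HasMeanDensity (constLaw p μ) μ := fun t f =>
  integral_dirac' _ _ (measurable_integral_dens f t).stronglyMeasurable

/-- The function need not be measurable, as is the case when this is applied to the action; its
integral is that of a measurable minorant, which gives the inequality. -/
theorem lintegral_dirac_le {α : Type*} [MeasurableSpace α] (f : α → ℝ≥0∞) (a : α) :
    ∫⁻ x, f x ∂(Measure.dirac a) ≤ f a := by
  obtain ⟨g, hg, hgf, h⟩ := exists_measurable_le_lintegral_eq (Measure.dirac a) f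
  rw [h, lintegral_dirac' a hg]
  exact hgf a

/-- Write v = (v + σu) - σu and apply `sqQuot_add_le` with b = σ/4. The factor 16 turns σ/4 into 4σ,
and 4σ ≤ 1 bounds the second term. Thus a finite rate implies finite energy of ∇ρ alone, as
`HasDensities` demands. -/
theorem sqQuot_mobility_le (v u : EuclideanSpace ℝ (Fin d)) {r : ℝ} (hr : r ∈ Icc (0 : ℝ) 1) :
    sqQuot v (mobility r) ≤
      16 * sqQuot (v + mobility r • u) (4 * mobility r) + ENNReal.ofReal (‖u‖ ^ 2) := by
  have h0 : 0 ≤ mobility r := mobility_nonneg hr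
  have h1 : mobility r ≤ 1 / 4 := by
    unfold mobility
    nlinarith [sq_nonneg (r - 1 / 2)]
  have h := sqQuot_add_le (v + mobility r • u) (-(mobility r • u))
    (b := mobility r / 4) (by positivity)
  rw [add_neg_cancel_right, mul_div_cancel₀ _ (four_ne_zero' ℝ)] at h
  refine h.trans (add_le_add ?_ ?_)
  · unfold sqQuot
    have h2 : ENNReal.ofReal (4 * mobility r) = 16 * ENNReal.ofReal (mobility r / 4) := by
      rw [← ENNReal.ofReal_ofNat, ← ENNReal.ofReal_mul (by norm_num)]
      congr 1
      ring
    rw [h2, ENNReal.div_eq_inv_mul, ENNReal.div_eq_inv_mul,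
      ENNReal.mul_inv (Or.inl (by norm_num)) (Or.inl (by norm_num)), mul_assoc, ← mul_assoc,
      ENNReal.mul_inv_cancel (by norm_num) (by norm_num), one_mul]
  · unfold sqQuot
    refine ENNReal.div_le_of_le_mul ?_
    rw [← ENNReal.ofReal_mul (by positivity), norm_neg, norm_smul, Real.norm_of_nonneg h0]
    refine ENNReal.ofReal_le_ofReal ?_
    nlinarith [mul_nonneg (mul_nonneg h0 (sub_nonneg.2 h1)) (sq_nonneg ‖u‖)]

theorem HasWeakGradient.congr_gradient {ρ : Torus d → ℝ} {g g' : Torus d → EuclideanSpace ℝ (Fin d)}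
    (h : HasWeakGradient ρ g) (hg : g =ᵐ[volume] g') : HasWeakGradient ρ g' := by
  refine ⟨h.1, h.2.1.congr hg, fun φ hφ k => ?_⟩
  rw [h.2.2 φ hφ k]
  congr 1
  refine integral_congr_ae ?_
  filter_upwards [hg] with x hx
  rw [hx]

theorem hasDensities_constPath {μ : MPlus d} {ρ : Torus d → ℝ}
    {g : Torus d → EuclideanSpace ℝ (Fin d)} (h : HasProfile m μ ρ g) (hg : Measurable g)
    {U : Torus d → ℝ} (hU : Continuous (grad U))
    (hE : ∫⁻ x, sqQuot (g x + mobility (ρ x) • grad U x) (4 * mobility (ρ x)) ≠ ∞) :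
    HasDensities m (constPath p μ) (fun _ => ρ) (fun _ => g) fun _ _ => 0 where
  mass_eq _ := h.1
  measurable_density := h.2.1.comp measurable_snd
  measurable_gradient := hg.comp measurable_snd
  measurable_current := measurable_const
  continuous_dens := continuous_const
  density_mem _ := h.2.2.1
  dens_eq _ := h.2.2.2.1
  weak_gradient := Eventually.of_forall fun _ => h.2.2.2.2
  gradient_energy S _ := by
    obtain ⟨C, -, hC⟩ := exists_bound_of_continuous hU
    have h1 : ∫⁻ x, sqQuot (g x) (mobility (ρ x)) ≤
        ∫⁻ x, (16 * sqQuot (g x + mobility (ρ x) • grad U x) (4 * mobility (ρ x))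
          + ENNReal.ofReal (C ^ 2)) :=
      lintegral_mono fun x => (sqQuot_mobility_le (g x) (grad U x) (h.2.2.1 x)).trans
        (add_le_add le_rfl (ENNReal.ofReal_le_ofReal
          (pow_le_pow_left₀ (norm_nonneg _) (hC x) 2)))
    rw [lintegral_add_right _ measurable_const, lintegral_const_mul' _ _ (by norm_num),
      lintegral_const, measure_univ, mul_one] at h1
    rw [setLIntegral_const, Real.volume_Icc]
    exact ENNReal.mul_lt_top (h1.trans_lt (ENNReal.add_lt_top.2
      ⟨ENNReal.mul_lt_top (by norm_num) hE.lt_top, ENNReal.ofReal_lt_top⟩)) ENNReal.ofReal_lt_top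
  continuous_curr := continuous_const
  curr_eq t n k := by
    have h0 : (0 : SobolevField d (-p)) n k = 0 := by rw [sobolevField_zero_apply]; rfl
    have h1 : (constPath p μ).curr t n k = 0 := h0
    simp [h1, torusFourierCoeff]
  current_energy S _ := by
    simp [sqQuot]

/-- The competitor is the Dirac mass at the constant path with zero current: with j = 0 and E = -∇U
the integrand of the action is that of the Fisher functional at every time. -/
theorem levelOneDensityRate_le_fisherFunctional (hT : 0 < T) {U : Torus d → ℝ}
    (hU : TorusContDiff 2 U) {E : Torus d → EuclideanSpace ℝ (Fin d)}
    (hE : ∀ x, E x = -grad U x) {μ : FiniteMeasure (Torus d)} (hμ : μ ∈ MPlus d) :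
    levelOneDensityRate p m T E μ ≤ fisherFunctional m U μ := by
  refine le_iInf fun ρ => le_iInf fun g => le_iInf fun h => ?_
  by_cases hfin : ∫⁻ x, sqQuot (g x + mobility (ρ x) • grad U x) (4 * mobility (ρ x)) = ∞
  · rw [hfin]; exact le_top
  -- `HasDensities` asks for a measurable gradient, whereas a weak gradient is only almost
  -- everywhere equal to one.
  obtain ⟨g', hg', hgg'⟩ := h.2.2.2.2.2.1.aestronglyMeasurable
  have hprof : HasProfile m μ ρ g' :=
    ⟨h.1, h.2.1, h.2.2.1, h.2.2.2.1, h.2.2.2.2.congr_gradient hgg'⟩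
  have heq : ∫⁻ x, sqQuot (g x + mobility (ρ x) • grad U x) (4 * mobility (ρ x)) =
      ∫⁻ x, sqQuot (g' x + mobility (ρ x) • grad U x) (4 * mobility (ρ x)) := by
    refine lintegral_congr_ae ?_
    filter_upwards [hgg'] with x hx
    rw [hx]
  rw [heq] at hfin ⊢
  have hd := hasDensities_constPath (p := p) (μ := ⟨μ, hμ⟩) hprof hg'.measurable
    (continuous_grad hU one_le_two) hfin
  have hact : action m T E (constPath p ⟨μ, hμ⟩) ≤ ENNReal.ofReal T *
      ∫⁻ x, sqQuot (g' x + mobility (ρ x) • grad U x) (4 * mobility (ρ x)) := by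
    refine (show action m T E (constPath p ⟨μ, hμ⟩) ≤ _ from
      iInf_le_of_le _ (iInf_le_of_le _ (iInf_le_of_le _ (iInf_le _ hd)))).trans (le_of_eq ?_)
    simp only [hE, smul_neg, sub_neg_eq_add, zero_add]
    rw [setLIntegral_const, Real.volume_Icc, sub_zero, mul_comm]
  refine (iInf₂_le (constLaw p ⟨μ, hμ⟩)
    ⟨constLaw_mem_stationaryMass h.1, hasMeanDensity_constLaw _⟩).trans ?_
  refine (mul_le_mul_right ((lintegral_dirac_le _ _).trans hact) _).trans_eq ?_
  rw [← mul_assoc, ENNReal.inv_mul_cancel (ENNReal.ofReal_pos.2 hT).ne' ENNReal.ofReal_ne_top,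
    one_mul]

end ConstantPath

/-! ### Convexity of the level-one rate -/

section Convexity

variable {d : ℕ} {p m T : ℝ}

theorem convex_mPlus : Convex ℝ≥0 (MPlus d) := by
  intro μ hμ ν hν a b _ _ hab
  change (a • μ + b • ν) univ ≤ 1
  have h : (a • μ + b • ν) univ = a * μ.mass + b * ν.mass := by
    rw [FiniteMeasure.coeFn_add, Pi.add_apply, FiniteMeasure.smul_apply,
      FiniteMeasure.smul_apply]
    rfl
  rw [h]
  calc a * μ.mass + b * ν.mass ≤ a * 1 + b * 1 :=
        add_le_add (mul_le_mul_right hμ a) (mul_le_mul_right hν b)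
    _ = 1 := by rw [mul_one, mul_one, hab]

/-- The mixture of two probability measures. -/
def mixture {Ω : Type*} [MeasurableSpace Ω] (a b : ℝ≥0) (hab : a + b = 1)
    (P Q : ProbabilityMeasure Ω) : ProbabilityMeasure Ω :=
  ⟨a • (P : Measure Ω) + b • (Q : Measure Ω), ⟨by
    simp only [Measure.add_apply, Measure.smul_apply, measure_univ, ENNReal.smul_def, smul_eq_mul,
      mul_one]
    exact_mod_cast hab⟩⟩

theorem coe_mixture {Ω : Type*} [MeasurableSpace Ω] (a b : ℝ≥0) (hab : a + b = 1)
    (P Q : ProbabilityMeasure Ω) :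
    (mixture a b hab P Q : Measure Ω) = a • (P : Measure Ω) + b • (Q : Measure Ω) := rfl

theorem mixture_mem_stationaryMass {a b : ℝ≥0} (hab : a + b = 1)
    {P Q : ProbabilityMeasure (PathSpace d p)} (hP : P ∈ stationaryMass d p m)
    (hQ : Q ∈ stationaryMass d p m) : mixture a b hab P Q ∈ stationaryMass d p m := by
  refine ⟨fun t => ⟨measurable_timeShift t, ?_⟩, ?_⟩
  · rw [coe_mixture, Measure.map_add _ _ (measurable_timeShift t), Measure.map_smul,
      Measure.map_smul, (hP.1 t).map_eq, (hQ.1 t).map_eq]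
  · rw [coe_mixture, ae_add_measure_iff]
    exact ⟨Measure.ae_smul_measure hP.2 a, Measure.ae_smul_measure hQ.2 b⟩

theorem HasMeanDensity.mixture {a b : ℝ≥0} (hab : a + b = 1)
    {P Q : ProbabilityMeasure (PathSpace d p)} {μ ν : FiniteMeasure (Torus d)}
    (hP : HasMeanDensity P μ) (hQ : HasMeanDensity Q ν) :
    HasMeanDensity (mixture a b hab P Q) (a • μ + b • ν) := by
  intro t f
  have hi : ∀ R : ProbabilityMeasure (PathSpace d p), Integrable
      (fun z : PathSpace d p => ∫ x, f x ∂((z.dens t : FiniteMeasure (Torus d)) :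
        Measure (Torus d))) (R : Measure (PathSpace d p)) := fun R =>
    (weaklyMeasurable_dens t).integrable (fun z => (z.dens t).2) _ f
  have hf : ∀ η : FiniteMeasure (Torus d), Integrable f (η : Measure (Torus d)) := fun η =>
    f.continuous.integrable_of_hasCompactSupport (HasCompactSupport.of_compactSpace _)
  rw [coe_mixture, integral_add_measure (hi P).smul_measure_nnreal (hi Q).smul_measure_nnreal,
    integral_smul_nnreal_measure, integral_smul_nnreal_measure, hP t f, hQ t f,
    FiniteMeasure.toMeasure_add, FiniteMeasure.toMeasure_smul, FiniteMeasure.toMeasure_smul,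
    integral_add_measure (hf μ).smul_measure_nnreal (hf ν).smul_measure_nnreal,
    integral_smul_nnreal_measure, integral_smul_nnreal_measure]

theorem levelThreeRate_mixture {a b : ℝ≥0} (hab : a + b = 1)
    (E : Torus d → EuclideanSpace ℝ (Fin d)) (P Q : ProbabilityMeasure (PathSpace d p)) :
    levelThreeRate m T E (mixture a b hab P Q) =
      a * levelThreeRate m T E P + b * levelThreeRate m T E Q := by
  unfold levelThreeRate
  rw [coe_mixture, lintegral_add_measure, lintegral_smul_measure, lintegral_smul_measure,
    ENNReal.smul_def, ENNReal.smul_def, smul_eq_mul, smul_eq_mul]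
  ring

theorem convexOn_levelOneDensityRate (E : Torus d → EuclideanSpace ℝ (Fin d)) :
    ConvexOn ℝ≥0 (MPlus d) (levelOneDensityRate p m T E) := by
  refine ⟨convex_mPlus, fun μ _ ν _ a b _ _ hab => ?_⟩
  -- Zero weights are treated apart: multiplication by 0 does not commute with an infimum over the
  -- empty set.
  rcases eq_or_ne a 0 with rfl | ha
  · rw [zero_add] at hab
    simp [hab]
  rcases eq_or_ne b 0 with rfl | hb
  · rw [add_zero] at hab
    simp [hab]
  rw [ENNReal.smul_def, ENNReal.smul_def, smul_eq_mul, smul_eq_mul]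
  conv_rhs => rw [levelOneDensityRate, levelOneDensityRate, iInf_subtype', iInf_subtype',
    ENNReal.mul_iInf_of_ne (by exact_mod_cast ha) ENNReal.coe_ne_top,
    ENNReal.mul_iInf_of_ne (by exact_mod_cast hb) ENNReal.coe_ne_top, ENNReal.iInf_add]
  refine le_iInf fun P => ?_
  rw [ENNReal.add_iInf]
  refine le_iInf fun Q => ?_
  rw [← levelThreeRate_mixture hab]
  exact iInf₂_le _ ⟨mixture_mem_stationaryMass hab P.2.1 Q.2.1, P.2.2.mixture hab Q.2.2⟩

end Convexity

end WASEP

end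

/-! ### The two inequalities combined -/

theorem theorem2p4 (d : ℕ) (hd : 1 ≤ d) (p m T : ℝ) (hp : ((d : ℝ) + 2) / 2 < p)
    (hm0 : 0 < m) (hm1 : m < 1) (hT : 0 < T)
    (U : WASEP.Torus d → ℝ) (hU : WASEP.TorusContDiff 2 U)
    (E : WASEP.Torus d → EuclideanSpace ℝ (Fin d)) (hE : ∀ x, E x = -WASEP.grad U x) :
    ∀ π ∈ WASEP.MPlus d,
      WASEP.levelOneDensityRate p m T E π =
        WASEP.convexHullFun (WASEP.MPlus d) (WASEP.fisherFunctional m U) π := by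
  intro π hπ
  refine le_antisymm ?_ (WASEP.convexHullFun_le_levelOneDensityRate hd hT hU hE hπ)
  exact le_iSup₂ (f := fun (f : MeasureTheory.FiniteMeasure (WASEP.Torus d) → ENNReal) _ => f π)
    (WASEP.levelOneDensityRate p m T E) ⟨WASEP.convexOn_levelOneDensityRate E,
      fun ν hν => WASEP.levelOneDensityRate_le_fisherFunctional hT hU hE hν⟩
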